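/- For $N\ge 1$ and a real number $\xi$, let $\lambda_N(\xi)\in[-\infty,\infty]$ (respectively $\widehat\lambda_N(\xi)$) be the supremum of the real numbers $\lambda$ such that the system $$1\le |x|\le X,\qquad \max_{1\le j\le N}|\xi^j x-y_j|\le X^{-\lambda}$$ has a solution $(x,y_1,\dots,y_N)\in\mathbb{Z}^{N+1}$ for arbitrarily large real $X$ (respectively for all sufficiently large real $X$). A real number $\xi$ is called extremal (in the sense of Roy) if it is not algebraic of degree at most $2$ over $\mathbb{Q}$ and there is a constant $c>0$ such that for every real $X\ge 1$ there are integers $x_0,x_1,x_2$ with $1\le |x_0|\le X$, $|x_0\xi-x_1|\le cX^{-1/\gamma}$ and $|x_0\xi^2-x_2|\le cX^{-1/\gamma}$, where $\gamma=(1+\sqrt5)/2$. For every irrational real number $\xi$ the exponent $\widehat\lambda_2(\xi)$ is finite and $$\lambda_3(\xi)\ \ge\ \frac{-\widehat\lambda_2(\xi)^2+3\widehat\lambda_2(\xi)-1}{3\widehat\lambda_2(\xi)^2-5\widehat\lambda_2(\xi)+3},\qquad \lambda_4(\xi)\ \ge\ \frac{-2\widehat\lambda_2(\xi)^2+5\widehat\lambda_2(\xi)-2}{4\widehat\lambda_2(\xi)^2-7\widehat\lambda_2(\xi)+4},$$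 and equality holds in the first inequality if $\xi$ is an extremal number. For rational $\xi$ one has $\widehat\lambda_2(\xi)=\lambda_3(\xi)=\lambda_4(\xi)=+\infty$. -/

import Mathlib

open Filter

/-- `(x, y)` ranges over integer points: the system `1 ≤ |x| ≤ X`, `max_j |ξ_j x - y_j| ≤ X ^ (-l)`
has an integer solution. -/
def SimApproxSolvable {N : ℕ} (ξ : Fin N → ℝ) (l X : ℝ) : Prop :=
  ∃ (x : ℤ) (y : Fin N → ℤ), 1 ≤ |(x : ℝ)| ∧ |(x : ℝ)| ≤ X ∧
    ∀ j : Fin N, |ξ j * (x : ℝ) - (y j : ℝ)| ≤ X ^ (-l)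

/-- The ordinary exponent of simultaneous approximation of a real vector: the supremum of the
real `l` for which the system is solvable for arbitrarily large `X`. -/
noncomputable def ordinaryExponentVec {N : ℕ} (ξ : Fin N → ℝ) : EReal :=
  sSup {e : EReal | ∃ l : ℝ, e = (l : EReal) ∧ ∃ᶠ X : ℝ in atTop, SimApproxSolvable ξ l X}

/-- The uniform exponent of simultaneous approximation of a real vector: the supremum of the
real `l` for which the system is solvable for all large `X`. -/
noncomputable def uniformExponentVec {N : ℕ} (ξ : Fin N → ℝ) : EReal :=
  sSup {e : EReal | ∃ l : ℝ, e = (l : EReal) ∧ ∀ᶠ X : ℝ in atTop, SimApproxSolvable ξ l X}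

/-- The point `(ξ, ξ ^ 2, …, ξ ^ N)` on the Veronese curve. -/
def veronesePoint (N : ℕ) (ξ : ℝ) : Fin N → ℝ := fun j => ξ ^ ((j : ℕ) + 1)

/-- The exponent `λ_N(ξ)`, with values in `[-∞, ∞]`. -/
noncomputable def ordinaryExponent (N : ℕ) (ξ : ℝ) : EReal :=
  ordinaryExponentVec (veronesePoint N ξ)

/-- The uniform exponent `λ̂_N(ξ)`, with values in `[-∞, ∞]`. -/
noncomputable def uniformExponent (N : ℕ) (ξ : ℝ) : EReal :=
  uniformExponentVec (veronesePoint N ξ)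

/-- Extremal numbers in the sense of Roy: `ξ` is not algebraic of degree at most two, and for some
constant `c > 0` the system `1 ≤ |x₀| ≤ X`, `|x₀ ξ - x₁| ≤ c X ^ (-1/γ)`,
`|x₀ ξ ^ 2 - x₂| ≤ c X ^ (-1/γ)` has an integer solution for every real `X ≥ 1`, where `γ` is the
golden ratio. -/
def IsExtremalNumber (ξ : ℝ) : Prop :=
  (∀ p : Polynomial ℤ, p ≠ 0 → p.natDegree ≤ 2 → Polynomial.aeval ξ p ≠ 0) ∧
  ∃ c : ℝ, 0 < c ∧ ∀ X : ℝ, 1 ≤ X → ∃ x₀ x₁ x₂ : ℤ,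
    1 ≤ |(x₀ : ℝ)| ∧ |(x₀ : ℝ)| ≤ X ∧
    |(x₀ : ℝ) * ξ - (x₁ : ℝ)| ≤ c * X ^ (-(1 / Real.goldenRatio)) ∧
    |(x₀ : ℝ) * ξ ^ 2 - (x₂ : ℝ)| ≤ c * X ^ (-(1 / Real.goldenRatio))

/-! Suppose first that `ξ` is not algebraic of degree at most two, and put `l = λ̂_2(ξ)`. Both lower
bounds come from one mechanism in two stages. Stage one: for an exponent slightly below `l`, still
written `l`, take primitive integer points near the line of `(1, ξ, ξ²)` at the scales `2 ^ j`. At a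
place where the points leave a plane, with scales `M ≤ M'`, the cross product of two points is an
integer quadratic polynomial of height `H ≪ M ^ (1 - l)` whose value at `ξ` is `≪ M ^ (-l) * M' ^
(-l)`. Three independent points have determinant at least 1, so `M ^ l ≪ M' ^ (1 - l)`. Eliminating
`M` and `M'` leaves a value `≪ H ^ (-W)` with `W = l / (1 - l) ^ 2`
(`IsDyadicSequence.exists_small_values`). Stage two: if `a T² + b T + c` is small at `ξ`, a
pigeonhole argument produces integers obeying the recurrence `a x_{i+2} + b x_{i+1} + c x_i = 0` for
`i < n` and starting close to a geometric progression of ratio `ξ`; they stay close to it.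
Optimizing yields `λ_{n+1}(ξ) ≥ (W + 1 - n) / (W + n + 1)` (`le_ordinaryExponent_of_small_values`),
and `n = 2, 3` are the two fractions.

For extremal `ξ`, the Davenport–Schmidt inequality `l² + l ≤ 1` (`IsDyadicSequence.sq_add_le_one`)
gives `l = 1 / γ`, and then all estimates of stage one are sharp up to constants. This produces a
sequence `y k` with first coordinates `Y_{k+1} ≍ Y_k ^ γ` and errors `≪ 1 / Y_k`
(`exists_isExtremalSequence`). Two facts about it give the upper bound `l / (2 - l)` for `λ_3`.
First, `|q ξ - p| ≫ |q| ^ (-1 - δ)` for every `δ > 0`: a descent through the matrices of `y k` turns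
an excess `δ` into `2 δ`, and an excess of at least 1 is impossible. Second, if `(x₀, x₁, x₂, x₃)`
approximates `(1, ξ, ξ², ξ³)` too well, both `(x₀, x₁, x₂)` and `(x₁, x₂, x₃)` lie in the plane of
some `y k, y (k + 1)`; their cross products with `y k` are integer multiples `t` and `s` of the
primitive normal, and `s / t` approximates `ξ` better than the first fact allows.

Quadratic irrationals have `λ̂_2 = 1` and `λ_N ≥ 1`, where both fractions equal 1. Rational numbers
are approximated with error 0. -/

/-! ### Exponents: formal properties and rational numbers -/

lemma SimApproxSolvable.mono {N : ℕ} {v : Fin N → ℝ} {l l' X : ℝ} (hX : 1 ≤ X) (hl : l' ≤ l)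
    (h : SimApproxSolvable v l X) : SimApproxSolvable v l' X := by
  obtain ⟨x, y, h1, h2, h3⟩ := h
  exact ⟨x, y, h1, h2, fun j => (h3 j).trans
    (Real.rpow_le_rpow_of_exponent_le hX (neg_le_neg hl))⟩

lemma le_ordinaryExponentVec {N : ℕ} {v : Fin N → ℝ} {l : ℝ}
    (h : ∃ᶠ X : ℝ in atTop, SimApproxSolvable v l X) : (l : EReal) ≤ ordinaryExponentVec v :=
  le_sSup ⟨l, rfl, h⟩

lemma le_uniformExponentVec {N : ℕ} {v : Fin N → ℝ} {l : ℝ}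
    (h : ∀ᶠ X : ℝ in atTop, SimApproxSolvable v l X) : (l : EReal) ≤ uniformExponentVec v :=
  le_sSup ⟨l, rfl, h⟩

lemma frequently_of_lt_ordinaryExponentVec {N : ℕ} {v : Fin N → ℝ} {l : ℝ}
    (h : (l : EReal) < ordinaryExponentVec v) :
    ∃ᶠ X : ℝ in atTop, SimApproxSolvable v l X := by
  obtain ⟨e, ⟨m, rfl, hm⟩, hlt⟩ := lt_sSup_iff.1 h
  have hlm : l < m := by exact_mod_cast hlt
  exact (hm.and_eventually (eventually_ge_atTop 1)).mono fun X hX => hX.1.mono hX.2 hlm.le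

lemma eventually_of_lt_uniformExponentVec {N : ℕ} {v : Fin N → ℝ} {l : ℝ}
    (h : (l : EReal) < uniformExponentVec v) :
    ∀ᶠ X : ℝ in atTop, SimApproxSolvable v l X := by
  obtain ⟨e, ⟨m, rfl, hm⟩, hlt⟩ := lt_sSup_iff.1 h
  have hlm : l < m := by exact_mod_cast hlt
  filter_upwards [hm, eventually_ge_atTop 1] with X hX h1 using hX.mono h1 hlm.le

lemma uniformExponentVec_le_ordinaryExponentVec {N : ℕ} (v : Fin N → ℝ) :
    uniformExponentVec v ≤ ordinaryExponentVec v :=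
  sSup_le fun _ ⟨_, he, hl⟩ => he ▸ le_ordinaryExponentVec hl.frequently

lemma uniformExponentVec_nonneg {N : ℕ} (v : Fin N → ℝ) : 0 ≤ uniformExponentVec v := by
  refine le_uniformExponentVec (l := 0) ?_
  filter_upwards [eventually_ge_atTop 1] with X hX
  refine ⟨1, fun j => round (v j), by simp, by simpa using hX, fun j => ?_⟩
  have := abs_sub_round (v j)
  simp only [Int.cast_one, mul_one, neg_zero, Real.rpow_zero]
  linarith

/-- `C * X ^ (-s)` is eventually small. -/
lemma exists_mul_rpow_neg_lt (C : ℝ) {s e : ℝ} (hs : 0 < s) (he : 0 < e) :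
    ∃ B : ℝ, 1 ≤ B ∧ ∀ X, B ≤ X → C * X ^ (-s) < e := by
  have h := (tendsto_rpow_neg_atTop hs).const_mul C
  rw [mul_zero] at h
  obtain ⟨B, hB⟩ := eventually_atTop.1 (h.eventually_lt_const he)
  exact ⟨max B 1, le_max_right _ _, fun X hX => hB X ((le_max_left _ _).trans hX)⟩

/-- With the `N`-th power of the denominator as multiplier, all the powers of `ξ` involved become
integers and the error is exactly 0. -/
lemma exponents_eq_top_of_rational {ξ : ℝ} (h : ¬ Irrational ξ) (N : ℕ) :
    uniformExponent N ξ = ⊤ ∧ ordinaryExponent N ξ = ⊤ := by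
  have key : uniformExponent N ξ = ⊤ := by
    rw [Irrational, not_not] at h
    obtain ⟨r, rfl⟩ := h
    rw [EReal.eq_top_iff_forall_lt]
    intro y
    refine lt_of_lt_of_le (b := ((y + 1 : ℝ) : EReal)) (by exact_mod_cast lt_add_one y) ?_
    refine le_uniformExponentVec ?_
    have hd : (0 : ℝ) < r.den := by exact_mod_cast r.den_pos
    have hr : (r : ℝ) * r.den = r.num := by exact_mod_cast Rat.mul_den_eq_num r
    filter_upwards [eventually_ge_atTop ((r.den : ℝ) ^ N), eventually_ge_atTop 1] with X hX h1
    refine ⟨(r.den : ℤ) ^ N, fun j => r.num ^ ((j : ℕ) + 1) * (r.den : ℤ) ^ (N - (j + 1)), ?_, ?_,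
      fun j => ?_⟩
    · push_cast
      rw [abs_of_pos (by positivity)]
      exact one_le_pow₀ (by exact_mod_cast r.den_pos)
    · push_cast
      rwa [abs_of_pos (by positivity)]
    · have hj : (j : ℕ) + 1 + (N - (j + 1)) = N := by have := j.2; omega
      have : veronesePoint N r j * (((r.den : ℤ) ^ N : ℤ) : ℝ) -
          ((r.num ^ ((j : ℕ) + 1) * (r.den : ℤ) ^ (N - (j + 1)) : ℤ) : ℝ) = 0 := by
        push_cast
        rw [← hr, veronesePoint, mul_pow, mul_assoc, ← pow_add, hj, sub_self]
      rw [this, abs_zero]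
      positivity
  exact ⟨key, top_le_iff.1 (key ▸ uniformExponentVec_le_ordinaryExponentVec _)⟩

/-! ### Irrational numbers: the uniform exponent is at most 1 -/

/-- Nonzero integer multiples of an irrational number, with bounded multiplier, stay away from the
integers. -/
lemma Irrational.exists_pos_le_abs_mul_sub {ξ : ℝ} (hξ : Irrational ξ) (B : ℝ) :
    ∃ m : ℝ, 0 < m ∧ ∀ q p : ℤ, q ≠ 0 → |(q : ℝ)| ≤ B → m ≤ |(q : ℝ) * ξ - p| := by
  have key : ∀ n : ℕ, ∃ m : ℝ, 0 < m ∧ ∀ q p : ℤ, q ≠ 0 → q.natAbs ≤ n →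
      m ≤ |(q : ℝ) * ξ - p| := by
    intro n
    induction n with
    | zero => exact ⟨1, one_pos, fun q p hq h => absurd (by omega) hq⟩
    | succ n ih =>
      obtain ⟨m, hm, h⟩ := ih
      have hirr : Irrational (((n + 1 : ℕ) : ℝ) * ξ) := hξ.natCast_mul (by omega)
      set e := |((n + 1 : ℕ) : ℝ) * ξ - round (((n + 1 : ℕ) : ℝ) * ξ)| with he
      have hpos : 0 < e := abs_pos.2 (sub_ne_zero.2 (hirr.ne_int _))
      have hz : ∀ p : ℤ, e ≤ |((n + 1 : ℕ) : ℝ) * ξ - p| := fun p => round_le _ p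
      refine ⟨min m e, lt_min hm hpos, fun q p hq hqn => ?_⟩
      rcases Nat.lt_or_ge q.natAbs (n + 1) with h1 | h1
      · exact (min_le_left _ _).trans (h q p hq (by omega))
      · refine (min_le_right _ _).trans ?_
        rcases Int.natAbs_eq q with h2 | h2
        · have : (q : ℝ) = ((n + 1 : ℕ) : ℝ) := by
            have : q = ((n + 1 : ℕ) : ℤ) := by omega
            exact_mod_cast congrArg (Int.cast : ℤ → ℝ) this
          rw [this]; exact hz p
        · have : (q : ℝ) = -((n + 1 : ℕ) : ℝ) := by
            have : q = -((n + 1 : ℕ) : ℤ) := by omega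
            exact_mod_cast congrArg (Int.cast : ℤ → ℝ) this
          have h3 := hz (-p)
          rw [this, ← abs_neg]
          rwa [show -(-((n + 1 : ℕ) : ℝ) * ξ - p) = ((n + 1 : ℕ) : ℝ) * ξ - ((-p : ℤ) : ℝ) by
            push_cast; ring]
  obtain ⟨m, hm, h⟩ := key ⌊B⌋₊
  refine ⟨m, hm, fun q p hq hqB => h q p hq (Nat.le_floor ?_)⟩
  rwa [Nat.cast_natAbs, Int.cast_abs]

/-- If some `l > 1` were admissible, solutions `(x, y)` at consecutive scales `X` and `2 X` would
have determinant `≪ X ^ (1 - l) < 1`, hence 0. All of them would then lie on one line through the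
origin while their errors tend to 0, which irrationality forbids. Only the first coordinate `ξ` is
used. -/
lemma uniformExponent_two_le_one {ξ : ℝ} (hξ : Irrational ξ) : uniformExponent 2 ξ ≤ 1 := by
  by_contra! hlt
  obtain ⟨l, hl1, hl⟩ := EReal.lt_iff_exists_real_btwn.1 hlt
  have hl1 : 1 < l := by exact_mod_cast hl1
  obtain ⟨X₀, hX₀⟩ := eventually_atTop.1 (eventually_of_lt_uniformExponentVec hl)
  obtain ⟨B, hB1, hB⟩ := exists_mul_rpow_neg_lt 3 (sub_pos.2 hl1) one_pos
  set A := max X₀ B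
  have hA1 : 1 ≤ A := hB1.trans (le_max_right _ _)
  have hpow : ∀ n : ℕ, A ≤ A * 2 ^ n := fun n =>
    le_mul_of_one_le_right (by linarith) (one_le_pow₀ (by norm_num))
  have hsol : ∀ n : ℕ, ∃ x y : ℤ, x ≠ 0 ∧ |(x : ℝ)| ≤ A * 2 ^ n ∧
      |(x : ℝ) * ξ - y| ≤ (A * 2 ^ n) ^ (-l) := by
    intro n
    obtain ⟨x, y, h1, h2, h3⟩ := hX₀ (A * 2 ^ n) ((le_max_left _ _).trans (hpow n))
    refine ⟨x, y 0, ?_, h2, ?_⟩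
    · rintro rfl; norm_num at h1
    · have := h3 0
      simp only [veronesePoint, Fin.val_zero, zero_add, pow_one] at this
      rwa [mul_comm]
  choose x y hx0 hx hy using hsol
  have hstep : ∀ n, x n * y (n + 1) = x (n + 1) * y n := by
    intro n
    set X := A * 2 ^ n with hX
    have hX1 : 1 ≤ X := hA1.trans (hpow n)
    have h2 : A * 2 ^ (n + 1) = 2 * X := by rw [hX]; ring
    have e1 := hx n
    have e2 := hx (n + 1)
    have e3 := hy n
    have e4 := hy (n + 1)
    rw [h2] at e2 e4
    have e5 : (2 * X) ^ (-l) ≤ X ^ (-l) :=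
      Real.rpow_le_rpow_of_nonpos (by linarith) (by linarith) (by linarith)
    have hp : 0 < X ^ (-l) := by positivity
    have e6 : X * X ^ (-l) = X ^ (-(l - 1)) := by
      rw [neg_sub, sub_eq_add_neg, Real.rpow_add (by linarith), Real.rpow_one]
    have hb := hB X (le_trans (le_max_right _ _) (hpow n))
    have : |((x n * y (n + 1) - x (n + 1) * y n : ℤ) : ℝ)| < 1 := by
      have : ((x n * y (n + 1) - x (n + 1) * y n : ℤ) : ℝ) =
        x (n + 1) * (x n * ξ - y n) - x n * (x (n + 1) * ξ - y (n + 1)) := by push_cast; ring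
      rw [this]
      refine (abs_sub _ _).trans_lt ?_
      rw [abs_mul, abs_mul]
      have f1 : |(x (n + 1) : ℝ)| * |x n * ξ - y n| ≤ (2 * X) * X ^ (-l) :=
        mul_le_mul e2 e3 (abs_nonneg _) (by linarith)
      have f2 : |(x n : ℝ)| * |x (n + 1) * ξ - y (n + 1)| ≤ X * X ^ (-l) :=
        mul_le_mul e1 (e4.trans e5) (abs_nonneg _) (by linarith)
      rw [← e6] at hb
      linarith
    have h0 : x n * y (n + 1) - x (n + 1) * y n = 0 := by
      rw [← Int.abs_lt_one_iff]; exact_mod_cast this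
    linarith
  have hall : ∀ n, x 0 * y n = x n * y 0 := by
    intro n
    induction n with
    | zero => ring
    | succ n ih =>
      have h := hstep n
      have : x n * (x 0 * y (n + 1)) = x n * (x (n + 1) * y 0) := by
        linear_combination x 0 * h + x (n + 1) * ih
      exact mul_left_cancel₀ (hx0 n) this
  have hne : x 0 * ξ - y 0 ≠ 0 := by
    have := (hξ.intCast_mul (hx0 0)).ne_int (y 0)
    exact sub_ne_zero.2 this
  have hpos : 0 < |(x 0 : ℝ) * ξ - y 0| := abs_pos.2 hne
  have hx0' : (0 : ℝ) < |(x 0 : ℝ)| := abs_pos.2 (by exact_mod_cast hx0 0)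
  obtain ⟨B', hB'1, hB'⟩ := exists_mul_rpow_neg_lt |(x 0 : ℝ)| (by linarith : 0 < l) hpos
  obtain ⟨n, hn⟩ := pow_unbounded_of_one_lt B' (one_lt_two : (1 : ℝ) < 2)
  have h1 := hB' (A * 2 ^ n) (hn.le.trans (le_mul_of_one_le_left (by positivity) hA1))
  have h2 := mul_le_mul_of_nonneg_left (hy n) (abs_nonneg (x 0 : ℝ))
  -- By proportionality the error of the `n`-th solution is at least a fixed positive multiple of
  -- the error of the first one.
  have h3 : |(x 0 : ℝ)| * |x n * ξ - y n| = |(x n : ℝ)| * |x 0 * ξ - y 0| := by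
    rw [← abs_mul, ← abs_mul]
    have := congrArg (Int.cast : ℤ → ℝ) (hall n)
    push_cast at this
    congr 1
    linear_combination -this
  have h4 : 1 ≤ |(x n : ℝ)| := by exact_mod_cast Int.one_le_abs (hx0 n)
  nlinarith [abs_nonneg ((x 0 : ℝ) * ξ - y 0)]

/-! ### Quadratic irrationals -/

lemma exists_int_quadratic {ξ : ℝ} (hξ : Irrational ξ) {p : Polynomial ℤ} (hp : p ≠ 0)
    (hd : p.natDegree ≤ 2) (h : Polynomial.aeval ξ p = 0) :
    ∃ a b c : ℤ, a ≠ 0 ∧ (a : ℝ) * ξ ^ 2 + b * ξ + c = 0 := by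
  have h0 := h
  rw [Polynomial.aeval_eq_sum_range' (Nat.lt_succ_of_le hd)] at h
  simp only [Finset.sum_range_succ, Finset.sum_range_zero, zsmul_eq_mul, pow_zero, mul_one,
    pow_one, zero_add] at h
  refine ⟨p.coeff 2, p.coeff 1, p.coeff 0, fun h2 => ?_, by linarith⟩
  rw [h2, Int.cast_zero, zero_mul, add_zero] at h
  by_cases h1 : p.coeff 1 = 0
  · rw [h1, Int.cast_zero, zero_mul, add_zero] at h
    have h3 : p.coeff 0 = 0 := by exact_mod_cast h
    apply hp
    ext n
    match n with
    | 0 => simpa using h3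
    | 1 => simpa using h1
    | 2 => simpa using h2
    | n + 3 => simpa using Polynomial.coeff_eq_zero_of_natDegree_lt (by omega)
  · have := (hξ.intCast_mul h1).ne_int (-p.coeff 0)
    apply this
    push_cast
    linarith

/-- Since `(a ξ) ^ j` lies in `ℤ + ℤ ξ`, a Dirichlet approximation `p / q` of `ξ` approximates all
powers at once, with common multiplier `a ^ N * q` and a loss of only a constant factor. -/
lemma one_le_uniformExponent_of_quadratic {ξ : ℝ} {a b c : ℤ} (ha : a ≠ 0)
    (h : (a : ℝ) * ξ ^ 2 + b * ξ + c = 0) (N : ℕ) : 1 ≤ uniformExponent N ξ := by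
  have hlin : ∀ j : ℕ, ∃ u v : ℤ, (a : ℝ) ^ j * ξ ^ j = u + v * ξ := by
    intro j
    induction j with
    | zero => exact ⟨1, 0, by simp⟩
    | succ j ih =>
      obtain ⟨u, v, huv⟩ := ih
      refine ⟨-v * c, a * u - v * b, ?_⟩
      push_cast
      linear_combination (a : ℝ) * ξ * huv + v * h
  choose u v huv using hlin
  set V : ℝ := ∑ j ∈ Finset.range (N + 1), |(a : ℝ) ^ (N - j) * v j| with hV
  set A : ℝ := |(a : ℝ)| ^ N with hA
  have hA1 : 1 ≤ A := one_le_pow₀ (by exact_mod_cast Int.one_le_abs ha)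
  have hV0 : 0 ≤ V := Finset.sum_nonneg fun _ _ => abs_nonneg _
  refine EReal.ge_of_forall_gt_iff_ge.1 fun l hl => le_uniformExponentVec ?_
  have hl : l < 1 := by exact_mod_cast hl
  obtain ⟨B, hB1, hB⟩ := exists_mul_rpow_neg_lt (V * A) (sub_pos.2 hl) one_pos
  filter_upwards [eventually_ge_atTop B, eventually_ge_atTop A] with X hXB hXA
  have hX1 : 1 ≤ X := hA1.trans hXA
  -- Dirichlet is applied at scale `X / A`, so that `|a| ^ N * q ≤ X`.
  have hn : 0 < ⌊X / A⌋₊ := Nat.floor_pos.2 ((one_le_div (by linarith)).2 hXA)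
  obtain ⟨p, q, hq0, hqn, hpq⟩ := Real.exists_int_int_abs_mul_sub_le ξ hn
  have hqX : (q : ℝ) ≤ X / A := by
    refine le_trans ?_ (Nat.floor_le (by positivity))
    exact_mod_cast hqn
  have hq0' : (0 : ℝ) < q := by exact_mod_cast hq0
  refine ⟨a ^ N * q, fun j => a ^ (N - (j + 1)) * (u (j + 1) * q + v (j + 1) * p), ?_, ?_, ?_⟩
  · exact_mod_cast Int.one_le_abs (mul_ne_zero (pow_ne_zero _ ha) hq0.ne')
  · push_cast
    rw [abs_mul, abs_pow, abs_of_pos hq0', mul_comm]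
    exact (le_div_iff₀ (by linarith)).1 hqX
  · intro j
    have hj : N - (j + 1) + ((j : ℕ) + 1) = N := by have := j.2; omega
    have e : veronesePoint N ξ j * ((a ^ N * q : ℤ) : ℝ) -
        ((a ^ (N - (j + 1)) * (u (j + 1) * q + v (j + 1) * p) : ℤ) : ℝ) =
        ((a : ℝ) ^ (N - ((j : ℕ) + 1)) * v (j + 1)) * (q * ξ - p) := by
      have h1 := huv (j + 1)
      have h2 : (a : ℝ) ^ N = a ^ (N - ((j : ℕ) + 1)) * a ^ ((j : ℕ) + 1) := by rw [← pow_add, hj]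
      push_cast
      rw [veronesePoint, h2]
      linear_combination (a : ℝ) ^ (N - ((j : ℕ) + 1)) * q * h1
    rw [e, abs_mul]
    have f1 : |(a : ℝ) ^ (N - ((j : ℕ) + 1)) * v (j + 1)| ≤ V :=
      Finset.single_le_sum (f := fun j => |(a : ℝ) ^ (N - j) * v j|) (fun _ _ => abs_nonneg _)
        (Finset.mem_range.2 (by have := j.2; omega : (j : ℕ) + 1 < N + 1))
    have f2 : |(q : ℝ) * ξ - p| ≤ A / X := by
      refine hpq.trans ?_
      rw [div_le_div_iff₀ (by positivity) (by linarith), one_mul]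
      have := (Nat.lt_floor_add_one (X / A)).le
      rw [div_le_iff₀ (by linarith)] at this
      linarith
    have f3 : V * A * X ^ (-(1 - l)) = V * (A / X) * X ^ (-(-l)) := by
      rw [neg_sub, neg_neg, Real.rpow_sub (by linarith), Real.rpow_one]; ring
    have f4 := hB X hXB
    rw [f3, Real.rpow_neg (by linarith) (-l), ← div_eq_mul_inv,
      div_lt_one (by positivity)] at f4
    exact (mul_le_mul f1 f2 (abs_nonneg _) hV0).trans f4.le

/-! ### From small values of quadratic polynomials to simultaneous approximation -/

/-- The integer sequence starting with `x`, `⌊x * η⌋` and following, up to rounding, the linear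
recurrence with characteristic polynomial `a T ^ 2 + b T + c`. -/
noncomputable def roundedRecurrence (η : ℝ) (a b c x : ℤ) : ℕ → ℤ
  | 0 => x
  | 1 => ⌊x * η⌋
  | n + 2 => -(c * roundedRecurrence η a b c x n + b * roundedRecurrence η a b c x (n + 1)) / a

/-- Pigeonhole principle: an integer recurrent sequence which is close to a geometric progression
in its first two terms. -/
lemma exists_recurrent_sequence (η : ℝ) (n : ℕ) {a : ℤ} (ha : a ≠ 0) (b c : ℤ) {K : ℕ}
    (hK : 0 < K) :
    ∃ x : ℕ → ℤ, x 0 ≠ 0 ∧ |(x 0 : ℝ)| ≤ K * |(a : ℝ)| ^ n ∧ |x 0 * η - x 1| ≤ 1 / K ∧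
      ∀ i < n, a * x (i + 2) + b * x (i + 1) + c * x i = 0 := by
  set g := roundedRecurrence η a b c with hg
  set A := a.natAbs with hA
  have hA0 : 0 < A := Int.natAbs_pos.2 ha
  set r : ℤ → ℕ → ℤ := fun x i => -(c * g x i + b * g x (i + 1)) % a with hr
  have hr0 : ∀ x i, 0 ≤ r x i := fun x i => Int.emod_nonneg _ ha
  have hrA : ∀ x i, (r x i).toNat < A := fun x i => by
    have := Int.emod_lt_abs (-(c * g x i + b * g x (i + 1))) ha
    have h0 := hr0 x i
    have h1 : |a| = A := Int.abs_eq_natAbs a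
    simp only [hr] at h0 ⊢
    omega
  have hrec : ∀ x i, a * g x (i + 2) + b * g x (i + 1) + c * g x i = - r x i := fun x i => by
    have h := Int.mul_ediv_add_emod (-(c * g x i + b * g x (i + 1))) a
    have h2 : g x (i + 2) = -(c * g x i + b * g x (i + 1)) / a := rfl
    rw [h2]
    simp only [hr]
    linarith
  have hK' : (0 : ℝ) < K := by exact_mod_cast hK
  have hbin : ∀ x : ℤ, ⌊(K : ℝ) * Int.fract ((x : ℝ) * η)⌋₊ < K := fun x => by
    rw [Nat.floor_lt (mul_nonneg hK'.le (Int.fract_nonneg _))]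
    exact mul_lt_of_lt_one_right hK' (Int.fract_lt_one _)
  -- There are `K * A ^ n` boxes: one of `K` intervals for the fractional part of `x * η`, and the
  -- remainders modulo `a` in the first `n` steps. Two starting values in the same box have rounding
  -- defects that cancel, so the difference of their sequences satisfies the recurrence exactly.
  let f : Fin (K * A ^ n + 1) → Fin K × (Fin n → Fin A) := fun x =>
    (⟨⌊(K : ℝ) * Int.fract (((x : ℕ) : ℤ) * η : ℝ)⌋₊, hbin _⟩,
      fun i => ⟨(r ((x : ℕ) : ℤ) i).toNat, hrA _ _⟩)
  obtain ⟨x, y, hxy, hf⟩ := Fintype.exists_ne_map_eq_of_card_lt f (by simp)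
  simp only [f, Prod.mk.injEq, Fin.mk.injEq] at hf
  obtain ⟨hf1, hf2⟩ := hf
  set u : ℤ := ((x : ℕ) : ℤ) with hu
  set v : ℤ := ((y : ℕ) : ℤ) with hv
  have huv : u ≠ v := fun h => hxy (Fin.ext (by rw [hu, hv] at h; exact_mod_cast h))
  refine ⟨fun i => g u i - g v i, ?_, ?_, ?_, fun i hi => ?_⟩
  · exact sub_ne_zero.2 huv
  · have h1 : |u - v| ≤ (K * A ^ n : ℕ) := by
      have := x.2
      have := y.2
      rw [abs_le]; omega
    have h2 : ((K * A ^ n : ℕ) : ℝ) = K * |(a : ℝ)| ^ n := by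
      rw [Nat.cast_mul, Nat.cast_pow, hA, Nat.cast_natAbs, Int.cast_abs]
    rw [← h2]
    have h3 : ((|u - v| : ℤ) : ℝ) ≤ ((K * A ^ n : ℕ) : ℝ) := by exact_mod_cast h1
    rw [Int.cast_abs] at h3
    exact h3
  · have e : (((g u 0 - g v 0 : ℤ) : ℝ)) * η - ((g u 1 - g v 1 : ℤ) : ℝ) =
        Int.fract ((u : ℝ) * η) - Int.fract ((v : ℝ) * η) := by
      have h1 : g u 1 = ⌊(u : ℝ) * η⌋ := rfl
      have h2 : g v 1 = ⌊(v : ℝ) * η⌋ := rfl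
      have h3 : g u 0 = u := rfl
      have h4 : g v 0 = v := rfl
      rw [h1, h2, h3, h4, ← Int.self_sub_floor, ← Int.self_sub_floor]
      push_cast
      ring
    rw [e, le_div_iff₀ hK']
    nth_rewrite 1 [← abs_of_pos hK']
    rw [← abs_mul, sub_mul]
    have b1 := Nat.floor_le (mul_nonneg hK'.le (Int.fract_nonneg ((u : ℝ) * η)))
    have b2 := Nat.lt_floor_add_one ((K : ℝ) * Int.fract ((u : ℝ) * η))
    have b3 := Nat.floor_le (mul_nonneg hK'.le (Int.fract_nonneg ((v : ℝ) * η)))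
    have b4 := Nat.lt_floor_add_one ((K : ℝ) * Int.fract ((v : ℝ) * η))
    rw [hf1] at b1 b2
    rw [abs_le]
    constructor <;> linarith
  · have h1 := hrec u i
    have h2 := hrec v i
    have h3 := congrFun hf2 ⟨i, hi⟩
    simp only [Fin.mk.injEq] at h3
    have h4 : r u i = r v i := by
      have := hr0 u i
      have := hr0 v i
      omega
    linear_combination h1 - h2 - h4

/-- The errors `x 0 * η ^ j - x j` obey the same recurrence, with the extra term `x 0 * η ^ i * (c +
b η + a η²)`. Dominance of `a` keeps `b / a` and `c / a` bounded, so each step enlarges the errors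
by a bounded factor. -/
lemma exists_approx_of_dominant_leading (η : ℝ) (n : ℕ) {ε : ℝ} (hε : 0 < ε) :
    ∃ D : ℝ, 1 ≤ D ∧ ∀ (a b c : ℤ) (K : ℕ), a ≠ 0 → 0 < K → ε * |(b : ℝ)| ≤ |(a : ℝ)| →
      |(c : ℝ) + b * η + a * η ^ 2| ≤ 1 →
      ∃ x : ℕ → ℤ, x 0 ≠ 0 ∧ |(x 0 : ℝ)| ≤ K * |(a : ℝ)| ^ n ∧
        ∀ j ≤ n + 1, |x 0 * η ^ j - x j| ≤
          D * (1 / K + |(x 0 : ℝ)| * |(c : ℝ) + b * η + a * η ^ 2| / |(a : ℝ)|) := by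
  -- `R` is taken so large that `1 + R / ε + (1 + |η| / ε + η²) ≤ R²`, which is what the induction
  -- on `j` needs, and `|η| ≤ R`.
  set R : ℝ := 1 / ε + 2 + |η| / ε + η ^ 2 + |η| with hR
  have hR1 : 1 ≤ R := by
    have : 0 ≤ 1 / ε + |η| / ε + η ^ 2 + |η| := by positivity
    linarith
  refine ⟨R ^ (n + 1), one_le_pow₀ hR1, fun a b c K ha hK hb hθ => ?_⟩
  obtain ⟨x, hx0, hxK, hx1, hrec⟩ := exists_recurrent_sequence η n ha b c hK
  refine ⟨x, hx0, hxK, ?_⟩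
  set θ := |(c : ℝ) + b * η + a * η ^ 2| with hθd
  set T := 1 / K + |(x 0 : ℝ)| * θ / |(a : ℝ)| with hT
  have ha1 : 1 ≤ |(a : ℝ)| := by exact_mod_cast Int.one_le_abs ha
  have ha0 : 0 < |(a : ℝ)| := by linarith
  have hK' : (0 : ℝ) < K := by exact_mod_cast hK
  have hT1 : 1 / (K : ℝ) ≤ T := le_add_of_nonneg_right (by positivity)
  have hT2 : |(x 0 : ℝ)| * θ / |(a : ℝ)| ≤ T := le_add_of_nonneg_left (by positivity)
  have hT0 : 0 ≤ T := le_trans (by positivity) hT1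
  have hba : |(b : ℝ)| / |(a : ℝ)| ≤ 1 / ε := by
    rw [div_le_div_iff₀ ha0 hε]; linarith
  have hca : |(c : ℝ)| / |(a : ℝ)| ≤ 1 + |η| / ε + η ^ 2 := by
    rw [div_le_iff₀ ha0]
    have h1 : |(c : ℝ)| ≤ θ + |(b : ℝ)| * |η| + |(a : ℝ)| * η ^ 2 := by
      have : (c : ℝ) = (c + b * η + a * η ^ 2) - b * η - a * η ^ 2 := by ring
      calc |(c : ℝ)| = |(c + b * η + a * η ^ 2) - b * η - a * η ^ 2| := by rw [← this]
        _ ≤ |(c + b * η + a * η ^ 2) - b * η| + |a * η ^ 2| := abs_sub _ _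
        _ ≤ |(c : ℝ) + b * η + a * η ^ 2| + |b * η| + |a * η ^ 2| := by
          gcongr; exact abs_sub _ _
        _ = _ := by rw [abs_mul, abs_mul, abs_of_nonneg (sq_nonneg η)]
    have h2 : |(b : ℝ)| * |η| ≤ |η| / ε * |(a : ℝ)| := by
      rw [div_le_iff₀ ha0] at hba
      calc |(b : ℝ)| * |η| ≤ (1 / ε * |(a : ℝ)|) * |η| := by gcongr
        _ = _ := by ring
    nlinarith
  have key : ∀ j, j ≤ n + 1 → |x 0 * η ^ j - x j| ≤ R ^ j * T := by
    intro j
    induction j using Nat.strong_induction_on with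
    | _ j ih =>
      intro hj
      match j with
      | 0 => simpa using hT0
      | 1 =>
        rw [pow_one, pow_one]
        exact hx1.trans (hT1.trans (le_mul_of_one_le_left hT0 hR1))
      | i + 2 =>
        have h0 := ih i (by omega) (by omega)
        have h1 := ih (i + 1) (by omega) (by omega)
        have hr := congrArg (Int.cast : ℤ → ℝ) (hrec i (by omega))
        push_cast at hr
        have e : (a : ℝ) * (x 0 * η ^ (i + 2) - x (i + 2)) =
            x 0 * η ^ i * (c + b * η + a * η ^ 2) - b * (x 0 * η ^ (i + 1) - x (i + 1))
              - c * (x 0 * η ^ i - x i) := by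
          linear_combination -hr
        have e2 : |(a : ℝ)| * |x 0 * η ^ (i + 2) - x (i + 2)| ≤
            |(x 0 : ℝ)| * |η| ^ i * θ + |(b : ℝ)| * (R ^ (i + 1) * T) + |(c : ℝ)| * (R ^ i * T) := by
          rw [← abs_mul, e]
          refine (abs_sub _ _).trans (add_le_add ((abs_sub _ _).trans (add_le_add ?_ ?_)) ?_)
          · rw [abs_mul, abs_mul, abs_pow]
          · rw [abs_mul]; gcongr
          · rw [abs_mul]; gcongr
        have e3 : |x 0 * η ^ (i + 2) - x (i + 2)| ≤
            |η| ^ i * (|(x 0 : ℝ)| * θ / |(a : ℝ)|) + |(b : ℝ)| / |(a : ℝ)| * (R ^ (i + 1) * T) +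
              |(c : ℝ)| / |(a : ℝ)| * (R ^ i * T) := by
          rw [← le_div_iff₀' ha0] at e2
          refine e2.trans (le_of_eq ?_)
          field_simp
        have hηR : |η| ^ i ≤ R ^ i := by
          gcongr
          have : 0 ≤ 1 / ε + |η| / ε + η ^ 2 := by positivity
          linarith
        calc _ ≤ R ^ i * T + 1 / ε * (R ^ (i + 1) * T) +
              (1 + |η| / ε + η ^ 2) * (R ^ i * T) := by
              refine e3.trans ?_
              gcongr
          _ = R ^ i * T * (1 + 1 / ε * R + (1 + |η| / ε + η ^ 2)) := by ring
          _ ≤ R ^ i * T * R ^ 2 := by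
              gcongr
              have h5 : 0 ≤ |η| := abs_nonneg _
              have h6 : 0 ≤ |η| / ε := by positivity
              have h7 : R ^ 2 - 1 / ε * R = R * (2 + |η| / ε + η ^ 2 + |η|) := by rw [hR]; ring
              have h8 : (2 + |η| / ε + η ^ 2 + |η|) ≤ R * (2 + |η| / ε + η ^ 2 + |η|) :=
                le_mul_of_one_le_left (by positivity) hR1
              linarith
          _ = R ^ (i + 2) * T := by ring
  intro j hj
  refine (key j hj).trans ?_
  gcongr

/-- The bound of the previous lemma with the parameter `K` chosen optimally. -/
lemma exists_approx_of_small_value (η : ℝ) (n : ℕ) {ε C W : ℝ} (hε : 0 < ε) (hC : 0 < C)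
    (hW : (n : ℝ) - 1 < W) :
    ∃ D : ℝ, 1 ≤ D ∧ ∀ (a b c : ℤ), a ≠ 0 → ε * |(b : ℝ)| ≤ |(a : ℝ)| →
      |(c : ℝ) + b * η + a * η ^ 2| ≤ 1 →
      |(c : ℝ) + b * η + a * η ^ 2| ≤ C * |(a : ℝ)| ^ (-W) →
      ∃ x : ℕ → ℤ, x 0 ≠ 0 ∧ |(x 0 : ℝ)| ≤ D * |(a : ℝ)| ^ ((W + n + 1) / 2) ∧
        ∀ j ≤ n + 1, |x 0 * η ^ j - x j| ≤ D * |(a : ℝ)| ^ (-((W + 1 - n) / 2)) := by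
  obtain ⟨D, hD1, hD⟩ := exists_approx_of_dominant_leading η n hε
  refine ⟨D * (2 + 2 * C), by nlinarith, fun a b c ha hb hθ1 hθ => ?_⟩
  -- With `|x 0| ≤ K |a| ^ n`, the two error terms are `1 / K` and `K * |a| ^ (n - 1 - W)`; they
  -- balance at `K = |a| ^ s`.
  set s := (W + 1 - n) / 2 with hs
  set A := |(a : ℝ)| with hA
  have hA1 : 1 ≤ A := by rw [hA]; exact_mod_cast Int.one_le_abs ha
  have hA0 : 0 < A := by linarith
  have hs0 : 0 < s := by rw [hs]; linarith
  have hAs1 : 1 ≤ A ^ s := Real.one_le_rpow hA1 hs0.le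
  have hK0 : 0 < ⌈A ^ s⌉₊ := Nat.ceil_pos.2 (by linarith)
  obtain ⟨x, hx0, hxK, hx⟩ := hD a b c ⌈A ^ s⌉₊ ha hK0 hb hθ1
  have hK1 : A ^ s ≤ ⌈A ^ s⌉₊ := Nat.le_ceil _
  have hK2 : (⌈A ^ s⌉₊ : ℝ) ≤ 2 * A ^ s := by
    have := (Nat.ceil_lt_add_one (by linarith : 0 ≤ A ^ s)).le
    linarith
  have hx2 : |(x 0 : ℝ)| ≤ 2 * A ^ ((W + n + 1) / 2) := by
    refine hxK.trans ?_
    calc (⌈A ^ s⌉₊ : ℝ) * A ^ n ≤ 2 * A ^ s * A ^ n := by gcongr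
      _ = 2 * A ^ ((W + n + 1) / 2) := by
        rw [mul_assoc, ← Real.rpow_natCast, ← Real.rpow_add hA0, hs]
        congr 2; ring
  refine ⟨x, hx0, hx2.trans ?_, fun j hj => (hx j hj).trans ?_⟩
  · gcongr
    nlinarith
  · rw [mul_assoc]
    gcongr
    have h1 : 1 / (⌈A ^ s⌉₊ : ℝ) ≤ A ^ (-s) := by
      rw [Real.rpow_neg hA0.le, ← one_div]
      gcongr
    have h2 : |(x 0 : ℝ)| * |(c : ℝ) + b * η + a * η ^ 2| / A ≤ 2 * C * A ^ (-s) := by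
      calc |(x 0 : ℝ)| * |(c : ℝ) + b * η + a * η ^ 2| / A
          ≤ (2 * A ^ ((W + n + 1) / 2)) * (C * A ^ (-W)) / A := by gcongr
        _ = 2 * C * (A ^ ((W + n + 1) / 2) * A ^ (-W) * A ^ (-1 : ℝ)) := by
          rw [Real.rpow_neg_one]; ring
        _ = 2 * C * A ^ (-s) := by
          rw [← Real.rpow_add hA0, ← Real.rpow_add hA0, hs]
          congr 2; ring
    have h3 : 0 ≤ A ^ (-s) := by positivity
    nlinarith

/-- Integer points approximating the Veronese point give a lower bound for the exponent. -/
lemma frequently_simApproxSolvable {N : ℕ} {ξ D p q μ : ℝ} (hD : 0 < D) (hp : 0 < p)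
    (hμq : μ * p < q)
    (h : ∀ B : ℝ, ∃ A : ℝ, B ≤ A ∧ ∃ x : ℕ → ℤ, x 0 ≠ 0 ∧ |(x 0 : ℝ)| ≤ D * A ^ p ∧
      ∀ j ≤ N, |x 0 * ξ ^ j - x j| ≤ D * A ^ (-q)) :
    ∃ᶠ X : ℝ in atTop, SimApproxSolvable (veronesePoint N ξ) μ X := by
  rw [frequently_atTop]
  intro X₀
  obtain ⟨B, hB1, hB⟩ := exists_mul_rpow_neg_lt (D * D ^ μ) (sub_pos.2 hμq) one_pos
  obtain ⟨B', hB'⟩ := eventually_atTop.1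
    (((tendsto_rpow_atTop hp).const_mul_atTop hD).eventually_ge_atTop X₀)
  obtain ⟨A, hA, x, hx0, hxA, hx⟩ := h (max B B')
  have hBA := (le_max_left _ _).trans hA
  have hA0 : 0 < A := by linarith
  refine ⟨D * A ^ p, hB' A ((le_max_right _ _).trans hA), x 0, fun j => x (j + 1), ?_, hxA,
    fun j => ?_⟩
  · exact_mod_cast Int.one_le_abs hx0
  · rw [veronesePoint, mul_comm]
    refine (hx (j + 1) j.2).trans ?_
    have h1 := (hB A hBA).le
    rw [Real.mul_rpow hD.le (by positivity), ← Real.rpow_mul hA0.le]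
    have e : A ^ (-(q - μ * p)) = A ^ (-q) * (A ^ (p * -μ))⁻¹ := by
      rw [← Real.rpow_neg hA0.le, ← Real.rpow_add hA0]; congr 1; ring
    rw [e, ← mul_assoc, ← div_eq_mul_inv, div_le_one (by positivity)] at h1
    rw [Real.rpow_neg hD.le, inv_mul_eq_div, le_div_iff₀ (by positivity)]
    linarith

/-- Small values of integer quadratic polynomials at `ξ` give good simultaneous approximations to
the powers of `ξ`. -/
lemma le_ordinaryExponent_of_small_values {ξ : ℝ} (hξ : ξ ≠ 0) {n : ℕ} {C W : ℝ} (hC : 0 < C)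
    (hW0 : 0 < W) (hW : (n : ℝ) - 1 < W)
    (h : ∀ B : ℝ, ∃ a b c : ℤ, B ≤ max |(a : ℝ)| |(b : ℝ)| ∧
      |(c : ℝ) + b * ξ + a * ξ ^ 2| ≤ C * max |(a : ℝ)| |(b : ℝ)| ^ (-W)) :
    (((W + 1 - n) / (W + n + 1) : ℝ) : EReal) ≤ ordinaryExponent (n + 1) ξ := by
  have hp : 0 < (W + n + 1) / 2 := by positivity
  have hq : 0 < (W + 1 - n) / 2 := by linarith
  have hξ0 : 0 < |ξ| := abs_pos.2 hξ
  suffices H : ∃ D : ℝ, 0 < D ∧ ∀ B : ℝ, ∃ A : ℝ, B ≤ A ∧ ∃ x : ℕ → ℤ, x 0 ≠ 0 ∧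
      |(x 0 : ℝ)| ≤ D * A ^ ((W + n + 1) / 2) ∧
      ∀ j ≤ n + 1, |x 0 * ξ ^ j - x j| ≤ D * A ^ (-((W + 1 - n) / 2)) by
    obtain ⟨D, hD, H⟩ := H
    refine EReal.ge_of_forall_gt_iff_ge.1 fun m hm => ?_
    have hm : m < (W + 1 - n) / (W + n + 1) := by exact_mod_cast hm
    refine le_trans (b := ((max m 0 : ℝ) : EReal)) (by exact_mod_cast le_max_left m 0) ?_
    refine le_ordinaryExponentVec (frequently_simApproxSolvable hD hp ?_ H)
    have h1 : max m 0 < (W + 1 - n) / (W + n + 1) :=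
      max_lt hm (div_pos (by linarith) (by linarith))
    rw [lt_div_iff₀ (by linarith)] at h1
    linarith
  -- When `|a| < ε |b|`, this choice makes `|a| ξ²` at most a quarter of `|b ξ|`, so `c` has to
  -- balance `b ξ`.
  set ε := min 1 (1 / (4 * |ξ|)) with hε
  have hε0 : 0 < ε := lt_min one_pos (by positivity)
  have hε4 : ε * |ξ| ≤ 1 / 4 := by
    calc ε * |ξ| ≤ 1 / (4 * |ξ|) * |ξ| := by gcongr; exact min_le_right _ _
      _ = 1 / 4 := by field_simp
  obtain ⟨B₁, hB₁1, hB₁⟩ := exists_mul_rpow_neg_lt C hW0 one_pos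
  obtain ⟨B₂, hB₂1, hB₂⟩ := exists_mul_rpow_neg_lt (C / ξ ^ 2) hW0 one_pos
  -- the two cases: leading coefficient comparable with the height, or constant coefficient
  by_cases hcase : ∀ B : ℝ, ∃ a b c : ℤ, B ≤ max |(a : ℝ)| |(b : ℝ)| ∧
      |(c : ℝ) + b * ξ + a * ξ ^ 2| ≤ C * max |(a : ℝ)| |(b : ℝ)| ^ (-W) ∧
      ε * |(b : ℝ)| ≤ |(a : ℝ)|
  · obtain ⟨D, hD1, hD⟩ := exists_approx_of_small_value ξ n hε0 hC hW
    refine ⟨D, by linarith, fun B => ?_⟩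
    obtain ⟨a, b, c, hB, hP, hab⟩ := hcase (max B₁ (max B 0 / ε + 1))
    set H := max |(a : ℝ)| |(b : ℝ)| with hH
    have hH1 : B₁ ≤ H := (le_max_left _ _).trans hB
    have hH2 : max B 0 / ε + 1 ≤ H := (le_max_right _ _).trans hB
    have haH : ε * H ≤ |(a : ℝ)| := by
      rcases max_choice |(a : ℝ)| |(b : ℝ)| with h1 | h1
      · rw [hH, h1]
        exact mul_le_of_le_one_left (abs_nonneg _) (min_le_left _ _)
      · rwa [hH, h1]
    have haB : B < |(a : ℝ)| := by
      have : max B 0 / ε < H := by linarith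
      rw [div_lt_iff₀ hε0] at this
      have := le_max_left B 0
      linarith
    have ha0 : (0 : ℝ) < |(a : ℝ)| := lt_of_lt_of_le (mul_pos hε0 (by linarith)) haH
    have ha : a ≠ 0 := by
      rintro rfl; simp at ha0
    refine ⟨|(a : ℝ)|, haB.le, hD a b c ha hab (hP.trans (hB₁ H hH1).le) (hP.trans ?_)⟩
    gcongr ?_ * ?_
    exact Real.rpow_le_rpow_of_nonpos ha0 (le_max_left _ _) (by linarith)
  · push Not at hcase
    obtain ⟨B₃, hB₃⟩ := hcase
    -- Now `|a| < ε |b|` for all polynomials of large height, so `c` is comparable with `b`. The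
    -- reciprocal polynomial has dominant leading coefficient `c` and is small at `ξ⁻¹`; the
    -- approximations to the powers of `ξ⁻¹` are then read backwards.
    have hη : ξ⁻¹ ≠ 0 := inv_ne_zero hξ
    set δ := |ξ| / 4 with hδ
    have hδ0 : 0 < δ := by positivity
    have hC' : 0 < C / ξ ^ 2 * (|ξ| + |ξ| + 1) ^ W := by positivity
    obtain ⟨D, hD1, hD⟩ := exists_approx_of_small_value ξ⁻¹ n hδ0 hC' hW
    set E : ℝ := (|ξ⁻¹| ^ (n + 1) + 1) + (1 + |ξ|) ^ (n + 1) * 2 with hE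
    have hE0 : 0 < E := by positivity
    -- This threshold guarantees `x (n + 1) ≠ 0`, the multiplier after reversal.
    obtain ⟨B₄, hB₄1, hB₄⟩ := exists_mul_rpow_neg_lt (D * (|ξ| ^ (n + 1) + 1)) hq one_pos
    refine ⟨D * E, by positivity, fun B => ?_⟩
    obtain ⟨a, b, c, hB, hP⟩ := h (max (max B₁ B₂) (max (max B₃ (2 / |ξ|)) (max (max B B₄) 0 / δ + 1)))
    set H := max |(a : ℝ)| |(b : ℝ)| with hH
    have hH1 : B₁ ≤ H := ((le_max_left _ _).trans (le_max_left _ _)).trans hB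
    have hH2 : B₂ ≤ H := ((le_max_right _ _).trans (le_max_left _ _)).trans hB
    have hH3 : B₃ ≤ H :=
      (((le_max_left _ _).trans (le_max_left _ _)).trans (le_max_right _ _)).trans hB
    have hH4 : 2 / |ξ| ≤ H :=
      (((le_max_right _ _).trans (le_max_left _ _)).trans (le_max_right _ _)).trans hB
    have hH5 : max (max B B₄) 0 / δ + 1 ≤ H :=
      ((le_max_right _ _).trans (le_max_right _ _)).trans hB
    have hab := hB₃ a b c hH3 hP
    have hHb : H = |(b : ℝ)| := by
      rw [hH]
      refine max_eq_right (hab.le.trans (mul_le_of_le_one_left (abs_nonneg _) (min_le_left _ _)))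
    have hP1 : |(c : ℝ) + b * ξ + a * ξ ^ 2| ≤ 1 := hP.trans (hB₁ H hH1).le
    have hb2 : 2 ≤ |(b : ℝ)| * |ξ| := by
      rw [hHb, div_le_iff₀ hξ0] at hH4; exact hH4
    have haξ : |(a : ℝ)| * ξ ^ 2 ≤ |(b : ℝ)| * |ξ| / 4 := by
      rw [← sq_abs]
      calc |(a : ℝ)| * |ξ| ^ 2 ≤ ε * |(b : ℝ)| * |ξ| ^ 2 := by gcongr
        _ = (ε * |ξ|) * (|(b : ℝ)| * |ξ|) := by ring
        _ ≤ 1 / 4 * (|(b : ℝ)| * |ξ|) := by gcongr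
        _ = _ := by ring
    have hclow : δ * |(b : ℝ)| ≤ |(c : ℝ)| := by
      have e : (b : ℝ) * ξ = (c + b * ξ + a * ξ ^ 2) - a * ξ ^ 2 - c := by ring
      have : |(b : ℝ)| * |ξ| ≤ 1 + |(b : ℝ)| * |ξ| / 4 + |(c : ℝ)| := by
        rw [← abs_mul, e]
        refine (abs_sub _ _).trans (add_le_add ((abs_sub _ _).trans (add_le_add hP1 ?_)) le_rfl)
        rw [← e, abs_mul, abs_mul, abs_of_nonneg (sq_nonneg ξ)]
        exact haξ
      rw [hδ]
      linarith
    have hcup : |(c : ℝ)| ≤ (|ξ| + |ξ| + 1) * H := by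
      have e : (c : ℝ) = (c + b * ξ + a * ξ ^ 2) - a * ξ ^ 2 - b * ξ := by ring
      have : |(c : ℝ)| ≤ 1 + |(b : ℝ)| * |ξ| / 4 + |(b : ℝ)| * |ξ| := by
        rw [e]
        refine (abs_sub _ _).trans (add_le_add ((abs_sub _ _).trans (add_le_add hP1 ?_)) ?_)
        · rw [abs_mul, abs_of_nonneg (sq_nonneg ξ)]
          exact haξ
        · rw [abs_mul]
      rw [hHb] at hH1 ⊢
      nlinarith
    have hcB : max (max B B₄) 0 < |(c : ℝ)| := by
      have : max (max B B₄) 0 / δ < H := by linarith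
      rw [div_lt_iff₀ hδ0, hHb] at this
      linarith
    have hc0 : (0 : ℝ) < |(c : ℝ)| := (le_max_right _ _).trans_lt hcB
    have hcB1 : B < |(c : ℝ)| := ((le_max_left _ _).trans (le_max_left _ _)).trans_lt hcB
    have hcB4 : B₄ < |(c : ℝ)| := ((le_max_right _ _).trans (le_max_left _ _)).trans_lt hcB
    have hc : c ≠ 0 := by
      rintro rfl; simp at hc0
    have hrev : |(a : ℝ) + b * ξ⁻¹ + c * ξ⁻¹ ^ 2| = |(c : ℝ) + b * ξ + a * ξ ^ 2| / ξ ^ 2 := by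
      rw [← abs_of_nonneg (sq_nonneg ξ), ← abs_div, abs_of_nonneg (sq_nonneg ξ)]
      congr 1
      field_simp
      ring
    have hH0 : 0 < H := by linarith
    obtain ⟨x, hx0, hxA, hx⟩ := hD c b a hc hclow
      (by
        rw [hrev]
        refine le_trans ?_ (hB₂ H hH2).le
        rw [div_mul_eq_mul_div]
        gcongr)
      (by
        rw [hrev, div_mul_eq_mul_div, div_mul_eq_mul_div]
        gcongr ?_ / _
        refine hP.trans ?_
        rw [mul_assoc]
        gcongr
        calc H ^ (-W) = (|ξ| + |ξ| + 1) ^ W * ((|ξ| + |ξ| + 1) * H) ^ (-W) := by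
              rw [Real.mul_rpow (by positivity) hH0.le, ← mul_assoc,
                ← Real.rpow_add (by positivity), add_neg_cancel, Real.rpow_zero, one_mul]
          _ ≤ _ := by
              gcongr ?_ * ?_
              exact Real.rpow_le_rpow_of_nonpos hc0 hcup (by linarith))
    set A := |(c : ℝ)| with hA
    set e := D * A ^ (-((W + 1 - n) / 2)) with he
    have he0 : 0 ≤ e := by positivity
    have hA1 : 1 ≤ A := by linarith
    have hAp : 1 ≤ A ^ ((W + n + 1) / 2) := Real.one_le_rpow hA1 hp.le
    have heD : e ≤ D := mul_le_of_le_one_right (by linarith)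
      (Real.rpow_le_one_of_one_le_of_nonpos hA1 (by linarith))
    have hlast := hx (n + 1) le_rfl
    have hξn : ∀ j ≤ n + 1, ξ ^ (n + 1) * ξ⁻¹ ^ (n + 1 - j) = ξ ^ j := by
      intro j hj
      rw [inv_pow, mul_inv_eq_iff_eq_mul₀ (pow_ne_zero _ hξ), ← pow_add]
      congr 1; omega
    refine ⟨A, hcB1.le, fun j => x (n + 1 - j), ?_, ?_, fun j hj => ?_⟩
    · intro h0
      simp only [Nat.sub_zero] at h0
      rw [h0, Int.cast_zero, sub_zero, abs_mul, abs_pow] at hlast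
      have hx1 : 1 ≤ |(x 0 : ℝ)| := by exact_mod_cast Int.one_le_abs hx0
      have h2 : |ξ⁻¹| ^ (n + 1) ≤ e := (le_mul_of_one_le_left (by positivity) hx1).trans hlast
      have h3 := hB₄ A hcB4.le
      have h4 : D * (|ξ| ^ (n + 1) + 1) * A ^ (-((W + 1 - n) / 2)) =
        e * |ξ| ^ (n + 1) + e := by rw [he]; ring
      rw [h4] at h3
      have h5 : |ξ⁻¹| ^ (n + 1) * |ξ| ^ (n + 1) = 1 := by
        rw [← mul_pow, ← abs_mul, inv_mul_cancel₀ hξ, abs_one, one_pow]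
      have h6 := mul_le_mul_of_nonneg_right h2 (by positivity : 0 ≤ |ξ| ^ (n + 1))
      linarith
    · simp only [Nat.sub_zero]
      have h1 : |(x (n + 1) : ℝ)| ≤ |(x 0 : ℝ)| * |ξ⁻¹| ^ (n + 1) + e := by
        rw [← abs_pow, ← abs_mul]
        have := abs_sub_abs_le_abs_sub (x (n + 1) : ℝ) (x 0 * ξ⁻¹ ^ (n + 1))
        rw [abs_sub_comm] at this
        linarith
      calc |(x (n + 1) : ℝ)| ≤ D * A ^ ((W + n + 1) / 2) * |ξ⁻¹| ^ (n + 1) +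
            D * A ^ ((W + n + 1) / 2) := by
            refine h1.trans (add_le_add (by gcongr) (heD.trans ?_))
            exact le_mul_of_one_le_right (by linarith) hAp
        _ = D * (|ξ⁻¹| ^ (n + 1) + 1) * A ^ ((W + n + 1) / 2) := by ring
        _ ≤ _ := by
          gcongr
          rw [hE]
          exact le_add_of_nonneg_right (by positivity)
    · simp only [Nat.sub_zero]
      have e1 : (x (n + 1) : ℝ) * ξ ^ j - x (n + 1 - j) =
          (x 0 * ξ⁻¹ ^ (n + 1 - j) - x (n + 1 - j)) -
            (x 0 * ξ⁻¹ ^ (n + 1) - x (n + 1)) * ξ ^ j := by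
        have h1 := hξn j hj
        have h2 : ξ⁻¹ ^ (n + 1) * ξ ^ j = ξ⁻¹ ^ (n + 1 - j) := by
          rw [← h1, ← mul_assoc, ← mul_pow, inv_mul_cancel₀ hξ, one_pow, one_mul]
        rw [← h2]; ring
      rw [e1]
      have h3 : |ξ| ^ j ≤ (1 + |ξ|) ^ (n + 1) :=
        (pow_le_pow_left₀ hξ0.le (by linarith) j).trans
          (pow_le_pow_right₀ (by linarith) hj)
      have h4 : 1 ≤ (1 + |ξ|) ^ (n + 1) := one_le_pow₀ (by linarith)
      calc _ ≤ e + e * (1 + |ξ|) ^ (n + 1) := by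
            refine (abs_sub _ _).trans (add_le_add (hx _ (by omega)) ?_)
            rw [abs_mul, abs_pow]
            gcongr
        _ ≤ e * E := by
            have : 0 ≤ |ξ⁻¹| ^ (n + 1) := by positivity
            have h5 : 1 + (1 + |ξ|) ^ (n + 1) ≤ E := by rw [hE]; linarith
            have h6 := mul_le_mul_of_nonneg_left h5 he0
            linarith
        _ = _ := by rw [he]; ring

/-! ### Cross products and primitive points in `ℤ³` -/

open scoped Matrix in
-- The triple product `P × (u × v)` is the combination of `u` and `v` with coefficients `P · v` and
-- `-(P · u)`.
lemma cross_cross_eq_zero_of_dot_eq_zero {P u v : Fin 3 → ℤ} (hu : u ⬝ᵥ P = 0) (hv : v ⬝ᵥ P = 0) :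
    P ⨯₃ (u ⨯₃ v) = 0 := by
  rw [Matrix.vec3_dotProduct] at hu hv
  ext i
  fin_cases i
  · simp [cross_apply]; linear_combination u 0 * hv - v 0 * hu
  · simp [cross_apply]; linear_combination u 1 * hv - v 1 * hu
  · simp [cross_apply]; linear_combination u 2 * hv - v 2 * hu

open scoped Matrix in
lemma mul_eq_mul_of_cross_eq_zero {u v : Fin 3 → ℤ} (h : u ⨯₃ v = 0) (i j : Fin 3) :
    u i * v j = u j * v i := by
  have h0 := congrFun h 0
  have h1 := congrFun h 1
  have h2 := congrFun h 2
  simp [cross_apply] at h0 h1 h2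
  fin_cases i <;> fin_cases j <;> simp <;> linarith

open scoped Matrix in
lemma dot_eq_zero_of_cross_eq_zero {P Q w : Fin 3 → ℤ} (hPQ : P ⨯₃ Q = 0) (hQ : Q ≠ 0)
    (hw : w ⬝ᵥ Q = 0) : w ⬝ᵥ P = 0 := by
  obtain ⟨i, hi⟩ := Function.ne_iff.1 hQ
  refine (mul_eq_zero.1 ?_).resolve_left hi
  rw [Matrix.vec3_dotProduct] at hw ⊢
  have h := fun j => mul_eq_mul_of_cross_eq_zero hPQ i j
  linear_combination P i * hw - w 0 * h 0 - w 1 * h 1 - w 2 * h 2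

open scoped Matrix in
/-- Three vectors orthogonal to a nonzero vector are coplanar. -/
lemma dot_cross_eq_zero {P u v w : Fin 3 → ℤ} (hP : P ≠ 0) (hu : u ⬝ᵥ P = 0) (hv : v ⬝ᵥ P = 0)
    (hw : w ⬝ᵥ P = 0) : w ⬝ᵥ (u ⨯₃ v) = 0 := by
  refine dot_eq_zero_of_cross_eq_zero ?_ hP hw
  rw [← neg_cross, cross_cross_eq_zero_of_dot_eq_zero hu hv, neg_zero]

open scoped Matrix in
lemma dot_eq_zero_of_dot_cross_eq_zero {P u v w : Fin 3 → ℤ} (huv : u ⨯₃ v ≠ 0) (hu : u ⬝ᵥ P = 0)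
    (hv : v ⬝ᵥ P = 0) (hw : w ⬝ᵥ (u ⨯₃ v) = 0) : w ⬝ᵥ P = 0 :=
  dot_eq_zero_of_cross_eq_zero (cross_cross_eq_zero_of_dot_eq_zero hu hv) huv hw

open scoped Matrix in
/-- An integer point that divides every integer point on its line. -/
def IsPrimitivePoint (z : Fin 3 → ℤ) : Prop :=
  ∀ w : Fin 3 → ℤ, w ⨯₃ z = 0 → ∃ n : ℤ, w = n • z

/-- Divide by the gcd of the coordinates. A Bézout relation for the quotient `z` recovers the
integer factor of any integer point on its line. -/
lemma exists_isPrimitivePoint {u : Fin 3 → ℤ} (hu : u ≠ 0) :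
    ∃ (z : Fin 3 → ℤ) (n : ℤ), n ≠ 0 ∧ u = n • z ∧ IsPrimitivePoint z := by
  set g₁ : ℤ := ((Int.gcd (u 0) (u 1) : ℕ) : ℤ) with hg₁
  set g : ℤ := ((Int.gcd g₁ (u 2) : ℕ) : ℤ) with hg
  have h1 : g₁ = u 0 * Int.gcdA (u 0) (u 1) + u 1 * Int.gcdB (u 0) (u 1) := Int.gcd_eq_gcd_ab _ _
  have h2 : g = g₁ * Int.gcdA g₁ (u 2) + u 2 * Int.gcdB g₁ (u 2) := Int.gcd_eq_gcd_ab _ _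
  have d1 : g ∣ g₁ := Int.gcd_dvd_left _ _
  have hdvd : ∀ i, g ∣ u i := by
    intro i
    fin_cases i
    · exact d1.trans (Int.gcd_dvd_left _ _)
    · exact d1.trans (Int.gcd_dvd_right _ _)
    · exact Int.gcd_dvd_right _ _
  choose z hz using hdvd
  have hg0 : g ≠ 0 := by
    rintro h0
    exact hu (funext fun i => by simp [hz i, h0])
  refine ⟨z, g, hg0, funext fun i => by simp [hz i], fun w hw => ?_⟩
  set α := Int.gcdA (u 0) (u 1) * Int.gcdA g₁ (u 2)
  set β := Int.gcdB (u 0) (u 1) * Int.gcdA g₁ (u 2)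
  set γ := Int.gcdB g₁ (u 2)
  have hbez : z 0 * α + z 1 * β + z 2 * γ = 1 := by
    refine mul_left_cancel₀ hg0 ?_
    have : g = u 0 * α + u 1 * β + u 2 * γ := by
      linear_combination h2 + Int.gcdA g₁ (u 2) * h1
    linear_combination -(α * hz 0) - β * hz 1 - γ * hz 2 - this
  refine ⟨w 0 * α + w 1 * β + w 2 * γ, funext fun i => ?_⟩
  have h := fun j => mul_eq_mul_of_cross_eq_zero hw i j
  simp only [Pi.smul_apply, smul_eq_mul]
  linear_combination -w i * hbez + α * h 0 + β * h 1 + γ * h 2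

/-! ### Determinants of points near the line of `(1, ξ, ξ²)` -/

/-- The point `u` is at distance at most `e` from the line spanned by `(1, ξ, ξ ^ 2)`. -/
def ApproxWithin (ξ : ℝ) (u : Fin 3 → ℤ) (e : ℝ) : Prop :=
  |u 0 * ξ - u 1| ≤ e ∧ |u 0 * ξ ^ 2 - u 2| ≤ e

lemma ApproxWithin.mono {ξ e e' : ℝ} {u : Fin 3 → ℤ} (h : ApproxWithin ξ u e) (he : e ≤ e') :
    ApproxWithin ξ u e' := ⟨h.1.trans he, h.2.trans he⟩

lemma ApproxWithin.nonneg {ξ e : ℝ} {u : Fin 3 → ℤ} (h : ApproxWithin ξ u e) : 0 ≤ e :=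
  (abs_nonneg _).trans h.1

section Bounds

open scoped Matrix

variable {ξ e f g : ℝ} {u v w : Fin 3 → ℤ}

lemma abs_sub_le_of_abs_le {a b s t : ℝ} (ha : |a| ≤ s) (hb : |b| ≤ t) : |a - b| ≤ s + t :=
  (abs_sub _ _).trans (add_le_add ha hb)

lemma abs_add_le_of_abs_le {a b s t : ℝ} (ha : |a| ≤ s) (hb : |b| ≤ t) : |a + b| ≤ s + t :=
  (abs_add_le _ _).trans (add_le_add ha hb)

lemma abs_mul_le_of_abs_le {a b s t : ℝ} (ha : |a| ≤ s) (hb : |b| ≤ t) : |a * b| ≤ s * t := by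
  rw [abs_mul]
  exact mul_le_mul ha hb (abs_nonneg _) ((abs_nonneg _).trans ha)

lemma ApproxWithin.abs_cross_one_le (hu : ApproxWithin ξ u e) (hv : ApproxWithin ξ v f) :
    |(((u ⨯₃ v) 1 : ℤ) : ℝ)| ≤ |(u 0 : ℝ)| * f + |(v 0 : ℝ)| * e := by
  have : (((u ⨯₃ v) 1 : ℤ) : ℝ) = u 0 * (v 0 * ξ ^ 2 - v 2) - v 0 * (u 0 * ξ ^ 2 - u 2) := by
    simp [cross_apply]; ring
  rw [this]
  exact abs_sub_le_of_abs_le (abs_mul_le_of_abs_le le_rfl hv.2) (abs_mul_le_of_abs_le le_rfl hu.2)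

lemma ApproxWithin.abs_cross_two_le (hu : ApproxWithin ξ u e) (hv : ApproxWithin ξ v f) :
    |(((u ⨯₃ v) 2 : ℤ) : ℝ)| ≤ |(u 0 : ℝ)| * f + |(v 0 : ℝ)| * e := by
  have : (((u ⨯₃ v) 2 : ℤ) : ℝ) = v 0 * (u 0 * ξ - u 1) - u 0 * (v 0 * ξ - v 1) := by
    simp [cross_apply]; ring
  rw [this, add_comm]
  exact abs_sub_le_of_abs_le (abs_mul_le_of_abs_le le_rfl hu.1) (abs_mul_le_of_abs_le le_rfl hv.1)

/-- The value is the determinant of `(1, ξ, ξ²)`, `u`, `v`. Column operations reduce it to a 2 × 2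
determinant in the errors alone, so it is quadratic in them. -/
lemma ApproxWithin.abs_cross_value_le (hu : ApproxWithin ξ u e) (hv : ApproxWithin ξ v f) :
    |(((u ⨯₃ v) 0 : ℤ) : ℝ) + ((u ⨯₃ v) 1 : ℤ) * ξ + ((u ⨯₃ v) 2 : ℤ) * ξ ^ 2| ≤ 2 * e * f := by
  have : (((u ⨯₃ v) 0 : ℤ) : ℝ) + ((u ⨯₃ v) 1 : ℤ) * ξ + ((u ⨯₃ v) 2 : ℤ) * ξ ^ 2 =
      (u 0 * ξ - u 1) * (v 0 * ξ ^ 2 - v 2) - (u 0 * ξ ^ 2 - u 2) * (v 0 * ξ - v 1) := by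
    simp [cross_apply]; ring
  rw [this]
  refine (abs_sub_le_of_abs_le (abs_mul_le_of_abs_le hu.1 hv.2)
    (abs_mul_le_of_abs_le hu.2 hv.1)).trans (le_of_eq (by ring))

lemma ApproxWithin.abs_dot_le {P : Fin 3 → ℤ} {θ H : ℝ} (hw : ApproxWithin ξ w g)
    (hθ : |(P 0 : ℝ) + P 1 * ξ + P 2 * ξ ^ 2| ≤ θ) (h1 : |(P 1 : ℝ)| ≤ H) (h2 : |(P 2 : ℝ)| ≤ H) :
    |((w ⬝ᵥ P : ℤ) : ℝ)| ≤ |(w 0 : ℝ)| * θ + 2 * g * H := by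
  have : ((w ⬝ᵥ P : ℤ) : ℝ) = w 0 * ((P 0 : ℝ) + P 1 * ξ + P 2 * ξ ^ 2) -
      (w 0 * ξ - w 1) * P 1 - (w 0 * ξ ^ 2 - w 2) * P 2 := by
    rw [Matrix.vec3_dotProduct]; push_cast; ring
  rw [this]
  refine (abs_sub_le_of_abs_le (abs_sub_le_of_abs_le (abs_mul_le_of_abs_le le_rfl hθ)
    (abs_mul_le_of_abs_le hw.1 h1)) (abs_mul_le_of_abs_le hw.2 h2)).trans (le_of_eq (by ring))

lemma ApproxWithin.abs_det_le (hw : ApproxWithin ξ w g) (hu : ApproxWithin ξ u e)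
    (hv : ApproxWithin ξ v f) :
    |((w ⬝ᵥ (u ⨯₃ v) : ℤ) : ℝ)| ≤
      |(w 0 : ℝ)| * (2 * e * f) + 2 * g * (|(u 0 : ℝ)| * f + |(v 0 : ℝ)| * e) :=
  hw.abs_dot_le (hu.abs_cross_value_le hv) (hu.abs_cross_one_le hv) (hu.abs_cross_two_le hv)

end Bounds

/-! ### Dyadic sequences of approximation points and their turns -/

/-- Rational approximations to `(ξ, ξ ^ 2)` of quality `c * X ^ (-l)` at every scale `X`. -/
def UniformlyApproximable (ξ l c : ℝ) : Prop :=
  ∀ X : ℝ, 1 ≤ X → ∃ x₀ x₁ x₂ : ℤ, 1 ≤ |(x₀ : ℝ)| ∧ |(x₀ : ℝ)| ≤ X ∧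
    |(x₀ : ℝ) * ξ - (x₁ : ℝ)| ≤ c * X ^ (-l) ∧ |(x₀ : ℝ) * ξ ^ 2 - (x₂ : ℝ)| ≤ c * X ^ (-l)

/-- The constant absorbs the bounded range of `X` where the system might fail: there `x₀ = 1` with
nearest integers is good enough. -/
lemma exists_uniformlyApproximable {ξ l : ℝ} (hl : 0 ≤ l) (h : (l : EReal) < uniformExponent 2 ξ) :
    ∃ c, 0 < c ∧ UniformlyApproximable ξ l c := by
  obtain ⟨X₀, hX₀⟩ := eventually_atTop.1 (eventually_of_lt_uniformExponentVec h)
  set A := max X₀ 1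
  have hA : 1 ≤ A := le_max_right _ _
  have hA1 : 1 ≤ A ^ l := Real.one_le_rpow hA hl
  refine ⟨A ^ l, by positivity, fun X hX => ?_⟩
  rcases le_or_gt A X with hAX | hAX
  · obtain ⟨x, y, h1, h2, h3⟩ := hX₀ X ((le_max_left _ _).trans hAX)
    have h4 : X ^ (-l) ≤ A ^ l * X ^ (-l) := le_mul_of_one_le_left (by positivity) hA1
    refine ⟨x, y 0, y 1, h1, h2, ?_, ?_⟩
    · have := h3 0
      simp only [veronesePoint, Fin.val_zero, zero_add, pow_one] at this
      rw [mul_comm]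
      exact this.trans h4
    · have := h3 1
      simp only [veronesePoint, Fin.val_one, Nat.reduceAdd] at this
      rw [mul_comm]
      exact this.trans h4
  · have h1 : 1 ≤ A ^ l * X ^ (-l) := by
      rw [Real.rpow_neg (by linarith), ← div_eq_mul_inv, one_le_div (by positivity)]
      gcongr
    have hr : ∀ y : ℝ, |((1 : ℤ) : ℝ) * y - round y| ≤ A ^ l * X ^ (-l) := fun y => by
      have := abs_sub_round y
      rw [Int.cast_one, one_mul]
      linarith
    exact ⟨1, round ξ, round (ξ ^ 2), by simp, by simpa using hX, hr _, hr _⟩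

/-- A sequence of primitive points realizing the uniform approximation at the scales `2 ^ j`. -/
structure IsDyadicSequence (ξ l c : ℝ) (z : ℕ → Fin 3 → ℤ) : Prop where
  pos : ∀ j, 1 ≤ z j 0
  le : ∀ j, (z j 0 : ℝ) ≤ 2 ^ j
  approx : ∀ j, ApproxWithin ξ (z j) (c * (2 ^ j : ℝ) ^ (-l))
  prim : ∀ j, IsPrimitivePoint (z j)

lemma IsPrimitivePoint.neg {z : Fin 3 → ℤ} (h : IsPrimitivePoint z) : IsPrimitivePoint (-z) := by
  intro w hw
  rw [map_neg, neg_eq_zero] at hw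
  obtain ⟨n, hn⟩ := h w hw
  exact ⟨-n, by rw [hn]; simp⟩

/-- Dividing a solution by its content decreases its size and its errors, and a change of sign makes
the first coordinate positive. -/
lemma UniformlyApproximable.exists_isDyadicSequence {ξ l c : ℝ}
    (h : UniformlyApproximable ξ l c) : ∃ z, IsDyadicSequence ξ l c z := by
  have key : ∀ j : ℕ, ∃ z : Fin 3 → ℤ, 1 ≤ z 0 ∧ (z 0 : ℝ) ≤ 2 ^ j ∧
      ApproxWithin ξ z (c * (2 ^ j : ℝ) ^ (-l)) ∧ IsPrimitivePoint z := by
    intro j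
    obtain ⟨x, y₁, y₂, h1, h2, h3, h4⟩ := h (2 ^ j) (one_le_pow₀ (by norm_num))
    have hx : x ≠ 0 := by rintro rfl; norm_num at h1
    have hu : ![x, y₁, y₂] ≠ 0 := fun h0 => hx (by simpa using congrFun h0 0)
    obtain ⟨z, n, hn, hzn, hz⟩ := exists_isPrimitivePoint hu
    have e0 : x = n * z 0 := by simpa using congrFun hzn 0
    have e1 : y₁ = n * z 1 := by simpa using congrFun hzn 1
    have e2 : y₂ = n * z 2 := by simpa using congrFun hzn 2
    have hn1 : 1 ≤ |(n : ℝ)| := by exact_mod_cast Int.one_le_abs hn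
    have hz0 : z 0 ≠ 0 := by rintro h0; rw [h0, mul_zero] at e0; exact hx e0
    rw [e0] at h2 h3 h4
    rw [e1] at h3
    rw [e2] at h4
    push_cast at h2 h3 h4
    have f2 : |(z 0 : ℝ)| ≤ 2 ^ j := by
      rw [abs_mul] at h2
      exact (le_mul_of_one_le_left (abs_nonneg _) hn1).trans h2
    have f3 : |z 0 * ξ - z 1| ≤ c * (2 ^ j : ℝ) ^ (-l) := by
      rw [mul_assoc, ← mul_sub, abs_mul] at h3
      exact (le_mul_of_one_le_left (abs_nonneg _) hn1).trans h3
    have f4 : |z 0 * ξ ^ 2 - z 2| ≤ c * (2 ^ j : ℝ) ^ (-l) := by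
      rw [mul_assoc, ← mul_sub, abs_mul] at h4
      exact (le_mul_of_one_le_left (abs_nonneg _) hn1).trans h4
    rcases lt_or_gt_of_ne hz0 with hneg | hpos
    · refine ⟨-z, ?_, ?_, ⟨?_, ?_⟩, hz.neg⟩
      · simp only [Pi.neg_apply]; omega
      · rw [← abs_neg] at f2
        push_cast [Pi.neg_apply]
        exact (le_abs_self _).trans f2
      · rw [← abs_neg] at f3
        convert f3 using 2
        push_cast [Pi.neg_apply]; ring
      · rw [← abs_neg] at f4
        convert f4 using 2
        push_cast [Pi.neg_apply]; ring
    · exact ⟨z, hpos, (le_abs_self _).trans f2, ⟨f3, f4⟩, hz⟩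
  choose z h1 h2 h3 h4 using key
  exact ⟨z, h1, h2, h3, h4⟩

/-- `ξ` is not algebraic of degree at most two, in terms of coefficients. -/
def NotQuadratic (ξ : ℝ) : Prop :=
  ∀ P : Fin 3 → ℤ, P ≠ 0 → (P 0 : ℝ) + P 1 * ξ + P 2 * ξ ^ 2 ≠ 0

lemma NotQuadratic.irrational {ξ : ℝ} (h : NotQuadratic ξ) : Irrational ξ := by
  rintro ⟨r, rfl⟩
  refine h ![r.num, -r.den, 0] (fun h0 => ?_) ?_
  · have := congrFun h0 1
    simp at this
  · have hr : (r : ℝ) * r.den = r.num := by exact_mod_cast Rat.mul_den_eq_num r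
    simp
    linarith

lemma notQuadratic_of_polynomial {ξ : ℝ}
    (h : ∀ p : Polynomial ℤ, p ≠ 0 → p.natDegree ≤ 2 → Polynomial.aeval ξ p ≠ 0) :
    NotQuadratic ξ := by
  intro P hP h0
  set p : Polynomial ℤ := .C (P 2) * .X ^ 2 + .C (P 1) * .X + .C (P 0) with hp
  refine h p (fun hp0 => hP ?_) Polynomial.natDegree_quadratic_le ?_
  · have hc : ∀ n, p.coeff n = 0 := fun n => by rw [hp0, Polynomial.coeff_zero]
    have c0 := hc 0
    have c1 := hc 1
    have c2 := hc 2
    simp [hp, Polynomial.coeff_X, Polynomial.coeff_C, -eq_intCast] at c0 c1 c2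
    funext i
    fin_cases i
    · exact c0
    · exact c1
    · exact c2
  · simp [hp]
    linarith

namespace IsDyadicSequence

open scoped Matrix

variable {ξ l c : ℝ} {z : ℕ → Fin 3 → ℤ}

lemma one_le (h : IsDyadicSequence ξ l c z) (j : ℕ) : (1 : ℝ) ≤ z j 0 := by
  exact_mod_cast h.pos j

lemma abs_le (h : IsDyadicSequence ξ l c z) (j : ℕ) : |(z j 0 : ℝ)| ≤ 2 ^ j := by
  rw [abs_of_pos (by linarith [h.one_le j])]
  exact h.le j

lemma eq_of_cross_eq_zero (h : IsDyadicSequence ξ l c z) {i j : ℕ} (hij : z i ⨯₃ z j = 0) :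
    z i = z j := by
  obtain ⟨n, hn⟩ := h.prim j _ hij
  obtain ⟨m, hm⟩ := h.prim i (z j) (by rw [← neg_cross, hij, neg_zero])
  have hi := h.pos i
  have hj := h.pos j
  have e1 : z i 0 = n * z j 0 := by simpa using congrFun hn 0
  have e2 : z j 0 = m * z i 0 := by simpa using congrFun hm 0
  have hn0 : 0 < n := by
    by_contra! h0
    nlinarith
  have hm0 : 0 < m := by
    by_contra! h0
    nlinarith
  have : z i 0 = z j 0 := le_antisymm (by nlinarith) (by nlinarith)
  have : n = 1 := by
    rw [this] at e1
    exact mul_right_cancel₀ (b := z j 0) (by omega) (by linarith)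
  rw [hn, this, one_smul]

lemma cross_ne_zero (h : IsDyadicSequence ξ l c z) {i j : ℕ} (hij : z i ≠ z j) :
    z i ⨯₃ z j ≠ 0 := fun h0 => hij (h.eq_of_cross_eq_zero h0)

/-- The errors tend to zero. -/
lemma exists_err_lt (hl : 0 < l) (c : ℝ) {e : ℝ} (he : 0 < e) :
    ∃ n : ℕ, ∀ m, n ≤ m → c * (2 ^ m : ℝ) ^ (-l) < e := by
  obtain ⟨B, hB1, hB⟩ := exists_mul_rpow_neg_lt c hl he
  obtain ⟨n, hn⟩ := pow_unbounded_of_one_lt B (one_lt_two : (1 : ℝ) < 2)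
  exact ⟨n, fun m hm => hB _ (hn.le.trans (pow_le_pow_right₀ (by norm_num) hm))⟩

lemma exists_ne_succ (h : IsDyadicSequence ξ l c z) (hξ : Irrational ξ) (hl : 0 < l) (n : ℕ) :
    ∃ j, n ≤ j ∧ z j ≠ z (j + 1) := by
  by_contra! hall
  have hconst : ∀ m, n ≤ m → z m = z n := by
    intro m hm
    induction m, hm using Nat.le_induction with
    | base => rfl
    | succ m hm ih => rw [← hall m hm, ih]
  have hne : (z n 0 : ℝ) * ξ - z n 1 ≠ 0 :=
    sub_ne_zero.2 ((hξ.intCast_mul (by have := h.pos n; omega)).ne_int _)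
  obtain ⟨m, hm⟩ := exists_err_lt hl c (abs_pos.2 hne)
  have h1 := hm (max m n) (le_max_left _ _)
  have h2 := (h.approx (max m n)).1
  rw [hconst _ (le_max_right _ _)] at h2
  linarith

/-- If all later points lay in the plane orthogonal to `P`, the value of `P` at `ξ` would be bounded
by the errors, hence vanish. -/
lemma exists_dot_ne_zero (h : IsDyadicSequence ξ l c z) (hξ : NotQuadratic ξ) (hl : 0 < l)
    {P : Fin 3 → ℤ} (hP : P ≠ 0) (n : ℕ) : ∃ m, n ≤ m ∧ z m ⬝ᵥ P ≠ 0 := by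
  by_contra! hall
  have hpos := abs_pos.2 (hξ P hP)
  set θ := (P 0 : ℝ) + P 1 * ξ + P 2 * ξ ^ 2
  obtain ⟨m, hm⟩ := exists_err_lt hl ((|(P 1 : ℝ)| + |(P 2 : ℝ)|) * c) hpos
  have h1 := hm (max m n) (le_max_left _ _)
  have h2 := h.approx (max m n)
  have h3 := congrArg (Int.cast : ℤ → ℝ) (hall (max m n) (le_max_right _ _))
  have h4 := h.one_le (max m n)
  set k := max m n
  set e := c * (2 ^ k : ℝ) ^ (-l) with he
  rw [Matrix.vec3_dotProduct] at h3
  push_cast at h3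
  have h5 : (z k 0 : ℝ) * θ = P 1 * (z k 0 * ξ - z k 1) + P 2 * (z k 0 * ξ ^ 2 - z k 2) := by
    simp only [θ]; linear_combination h3
  have h6 : |(z k 0 : ℝ) * θ| ≤ |(P 1 : ℝ)| * e + |(P 2 : ℝ)| * e := by
    rw [h5]
    exact abs_add_le_of_abs_le (abs_mul_le_of_abs_le le_rfl h2.1)
      (abs_mul_le_of_abs_le le_rfl h2.2)
  rw [abs_mul, abs_of_pos (by linarith : (0 : ℝ) < z k 0)] at h6
  have h7 : |θ| ≤ z k 0 * |θ| := le_mul_of_one_le_left hpos.le h4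
  have h8 : (|(P 1 : ℝ)| + |(P 2 : ℝ)|) * c * (2 ^ k : ℝ) ^ (-l) =
    |(P 1 : ℝ)| * e + |(P 2 : ℝ)| * e := by rw [he]; ring
  linarith

end IsDyadicSequence

/-- In a sequence that changes value between `a` and `b`, there is a last index whose value differs
from the value at `b`. -/
lemma exists_last_ne {α : Type*} (z : ℕ → α) {a b : ℕ} (hab : a < b) (h : z a ≠ z b) :
    ∃ i, a ≤ i ∧ i < b ∧ z i ≠ z b ∧ z (i + 1) = z b := by
  by_cases h1 : z (a + 1) = z b
  · exact ⟨a, le_rfl, hab, h, h1⟩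
  · have : a + 1 ≠ b := fun h2 => h1 (h2 ▸ rfl)
    obtain ⟨i, hi⟩ := exists_last_ne z (a := a + 1) (b := b) (by omega) h1
    exact ⟨i, by omega, hi.2⟩
termination_by b - a

namespace IsDyadicSequence

open scoped Matrix

variable {ξ l c : ℝ} {z : ℕ → Fin 3 → ℤ}

/-- Following the sequence until it leaves the plane spanned by two consecutive points. -/
lemma exists_turn (h : IsDyadicSequence ξ l c z) (hξ : NotQuadratic ξ) (hl : 0 < l) {j : ℕ}
    (hj : z j ≠ z (j + 1)) :
    ∃ i' j', j ≤ i' ∧ i' < j' ∧ z i' ≠ z j' ∧ z (i' + 1) = z j' ∧ z j' ≠ z (j' + 1) ∧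
      z i' ⬝ᵥ (z j ⨯₃ z (j + 1)) = 0 ∧ z j' ⬝ᵥ (z j ⨯₃ z (j + 1)) = 0 ∧
      z (j' + 1) ⬝ᵥ (z j ⨯₃ z (j + 1)) ≠ 0 := by
  classical
  set P := z j ⨯₃ z (j + 1) with hPd
  have hP : P ≠ 0 := h.cross_ne_zero hj
  have hex : ∃ m, j ≤ m ∧ z m ⬝ᵥ P ≠ 0 := h.exists_dot_ne_zero hξ hl hP j
  have h0 : z j ⬝ᵥ P = 0 := by rw [hPd, dot_self_cross]
  have h1 : z (j + 1) ⬝ᵥ P = 0 := by rw [hPd, dot_cross_self]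
  obtain ⟨hm1, hm2⟩ := Nat.find_spec hex
  have hmin : ∀ k, j ≤ k → k < Nat.find hex → z k ⬝ᵥ P = 0 := fun k hk1 hk2 => by
    by_contra hk
    exact Nat.find_min hex hk2 ⟨hk1, hk⟩
  set m := Nat.find hex
  have hmj : m ≠ j := fun hm => hm2 (hm ▸ h0)
  have hmj1 : m ≠ j + 1 := fun hm => hm2 (hm ▸ h1)
  obtain ⟨j', hj'⟩ : ∃ j', m = j' + 1 := ⟨m - 1, by omega⟩
  -- As `z j` and `z (j + 1)` differ, at least one of them differs from `z j'`, the last point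
  -- before the sequence leaves the plane.
  have hi : ∃ a, j ≤ a ∧ a < j' ∧ z a ≠ z j' := by
    by_cases hjj : z j = z j'
    · refine ⟨j + 1, by omega, ?_, fun h2 => hj (hjj.trans h2.symm)⟩
      have : j + 1 ≠ j' := fun h2 => hj (hjj.trans (h2 ▸ rfl))
      omega
    · exact ⟨j, le_rfl, by omega, hjj⟩
  obtain ⟨a, ha1, ha2, ha3⟩ := hi
  obtain ⟨i', hi1, hi2, hi3, hi4⟩ := exists_last_ne z ha2 ha3
  have hj'0 : z j' ⬝ᵥ P = 0 := hmin j' (by omega) (by omega)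
  rw [hj'] at hm2
  exact ⟨i', j', by omega, hi2, hi3, hi4, fun h2 => hm2 (h2 ▸ hj'0),
    hmin i' (by omega) (by omega), hj'0, hm2⟩

/-- A pair `i < j` such that `z j` first appears at `i + 1`, and three independent points. -/
structure IsTurn (z : ℕ → Fin 3 → ℤ) (i j : ℕ) : Prop where
  lt : i < j
  ne : z i ≠ z j
  eq : z (i + 1) = z j
  det : z (j + 1) ⬝ᵥ (z i ⨯₃ z j) ≠ 0

lemma exists_isTurn (h : IsDyadicSequence ξ l c z) (hξ : NotQuadratic ξ) (hl : 0 < l) (n : ℕ) :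
    ∃ i j, n ≤ i ∧ IsTurn z i j := by
  obtain ⟨j, hnj, hj⟩ := h.exists_ne_succ hξ.irrational hl n
  obtain ⟨i', j', h1, h2, h3, h4, h5, h6, h7, h8⟩ := h.exists_turn hξ hl hj
  exact ⟨i', j', by omega, h2, h3, h4,
    fun h0 => h8 (dot_eq_zero_of_dot_cross_eq_zero (h.cross_ne_zero h3) h6 h7 h0)⟩

/-- The point `z j` already occurs at index `i + 1`, so its size is at most `2 * 2 ^ i` although its
error is governed by `2 ^ j`. The first bound says that a nonzero integer determinant is at least 1.
-/
lemma turn_bounds (h : IsDyadicSequence ξ l c z) (hc : 0 ≤ c) (hl : 0 ≤ l) {i j : ℕ}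
    (ht : IsTurn z i j) :
    1 ≤ 10 * c ^ 2 * ((2 ^ j : ℝ) * (2 ^ i : ℝ) ^ (-l) * (2 ^ j : ℝ) ^ (-l)) ∧
    (∀ k : Fin 3, k ≠ 0 → |(((z i ⨯₃ z j) k : ℤ) : ℝ)| ≤ 3 * c * ((2 ^ i : ℝ) * (2 ^ i : ℝ) ^ (-l))) ∧
    |(((z i ⨯₃ z j) 0 : ℤ) : ℝ) + ((z i ⨯₃ z j) 1 : ℤ) * ξ + ((z i ⨯₃ z j) 2 : ℤ) * ξ ^ 2| ≤
      2 * c ^ 2 * ((2 ^ i : ℝ) ^ (-l) * (2 ^ j : ℝ) ^ (-l)) := by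
  have hi := h.approx i
  have hj := h.approx j
  have hj1 := h.approx (j + 1)
  have hij : (2 : ℝ) ^ i ≤ 2 ^ j := pow_le_pow_right₀ (by norm_num) ht.lt.le
  have bi := h.abs_le i
  have bj := h.abs_le (i + 1)
  rw [ht.eq, pow_succ] at bj
  have bj1 := h.abs_le (j + 1)
  rw [pow_succ] at hj1 bj1
  have hM : (0 : ℝ) < 2 ^ i := by positivity
  set M : ℝ := 2 ^ i
  set M' : ℝ := 2 ^ j
  have hM' : 0 < M' := hM.trans_le hij
  have hr : (M' * 2) ^ (-l) ≤ M' ^ (-l) :=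
    Real.rpow_le_rpow_of_nonpos hM' (by linarith) (by linarith)
  have hr2 : M' ^ (-l) ≤ M ^ (-l) := Real.rpow_le_rpow_of_nonpos hM hij (by linarith)
  have hj1 := hj1.mono (mul_le_mul_of_nonneg_left hr hc)
  set a := M ^ (-l) with ha
  set b := M' ^ (-l) with hb
  have ha0 : 0 < a := by positivity
  have hb0 : 0 < b := by positivity
  refine ⟨?_, ?_, ?_⟩
  · have h1 := hj1.abs_det_le hi hj
    have h2 : (1 : ℝ) ≤ |((z (j + 1) ⬝ᵥ (z i ⨯₃ z j) : ℤ) : ℝ)| := by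
      exact_mod_cast Int.one_le_abs ht.det
    refine (h2.trans h1).trans ?_
    calc _ ≤ (M' * 2) * (2 * (c * a) * (c * b)) +
          2 * (c * b) * (M * (c * b) + (M * 2) * (c * a)) := by gcongr
      _ ≤ (M' * 2) * (2 * (c * a) * (c * b)) +
          2 * (c * b) * (M' * (c * a) + (M' * 2) * (c * a)) := by gcongr
      _ = _ := by ring
  · have hb2 : |(z i 0 : ℝ)| * (c * b) + |(z j 0 : ℝ)| * (c * a) ≤ 3 * c * (M * a) := by
      calc _ ≤ M * (c * a) + M * 2 * (c * a) := by gcongr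
        _ = _ := by ring
    intro k hk
    fin_cases k
    · exact absurd rfl hk
    · exact (hi.abs_cross_one_le hj).trans hb2
    · exact (hi.abs_cross_two_le hj).trans hb2
  · exact (hi.abs_cross_value_le hj).trans (le_of_eq (by ring))

end IsDyadicSequence

/-! ### Small quadratic polynomials and the lower bounds for `λ_3` and `λ_4` -/

lemma Finset.exists_pos_forall_le {α : Type*} (S : Finset α) {f : α → ℝ} (h : ∀ s ∈ S, 0 < f s) :
    ∃ m, 0 < m ∧ ∀ s ∈ S, m ≤ f s := by
  rcases S.eq_empty_or_nonempty with rfl | hS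
  · exact ⟨1, one_pos, by simp⟩
  · obtain ⟨x, hx, hmin⟩ := S.exists_min_image f hS
    exact ⟨f x, h x hx, hmin⟩

/-- Only finitely many pairs `(P 1, P 2)` occur, and for each nonzero pair the best `P 0` is given
by a nearest integer. The zero pair leaves `|P 0| ≥ 1`. -/
lemma NotQuadratic.exists_pos_le_abs {ξ : ℝ} (hξ : NotQuadratic ξ) (B : ℝ) :
    ∃ m : ℝ, 0 < m ∧ ∀ P : Fin 3 → ℤ, P ≠ 0 → |(P 1 : ℝ)| ≤ B → |(P 2 : ℝ)| ≤ B →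
      m ≤ |(P 0 : ℝ) + P 1 * ξ + P 2 * ξ ^ 2| := by
  set S : Finset (ℤ × ℤ) := (Finset.Icc (-⌊B⌋) ⌊B⌋ ×ˢ Finset.Icc (-⌊B⌋) ⌊B⌋).filter (· ≠ 0)
  have hS : ∀ s ∈ S, 0 < |(s.1 * ξ + s.2 * ξ ^ 2) - round (s.1 * ξ + s.2 * ξ ^ 2)| := by
    intro s hs
    have hs0 : s ≠ 0 := (Finset.mem_filter.1 hs).2
    rw [abs_pos]
    have := hξ ![-round (s.1 * ξ + s.2 * ξ ^ 2), s.1, s.2] (fun h0 => hs0 ?_)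
    · simp at this
      intro h0
      apply this
      linarith
    · have h1 := congrFun h0 1
      have h2 := congrFun h0 2
      simp at h1 h2
      exact Prod.ext h1 h2
  obtain ⟨m, hm, h⟩ := S.exists_pos_forall_le hS
  refine ⟨min m 1, lt_min hm one_pos, fun P hP h1 h2 => ?_⟩
  by_cases h0 : (P 1, P 2) = (0 : ℤ × ℤ)
  · have h3 : P 1 = 0 := congrArg Prod.fst h0
    have h4 : P 2 = 0 := congrArg Prod.snd h0
    have h5 : P 0 ≠ 0 := fun h5 => hP (funext fun i => by fin_cases i <;> assumption)
    rw [h3, h4]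
    simp only [Int.cast_zero, zero_mul, add_zero]
    exact (min_le_right _ _).trans (by exact_mod_cast Int.one_le_abs h5)
  · have hmem : ∀ k : ℤ, |(k : ℝ)| ≤ B → k ∈ Finset.Icc (-⌊B⌋) ⌊B⌋ := by
      intro k hk
      have : |k| ≤ ⌊B⌋ := Int.le_floor.2 (by rwa [Int.cast_abs])
      rw [Finset.mem_Icc]
      exact abs_le.1 this
    refine (min_le_left _ _).trans ((h (P 1, P 2) ?_).trans ?_)
    · exact Finset.mem_filter.2 ⟨Finset.mem_product.2 ⟨hmem _ h1, hmem _ h2⟩, h0⟩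
    · refine (round_le _ (-P 0)).trans (le_of_eq ?_)
      congr 1
      push_cast
      ring

namespace IsDyadicSequence

open scoped Matrix

variable {ξ l c : ℝ} {z : ℕ → Fin 3 → ℤ}

/-- The planes containing consecutive points give quadratic polynomials with small values. -/
lemma exists_small_values (h : IsDyadicSequence ξ l c z) (hc : 0 < c) (hl0 : 0 < l) (hl1 : l < 1)
    (hξ : NotQuadratic ξ) : ∃ C : ℝ, 0 < C ∧ ∀ B : ℝ, ∃ a b d : ℤ,
      B ≤ max |(a : ℝ)| |(b : ℝ)| ∧
      |(d : ℝ) + b * ξ + a * ξ ^ 2| ≤ C * max |(a : ℝ)| |(b : ℝ)| ^ (-(l / (1 - l) ^ 2)) := by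
  have hl1' : 0 < 1 - l := by linarith
  set k := l / (1 - l) with hk
  set W := l / (1 - l) ^ 2 with hW
  have hk0 : 0 < k := by positivity
  have hW0 : 0 < W := by positivity
  refine ⟨2 * c ^ 2 * (10 * c ^ 2) ^ k * (3 * c) ^ W, by positivity, fun B => ?_⟩
  obtain ⟨m, hm, hmin⟩ := hξ.exists_pos_le_abs (max B 1)
  obtain ⟨n, hn⟩ := exists_err_lt hl0 (2 * c ^ 2) hm
  obtain ⟨i, j, hni, ht⟩ := h.exists_isTurn hξ hl0 n
  obtain ⟨b1, b2, b3⟩ := h.turn_bounds hc.le hl0.le ht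
  have hni := hn i hni
  have hP : z i ⨯₃ z j ≠ 0 := h.cross_ne_zero ht.ne
  set P := z i ⨯₃ z j
  have hM1 : (1 : ℝ) ≤ 2 ^ i := one_le_pow₀ (by norm_num)
  have hM1' : (1 : ℝ) ≤ 2 ^ j := one_le_pow₀ (by norm_num)
  set M : ℝ := 2 ^ i
  set M' : ℝ := 2 ^ j
  have hM0 : 0 < M := by linarith
  have hM0' : 0 < M' := by linarith
  have hb1 : M' ^ (-l) ≤ 1 := Real.rpow_le_one_of_one_le_of_nonpos hM1' (by linarith)
  set H := max |(P 2 : ℝ)| |(P 1 : ℝ)| with hH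
  -- Polynomials of bounded height have values bounded away from 0 at `ξ`, whereas the value of `P`
  -- is below `m`.
  have hBH : max B 1 < H := by
    by_contra! hle
    have h1 := hmin P hP ((le_max_right _ _).trans hle) ((le_max_left _ _).trans hle)
    have h2 : 2 * c ^ 2 * (M ^ (-l) * M' ^ (-l)) ≤ 2 * c ^ 2 * M ^ (-l) := by
      gcongr
      exact mul_le_of_le_one_right (by positivity) hb1
    linarith
  have hH0 : 0 < H := lt_of_lt_of_le one_pos ((le_max_right _ _).trans hBH.le)
  have hHM : H ≤ 3 * c * M ^ (1 - l) := by
    have e : M ^ (1 - l) = M * M ^ (-l) := by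
      rw [sub_eq_add_neg, Real.rpow_add hM0, Real.rpow_one]
    rw [e]
    exact max_le (b2 2 (by decide)) (b2 1 (by decide))
  refine ⟨P 2, P 1, P 0, (le_max_left _ _).trans hBH.le, b3.trans ?_⟩
  have hMl : M ^ l ≤ 10 * c ^ 2 * M' ^ (1 - l) := by
    have e : M' ^ (1 - l) = M' * M' ^ (-l) := by
      rw [sub_eq_add_neg, Real.rpow_add hM0', Real.rpow_one]
    have e2 : M ^ (-l) * M ^ l = 1 := by rw [← Real.rpow_add hM0, neg_add_cancel, Real.rpow_zero]
    have h1 := mul_le_mul_of_nonneg_right b1 (by positivity : 0 ≤ M ^ l)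
    rw [e]
    calc M ^ l = 1 * M ^ l := (one_mul _).symm
      _ ≤ _ := h1
      _ = 10 * c ^ 2 * (M' * M' ^ (-l)) * (M ^ (-l) * M ^ l) := by ring
      _ = _ := by rw [e2, mul_one]
  -- The determinant bound, raised to the power `-k`, replaces `M'` by `M`. The value is then `≪ M ^
  -- (-l - l k) = M ^ (-k)`, and the height bound converts this into a power of `H`.
  have hbk : M' ^ (-l) ≤ (10 * c ^ 2) ^ k * M ^ (-(l * k)) := by
    have h1 : (10 * c ^ 2 * M' ^ (1 - l)) ^ (-k) ≤ (M ^ l) ^ (-k) :=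
      Real.rpow_le_rpow_of_nonpos (by positivity) hMl (by linarith)
    rw [Real.mul_rpow (by positivity) (by positivity), ← Real.rpow_mul hM0'.le,
      ← Real.rpow_mul hM0.le, Real.rpow_neg (by positivity)] at h1
    have e1 : (1 - l) * -k = -l := by rw [hk]; field_simp
    have e2 : l * -k = -(l * k) := by ring
    rw [e1, e2] at h1
    rwa [inv_mul_le_iff₀ (by positivity)] at h1
  have hHW : M ^ (-k) ≤ (3 * c) ^ W * H ^ (-W) := by
    have h1 : (3 * c * M ^ (1 - l)) ^ (-W) ≤ H ^ (-W) :=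
      Real.rpow_le_rpow_of_nonpos hH0 hHM (by linarith)
    rw [Real.mul_rpow (by positivity) (by positivity), ← Real.rpow_mul hM0.le,
      Real.rpow_neg (by positivity)] at h1
    have e1 : (1 - l) * -W = -k := by rw [hk, hW]; field_simp
    rw [e1] at h1
    rwa [inv_mul_le_iff₀ (by positivity)] at h1
  have e3 : M ^ (-l) * M ^ (-(l * k)) = M ^ (-k) := by
    rw [← Real.rpow_add hM0]
    congr 1
    rw [hk]; field_simp; ring
  calc 2 * c ^ 2 * (M ^ (-l) * M' ^ (-l))
      ≤ 2 * c ^ 2 * (M ^ (-l) * ((10 * c ^ 2) ^ k * M ^ (-(l * k)))) := by gcongr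
    _ = 2 * c ^ 2 * (10 * c ^ 2) ^ k * (M ^ (-l) * M ^ (-(l * k))) := by ring
    _ ≤ 2 * c ^ 2 * (10 * c ^ 2) ^ k * ((3 * c) ^ W * H ^ (-W)) := by rw [e3]; gcongr
    _ = _ := by ring

end IsDyadicSequence

/-- For `W = l / (1 - l) ^ 2 ≤ n - 1` the bound is nonpositive and there is nothing to prove;
otherwise both stages apply. -/
lemma le_ordinaryExponent_of_lt_uniformExponent {ξ l : ℝ} (hξ : NotQuadratic ξ) (hl0 : 0 < l)
    (hl1 : l < 1) (hl : (l : EReal) < uniformExponent 2 ξ) (n : ℕ) :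
    (((l / (1 - l) ^ 2 + 1 - n) / (l / (1 - l) ^ 2 + n + 1) : ℝ) : EReal) ≤
      ordinaryExponent (n + 1) ξ := by
  have hl1' : 0 < 1 - l := by linarith
  rcases le_or_gt (l / (1 - l) ^ 2) ((n : ℝ) - 1) with hW | hW
  · refine le_trans ?_ ((uniformExponentVec_nonneg _).trans
      (uniformExponentVec_le_ordinaryExponentVec _))
    have : (l / (1 - l) ^ 2 + 1 - n) / (l / (1 - l) ^ 2 + n + 1) ≤ 0 :=
      div_nonpos_of_nonpos_of_nonneg (by linarith) (by positivity)
    exact_mod_cast this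
  · obtain ⟨c, hc, hu⟩ := exists_uniformlyApproximable hl0.le hl
    obtain ⟨z, hz⟩ := hu.exists_isDyadicSequence
    obtain ⟨C, hC, h⟩ := hz.exists_small_values hc hl0 hl1 hξ
    exact le_ordinaryExponent_of_small_values hξ.irrational.ne_zero hC (by positivity) hW h

/-- Limit form of the lower bound. -/
lemma le_ordinaryExponent_of_uniformExponent_eq {ξ l : ℝ} (hξ : NotQuadratic ξ) (hl1 : l ≤ 1)
    (hl : uniformExponent 2 ξ = l) {n : ℕ} (hn : 1 < n) {f : ℝ → ℝ} (hf : ContinuousAt f l)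
    (hfW : ∀ x, x < 1 → f x = (x / (1 - x) ^ 2 + 1 - n) / (x / (1 - x) ^ 2 + n + 1)) :
    ((f l : ℝ) : EReal) ≤ ordinaryExponent (n + 1) ξ := by
  have hl0 : 0 ≤ l := by
    have := uniformExponentVec_nonneg (veronesePoint 2 ξ)
    have h2 : (0 : EReal) ≤ l := hl ▸ this
    exact_mod_cast h2
  -- For `l = 0` there is no positive exponent below `l` to start from, but the claimed bound is
  -- negative since `n > 1`.
  rcases hl0.eq_or_lt with rfl | hpos
  · refine le_trans ?_ ((uniformExponentVec_nonneg _).trans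
      (uniformExponentVec_le_ordinaryExponentVec _))
    rw [hfW 0 one_pos]
    have hn' : (1 : ℝ) < n := by exact_mod_cast hn
    have : ((0 : ℝ) / (1 - 0) ^ 2 + 1 - n) / (0 / (1 - 0) ^ 2 + n + 1) ≤ 0 :=
      div_nonpos_of_nonpos_of_nonneg (by simp; linarith) (by simp; positivity)
    exact_mod_cast this
  · have ht : Tendsto (fun x => ((f x : ℝ) : EReal)) (nhdsWithin l (Set.Iio l))
        (nhds ((f l : ℝ) : EReal)) :=
      (continuous_coe_real_ereal.tendsto _).comp (hf.tendsto.mono_left nhdsWithin_le_nhds)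
    refine le_of_tendsto ht ?_
    filter_upwards [Ioo_mem_nhdsLT hpos] with x hx
    have hx1 : x < 1 := hx.2.trans_le hl1
    rw [hfW x hx1]
    exact le_ordinaryExponent_of_lt_uniformExponent hξ hx.1 hx1
      (by rw [hl]; exact_mod_cast hx.2) n

/-! ### The Davenport–Schmidt inequality -/

lemma ApproxWithin.abs_hankel_le {ξ e : ℝ} {z : Fin 3 → ℤ} (h : ApproxWithin ξ z e) :
    |((z 0 * z 2 - z 1 ^ 2 : ℤ) : ℝ)| ≤ |(z 0 : ℝ)| * ((2 * |ξ| + 1) * e) + e ^ 2 := by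
  have e1 : ((z 0 * z 2 - z 1 ^ 2 : ℤ) : ℝ) =
      z 0 * (2 * ξ * (z 0 * ξ - z 1) - (z 0 * ξ ^ 2 - z 2)) - (z 0 * ξ - z 1) * (z 0 * ξ - z 1) := by
    push_cast; ring
  rw [e1]
  have h2 : |2 * ξ| ≤ 2 * |ξ| := by rw [abs_mul, abs_two]
  refine (abs_sub_le_of_abs_le (abs_mul_le_of_abs_le le_rfl (abs_sub_le_of_abs_le
    (abs_mul_le_of_abs_le h2 h.1) h.2)) (abs_mul_le_of_abs_le h.1 h.1)).trans (le_of_eq (by ring))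

open scoped Matrix in
/-- A degenerate point `z`, i.e. one proportional to `(m ^ 2, m * n, n ^ 2)`, is proportional to
every point `w` for which the minors of the pair are small. -/
lemma cross_eq_zero_of_hankel_eq_zero {z w : Fin 3 → ℤ} (hz0 : 0 < z 0)
    (hz : z 0 * z 2 = z 1 ^ 2) {T : ℝ} (hT : T ^ 2 < z 0)
    (h1 : |(((w ⨯₃ z) 1 : ℤ) : ℝ)| ≤ T) (h2 : |(((w ⨯₃ z) 2 : ℤ) : ℝ)| ≤ T) : w ⨯₃ z = 0 := by
  set g : ℤ := ((Int.gcd (z 0) (z 1) : ℕ) : ℤ) with hg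
  have hgpos : 0 < g := by
    rw [hg]; exact_mod_cast Int.gcd_pos_of_ne_zero_left _ hz0.ne'
  obtain ⟨m, hm⟩ : g ∣ z 0 := Int.gcd_dvd_left _ _
  obtain ⟨n, hn⟩ : g ∣ z 1 := Int.gcd_dvd_right _ _
  have hcop : IsCoprime m n := by
    have hb : g = z 0 * Int.gcdA (z 0) (z 1) + z 1 * Int.gcdB (z 0) (z 1) := Int.gcd_eq_gcd_ab _ _
    refine ⟨Int.gcdA (z 0) (z 1), Int.gcdB (z 0) (z 1), mul_left_cancel₀ hgpos.ne' ?_⟩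
    linear_combination -hb - Int.gcdA (z 0) (z 1) * hm - Int.gcdB (z 0) (z 1) * hn
  have hmpos : 0 < m := by
    by_contra! h0
    nlinarith
  have h3 : m * z 2 = g * n ^ 2 := by
    refine mul_left_cancel₀ hgpos.ne' ?_
    rw [hm, hn] at hz
    linear_combination hz
  -- This gives `z = h (m², m n, n²)` and `g = h m`, so that `g² ≥ z 0 > T²`. The second minor is a
  -- multiple of `g`, and once it vanishes the first one is too, so bounds by `T < g` force both to
  -- be 0.
  obtain ⟨h, hh⟩ : m ∣ g := hcop.pow_right.dvd_of_dvd_mul_right ⟨z 2, h3.symm⟩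
  have hhpos : 0 < h := by
    by_contra! h0
    nlinarith
  have hz2 : z 2 = h * n ^ 2 := by
    refine mul_left_cancel₀ hmpos.ne' ?_
    rw [h3, hh]; ring
  have hz0' : z 0 = h * m ^ 2 := by rw [hm, hh]; ring
  have hz1' : z 1 = h * (m * n) := by rw [hn, hh]; ring
  have hgT : T < g := by
    have : (z 0 : ℝ) ≤ g ^ 2 := by
      have : z 0 ≤ g ^ 2 := by
        rw [hm, hh]
        nlinarith [mul_pos hmpos hmpos, mul_pos (mul_pos hmpos hmpos) hhpos]
      exact_mod_cast this
    exact lt_of_pow_lt_pow_left₀ 2 (by exact_mod_cast hgpos.le) (hT.trans_le this)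
  have hzero : ∀ I : ℤ, |((g * I : ℤ) : ℝ)| ≤ T → I = 0 := by
    intro I hI
    by_contra h0
    have h4 : (1 : ℝ) ≤ |(I : ℝ)| := by exact_mod_cast Int.one_le_abs h0
    have h5 : (0 : ℝ) < g := by exact_mod_cast hgpos
    push_cast at hI
    rw [abs_mul, abs_of_pos h5] at hI
    nlinarith
  have c0 : (w ⨯₃ z) 0 = w 1 * z 2 - w 2 * z 1 := by simp [cross_apply]
  have c1 : (w ⨯₃ z) 1 = w 2 * z 0 - w 0 * z 2 := by simp [cross_apply]
  have c2 : (w ⨯₃ z) 2 = w 0 * z 1 - w 1 * z 0 := by simp [cross_apply]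
  have I1 : n * w 0 - m * w 1 = 0 := by
    apply hzero
    convert h2 using 3
    rw [c2, hm, hn]; ring
  have I2 : m * w 2 - n * w 1 = 0 := by
    apply hzero
    convert h1 using 3
    rw [c1, hz0', hz2, hh]
    linear_combination h * n * I1
  ext i
  fin_cases i
  · change (w ⨯₃ z) 0 = 0
    rw [c0, hz1', hz2]
    linear_combination -h * n * I2
  · change (w ⨯₃ z) 1 = 0
    rw [c1, hz0', hz2]
    linear_combination h * m * I2 - h * n * I1
  · change (w ⨯₃ z) 2 = 0
    rw [c2, hz0', hz1']
    linear_combination h * m * I1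

namespace IsDyadicSequence

open scoped Matrix

variable {ξ l c : ℝ} {z : ℕ → Fin 3 → ℤ}

lemma exists_le_first (h : IsDyadicSequence ξ l c z) (hξ : Irrational ξ) (hl : 0 < l) (B : ℝ) :
    ∃ n, ∀ j, n ≤ j → B < z j 0 := by
  obtain ⟨m, hm, hmin⟩ := hξ.exists_pos_le_abs_mul_sub B
  obtain ⟨n, hn⟩ := exists_err_lt hl c hm
  refine ⟨n, fun j hj => ?_⟩
  by_contra! hB
  have hpos := h.one_le j
  have h1 := hmin (z j 0) (z j 1) (by have := h.pos j; omega)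
    (by rwa [abs_of_pos (by linarith)])
  linarith [(h.approx j).1, hn j hj]

/-- A degenerate point `z j` with first coordinate `Z` is compared with the point at a scale just
below `Z / 2`. Their minors are `≪ Z ^ (1 - l)`, which is below `Z ^ (1 / 2)` because `l > 1 / 2`,
so the points are proportional and, being primitive, equal; but their first coordinates differ. -/
lemma exists_hankel_ne_zero (h : IsDyadicSequence ξ l c z) (hξ : Irrational ξ) (hc : 0 < c)
    (hl : 1 / 2 < l) : ∃ n, ∀ j, n ≤ j → z j 0 * z j 2 - z j 1 ^ 2 ≠ 0 := by
  obtain ⟨B, hB1, hB⟩ := exists_mul_rpow_neg_lt (c * (1 + 4 ^ l)) (sub_pos.2 hl) one_pos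
  obtain ⟨n, hn⟩ := h.exists_le_first hξ (by linarith) (max B 2)
  refine ⟨n, fun j hj h0 => ?_⟩
  have hBz : B ≤ z j 0 := (le_max_left _ _).trans (hn j hj).le
  have h2z : (2 : ℝ) ≤ z j 0 := (le_max_right _ _).trans (hn j hj).le
  set Z : ℝ := ((z j 0 : ℤ) : ℝ) with hZ
  have hZ0 : 0 < Z := by linarith
  -- `2 ^ b ≤ Z / 2` separates `z b` from `z j`, and `2 ^ b > Z / 4` keeps its error `≪ Z ^ (-l)`.
  obtain ⟨b, hb1, hb2⟩ := exists_nat_pow_near (x := Z / 2) (y := 2) (by linarith) (by norm_num)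
  have hne : z b ≠ z j := by
    intro h1
    have := h.le b
    rw [h1, ← hZ] at this
    linarith
  have e1 : ApproxWithin ξ (z b) (c * (4 ^ l * Z ^ (-l))) := by
    refine (h.approx b).mono (mul_le_mul_of_nonneg_left ?_ hc.le)
    have : (Z / 4) ^ (-l) = 4 ^ l * Z ^ (-l) := by
      rw [Real.div_rpow hZ0.le (by norm_num), Real.rpow_neg (by norm_num : (0 : ℝ) ≤ 4),
        div_inv_eq_mul, mul_comm]
    rw [← this]
    refine Real.rpow_le_rpow_of_nonpos (by positivity) ?_ (by linarith)
    rw [pow_succ] at hb2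
    linarith
  have e2 : ApproxWithin ξ (z j) (c * Z ^ (-l)) := by
    refine (h.approx j).mono (mul_le_mul_of_nonneg_left ?_ hc.le)
    exact Real.rpow_le_rpow_of_nonpos hZ0 (h.le j) (by linarith)
  have hbd : |(z b 0 : ℝ)| * (c * Z ^ (-l)) + |(z j 0 : ℝ)| * (c * (4 ^ l * Z ^ (-l))) ≤
      c * (1 + 4 ^ l) * Z ^ (1 - l) := by
    have f1 : |(z b 0 : ℝ)| ≤ Z := (h.abs_le b).trans (by linarith)
    have f2 : |(z j 0 : ℝ)| ≤ Z := by rw [← hZ, abs_of_pos hZ0]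
    have e : Z ^ (1 - l) = Z * Z ^ (-l) := by
      rw [sub_eq_add_neg, Real.rpow_add hZ0, Real.rpow_one]
    rw [e]
    calc _ ≤ Z * (c * Z ^ (-l)) + Z * (c * (4 ^ l * Z ^ (-l))) := by gcongr
      _ = _ := by ring
  have hT : (c * (1 + 4 ^ l) * Z ^ (1 - l)) ^ 2 < Z := by
    have h1 := hB Z hBz
    have e : c * (1 + 4 ^ l) * Z ^ (1 - l) = (c * (1 + 4 ^ l) * Z ^ (-(l - 1 / 2))) * Z ^ (1 / 2 : ℝ) := by
      rw [mul_assoc _ (Z ^ _) (Z ^ _), ← Real.rpow_add hZ0]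
      congr 2; ring
    have e3 : (Z ^ (1 / 2 : ℝ)) ^ 2 = Z := by
      rw [← Real.sqrt_eq_rpow, Real.sq_sqrt hZ0.le]
    rw [e, mul_pow, e3]
    refine mul_lt_of_lt_one_left hZ0 ?_
    exact pow_lt_one₀ (by positivity) h1 (by norm_num)
  refine hne (h.eq_of_cross_eq_zero (cross_eq_zero_of_hankel_eq_zero (h.pos j) (by linarith) hT
    ((e1.abs_cross_one_le e2).trans hbd) ((e1.abs_cross_two_le e2).trans hbd)))

/-- The form `z 0 * z 2 - z 1 ^ 2` vanishes at `(1, ξ, ξ²)`, so at `z j` it is at most size times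
error, while it is a nonzero integer. -/
lemma exists_one_le_mul (h : IsDyadicSequence ξ l c z) (hξ : Irrational ξ) (hc : 0 < c)
    (hl : 1 / 2 < l) : ∃ C, 0 < C ∧ ∃ n, ∀ j, n ≤ j → z j 0 * z j 2 - z j 1 ^ 2 ≠ 0 ∧
      1 ≤ C * (z j 0 * (2 ^ j : ℝ) ^ (-l)) := by
  obtain ⟨n, hn⟩ := h.exists_hankel_ne_zero hξ hc hl
  refine ⟨(2 * |ξ| + 1) * c + c ^ 2, by positivity, n, fun j hj => ⟨hn j hj, ?_⟩⟩
  have h1 : (1 : ℝ) ≤ |((z j 0 * z j 2 - z j 1 ^ 2 : ℤ) : ℝ)| := by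
    exact_mod_cast Int.one_le_abs (hn j hj)
  have h2 := (h.approx j).abs_hankel_le
  have h3 := h.one_le j
  rw [abs_of_pos (by linarith : (0 : ℝ) < z j 0)] at h2
  have h4 : (2 ^ j : ℝ) ^ (-l) ≤ 1 :=
    Real.rpow_le_one_of_one_le_of_nonpos (one_le_pow₀ (by norm_num)) (by linarith)
  set a := (2 ^ j : ℝ) ^ (-l)
  have ha0 : 0 < a := by positivity
  refine (h1.trans h2).trans ?_
  have h5 : (c * a) ^ 2 ≤ c ^ 2 * (z j 0 * a) := by
    rw [mul_pow]
    gcongr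
    calc a ^ 2 = a * a := sq a
      _ ≤ z j 0 * a := by gcongr; linarith
  calc _ ≤ (z j 0 : ℝ) * ((2 * |ξ| + 1) * (c * a)) + c ^ 2 * (z j 0 * a) := by gcongr
    _ = _ := by ring

/-- The inequality of Davenport and Schmidt. -/
lemma sq_add_le_one (h : IsDyadicSequence ξ l c z) (hξ : NotQuadratic ξ) (hc : 0 < c)
    (hl : 1 / 2 < l) (hl1 : l < 1) : l ^ 2 + l ≤ 1 := by
  by_contra! hlt
  obtain ⟨C, hC, n, hn⟩ := h.exists_one_le_mul hξ.irrational hc hl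
  set K := (10 * c ^ 2) ^ l * (2 * C) ^ (1 - l)
  obtain ⟨n', hn'⟩ := exists_err_lt (l := l ^ 2 + l - 1) (by linarith) K one_pos
  obtain ⟨i, j, hi, ht⟩ := h.exists_isTurn hξ (by linarith) (max n n')
  have b1 := (h.turn_bounds hc.le (by linarith) ht).1
  have b2 := (hn j (by have := ht.lt; have := le_max_left n n'; omega)).2
  have b3 := h.le (i + 1)
  have b4 := hn' i ((le_max_right _ _).trans hi)
  rw [ht.eq, pow_succ] at b3
  have hM0 : (0 : ℝ) < 2 ^ i := by positivity
  have hM0' : (0 : ℝ) < 2 ^ j := by positivity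
  set M : ℝ := 2 ^ i
  set M' : ℝ := 2 ^ j
  have hMl : M ^ l ≤ 10 * c ^ 2 * M' ^ (1 - l) := by
    have e : M' ^ (1 - l) = M' * M' ^ (-l) := by
      rw [sub_eq_add_neg, Real.rpow_add hM0', Real.rpow_one]
    have e2 : M ^ (-l) * M ^ l = 1 := by rw [← Real.rpow_add hM0, neg_add_cancel, Real.rpow_zero]
    have h1 := mul_le_mul_of_nonneg_right b1 (by positivity : 0 ≤ M ^ l)
    rw [e]
    calc M ^ l = 1 * M ^ l := (one_mul _).symm
      _ ≤ _ := h1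
      _ = 10 * c ^ 2 * (M' * M' ^ (-l)) * (M ^ (-l) * M ^ l) := by ring
      _ = _ := by rw [e2, mul_one]
  have hMl' : M' ^ l ≤ 2 * C * M := by
    -- The determinant gave `M ^ l ≪ M' ^ (1 - l)`; the nonzero form at `z j`, whose first
    -- coordinate is at most `2 M`, gives `M' ^ l ≪ M`. Together `M ^ (l²) ≪ M ^ (1 - l)`,
    -- impossible for large `M` when `l² + l > 1`.
    have h1 : 1 ≤ C * (M * 2 * M' ^ (-l)) := b2.trans (by gcongr)
    rw [Real.rpow_neg hM0'.le, ← div_eq_mul_inv, ← mul_div_assoc, le_div_iff₀ (by positivity)] at h1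
    linarith
  have h2 : M ^ (l ^ 2) ≤ K * M ^ (1 - l) := by
    calc M ^ (l ^ 2) = (M ^ l) ^ l := by rw [← Real.rpow_mul hM0.le]; congr 1; ring
      _ ≤ (10 * c ^ 2 * M' ^ (1 - l)) ^ l := by gcongr
      _ = (10 * c ^ 2) ^ l * (M' ^ l) ^ (1 - l) := by
        rw [Real.mul_rpow (by positivity) (by positivity), ← Real.rpow_mul hM0'.le,
          ← Real.rpow_mul hM0'.le, mul_comm l]
      _ ≤ (10 * c ^ 2) ^ l * (2 * C * M) ^ (1 - l) := by gcongr
      _ = _ := by rw [Real.mul_rpow (by positivity) hM0.le]; ring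
  have e : M ^ (-(l ^ 2 + l - 1)) = M ^ (1 - l) / M ^ (l ^ 2) := by
    rw [← Real.rpow_sub hM0]; congr 1; ring
  rw [e, ← mul_div_assoc, div_lt_one (by positivity)] at b4
  linarith

end IsDyadicSequence

lemma uniformExponent_sq_add_le_one {ξ l : ℝ} (hξ : NotQuadratic ξ) (hl : 1 / 2 < l) (hl1 : l < 1)
    (h : (l : EReal) < uniformExponent 2 ξ) : l ^ 2 + l ≤ 1 := by
  obtain ⟨c, hc, hu⟩ := exists_uniformlyApproximable (by linarith) h
  obtain ⟨z, hz⟩ := hu.exists_isDyadicSequence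
  exact hz.sq_add_le_one hξ hc hl hl1

/-! ### Extremal numbers: the sequence of Roy -/

section

open scoped Matrix

/-- The planes orthogonal to `P` and `P'` are distinct and meet in the line of `y`. As `y` is
primitive, `P × P'` is a nonzero integer multiple of it. -/
lemma abs_first_le_of_planes {P P' y w : Fin 3 → ℤ} (hy : IsPrimitivePoint y) (hyP : y ⬝ᵥ P = 0)
    (hyP' : y ⬝ᵥ P' = 0) (hP' : P' ≠ 0) (hwP' : w ⬝ᵥ P' = 0) (hwP : w ⬝ᵥ P ≠ 0) {H H' : ℝ}
    (h1 : |(P 1 : ℝ)| ≤ H) (h2 : |(P 2 : ℝ)| ≤ H) (h1' : |(P' 1 : ℝ)| ≤ H')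
    (h2' : |(P' 2 : ℝ)| ≤ H') : |(y 0 : ℝ)| ≤ 2 * H * H' := by
  have hne : P ⨯₃ P' ≠ 0 := fun h0 => hwP (dot_eq_zero_of_cross_eq_zero h0 hP' hwP')
  have hpar : (P ⨯₃ P') ⨯₃ y = 0 := by
    rw [← neg_cross, cross_cross_eq_zero_of_dot_eq_zero (by rwa [dotProduct_comm])
      (by rwa [dotProduct_comm]), neg_zero]
  obtain ⟨n, hn⟩ := hy _ hpar
  have hn0 : n ≠ 0 := by
    rintro rfl
    exact hne (by rw [hn, zero_smul])
  have h0 : n * y 0 = P 1 * P' 2 - P 2 * P' 1 := by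
    have := congrFun hn 0
    simp [cross_apply] at this
    exact this.symm
  have h0' : (n : ℝ) * y 0 = P 1 * P' 2 - P 2 * P' 1 := by exact_mod_cast h0
  have hn1 : (1 : ℝ) ≤ |(n : ℝ)| := by exact_mod_cast Int.one_le_abs hn0
  calc |(y 0 : ℝ)| ≤ |(n : ℝ)| * |(y 0 : ℝ)| := le_mul_of_one_le_left (abs_nonneg _) hn1
    _ = |(P 1 : ℝ) * P' 2 - P 2 * P' 1| := by rw [← abs_mul, h0']
    _ ≤ H * H' + H * H' := abs_sub_le_of_abs_le (abs_mul_le_of_abs_le h1 h2')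
        (abs_mul_le_of_abs_le h2 h1')
    _ = _ := by ring

end

/-- A sequence of approximation points to `(ξ, ξ ^ 2)` with the properties shown by Roy for
extremal numbers. -/
structure IsExtremalSequence (ξ C : ℝ) (y : ℕ → Fin 3 → ℤ) : Prop where
  pos : ∀ k, 1 ≤ y k 0
  double : ∀ k, 2 * (y k 0 : ℝ) ≤ y (k + 1) 0
  growth_le : ∀ k, (y (k + 1) 0 : ℝ) ≤ C * (y k 0 : ℝ) ^ Real.goldenRatio
  le_growth : ∀ k, (y k 0 : ℝ) ^ Real.goldenRatio ≤ C * y (k + 1) 0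
  approx : ∀ k, ApproxWithin ξ (y k) (C / y k 0)
  hankel : ∀ k, y k 0 * y k 2 - y k 1 ^ 2 ≠ 0
  prim : ∀ k, IsPrimitivePoint (y k)
  det : ∀ k, y (k + 2) ⬝ᵥ (crossProduct (y k) (y (k + 1))) ≠ 0

lemma goldenRatio_eq : Real.goldenRatio = 1 + 1 / Real.goldenRatio := by
  have h := Real.goldenRatio_sq
  have e : 1 / Real.goldenRatio = Real.goldenRatio - 1 := by
    rw [div_eq_iff Real.goldenRatio_ne_zero]
    linarith
  linarith

lemma inv_goldenRatio_sq_add : (1 / Real.goldenRatio) ^ 2 + 1 / Real.goldenRatio = 1 := by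
  have h := Real.goldenRatio_sq
  have e : 1 / Real.goldenRatio = Real.goldenRatio - 1 := by linarith [goldenRatio_eq]
  rw [e]
  linarith

lemma inv_goldenRatio_bounds : 3 / 5 < 1 / Real.goldenRatio ∧ 1 / Real.goldenRatio < 2 / 3 := by
  have h := inv_goldenRatio_sq_add
  have h0 : 0 < 1 / Real.goldenRatio := one_div_pos.2 Real.goldenRatio_pos
  constructor <;> nlinarith

lemma rpow_inv_goldenRatio_rpow {x : ℝ} (hx : 0 ≤ x) :
    (x ^ (1 / Real.goldenRatio)) ^ Real.goldenRatio = x := by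
  rw [← Real.rpow_mul hx, one_div_mul_cancel Real.goldenRatio_ne_zero, Real.rpow_one]

namespace IsDyadicSequence

open scoped Matrix

variable {ξ l c : ℝ} {z : ℕ → Fin 3 → ℤ}

lemma abs_cross_succ_le (h : IsDyadicSequence ξ l c z) (hc : 0 ≤ c) (hl : 0 ≤ l) (j : ℕ)
    {k : Fin 3} (hk : k ≠ 0) :
    |(((z j ⨯₃ z (j + 1)) k : ℤ) : ℝ)| ≤ 3 * c * (2 ^ j : ℝ) ^ (1 - l) := by
  have hj := h.approx j
  have hj1 := h.approx (j + 1)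
  have bj := h.abs_le j
  have bj1 := h.abs_le (j + 1)
  rw [pow_succ] at hj1 bj1
  have hM : (0 : ℝ) < 2 ^ j := by positivity
  set M : ℝ := 2 ^ j
  have hr : (M * 2) ^ (-l) ≤ M ^ (-l) :=
    Real.rpow_le_rpow_of_nonpos hM (by linarith) (by linarith)
  have hj1 := hj1.mono (mul_le_mul_of_nonneg_left hr hc)
  have e : M ^ (1 - l) = M * M ^ (-l) := by
    rw [sub_eq_add_neg, Real.rpow_add hM, Real.rpow_one]
  have hb2 : |(z j 0 : ℝ)| * (c * M ^ (-l)) + |(z (j + 1) 0 : ℝ)| * (c * M ^ (-l)) ≤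
      3 * c * M ^ (1 - l) := by
    rw [e]
    calc _ ≤ M * (c * M ^ (-l)) + M * 2 * (c * M ^ (-l)) := by gcongr
      _ = _ := by ring
  fin_cases k
  · exact absurd rfl hk
  · exact (hj.abs_cross_one_le hj1).trans hb2
  · exact (hj.abs_cross_two_le hj1).trans hb2

/-- The chain of successive turns. -/
lemma exists_turn_chain (h : IsDyadicSequence ξ l c z) (hξ : NotQuadratic ξ) (hl : 0 < l) (n : ℕ) :
    ∃ I J : ℕ → ℕ, n ≤ J 0 ∧ ∀ k, J k ≤ I k ∧ I k < J (k + 1) ∧ z (J k) ≠ z (J k + 1) ∧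
      IsTurn z (I k) (J (k + 1)) ∧ z (J (k + 1)) ⬝ᵥ (z (J k) ⨯₃ z (J k + 1)) = 0 ∧
      z (J (k + 1) + 1) ⬝ᵥ (z (J k) ⨯₃ z (J k + 1)) ≠ 0 := by
  obtain ⟨j₀, hn, hj₀⟩ := h.exists_ne_succ hξ.irrational hl n
  have hstep : ∀ s : {j // z j ≠ z (j + 1)}, ∃ (i' : ℕ) (t : {j // z j ≠ z (j + 1)}),
      s.1 ≤ i' ∧ i' < t.1 ∧ IsTurn z i' t.1 ∧ z t.1 ⬝ᵥ (z s.1 ⨯₃ z (s.1 + 1)) = 0 ∧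
        z (t.1 + 1) ⬝ᵥ (z s.1 ⨯₃ z (s.1 + 1)) ≠ 0 := by
    rintro ⟨j, hj⟩
    obtain ⟨i', j', h1, h2, h3, h4, h5, h6, h7, h8⟩ := h.exists_turn hξ hl hj
    exact ⟨i', ⟨j', h5⟩, h1, h2, ⟨h2, h3, h4, fun h0 =>
      h8 (dot_eq_zero_of_dot_cross_eq_zero (h.cross_ne_zero h3) h6 h7 h0)⟩, h7, h8⟩
  choose f g hfg using hstep
  let S : ℕ → {j // z j ≠ z (j + 1)} := fun k => Nat.rec ⟨j₀, hj₀⟩ (fun _ s => g s) k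
  refine ⟨fun k => f (S k), fun k => (S k).1, hn, fun k => ?_⟩
  obtain ⟨h1, h2, h3, h4, h5⟩ := hfg (S k)
  exact ⟨h1, h2, (S k).2, h3, h4, h5⟩

/-- At `l = 1 / γ` the estimates behind the Davenport–Schmidt inequality must all be sharp. For the
point at a turn, with first coordinate `Y` and scales `U = 2 ^ I k`, `M = 2 ^ J (k + 1)`, one gets
`Y ≍ U ≍ M ^ l`. Also `M ≤ 2 ^ I (k + 1) ≪ M`, so the next first coordinate is `≍ M ≍ Y ^ γ`. -/
lemma exists_isExtremalSequence (h : IsDyadicSequence ξ (1 / Real.goldenRatio) c z) (hc : 0 < c)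
    (hξ : NotQuadratic ξ) : ∃ C y, 0 < C ∧ IsExtremalSequence ξ C y := by
  obtain ⟨hl35, hl23⟩ := inv_goldenRatio_bounds
  have hsq := inv_goldenRatio_sq_add
  have hγl := goldenRatio_eq
  have hγ0 := Real.goldenRatio_pos
  have hroot : ∀ x : ℝ, 0 ≤ x → (x ^ (1 / Real.goldenRatio)) ^ Real.goldenRatio = x :=
    fun x hx => rpow_inv_goldenRatio_rpow hx
  set γ := Real.goldenRatio with hγ
  set l := 1 / γ with hl
  have hl0 : 0 < l := by linarith
  obtain ⟨C₁, hC₁, n₁, hn₁⟩ := h.exists_one_le_mul hξ.irrational hc (by linarith)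
  set C₂ := (10 * c ^ 2) ^ γ with hC₂
  have hC₂0 : 0 < C₂ := by positivity
  set D := C₂ * C₁ * (2 * (3 * c) * (3 * c) * (2 * C₁) ^ l) with hD
  have hD0 : 0 < D := by positivity
  set C₃ := D ^ (1 / (1 - l)) with hC₃
  have hC₃0 : 0 < C₃ := by positivity
  set C := 2 * C₃ * C₁ ^ γ + (2 * C₂) ^ γ * (C₂ * C₁) + c * (2 * C₂) with hCdef
  have hC0 : 0 < C := by positivity
  obtain ⟨B, hB1, hB⟩ := exists_mul_rpow_neg_lt (2 * C) hl0 one_pos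
  obtain ⟨n₂, hn₂⟩ := h.exists_le_first hξ.irrational hl0 B
  obtain ⟨I, J, hJ0, hIJ⟩ := h.exists_turn_chain hξ hl0 (max n₁ n₂)
  have hJmono : ∀ k, max n₁ n₂ ≤ J k := by
    intro k
    induction k with
    | zero => exact hJ0
    | succ k ih =>
      obtain ⟨h1, h2, -⟩ := hIJ k
      omega
  have hM0 : ∀ k, (0 : ℝ) < 2 ^ J k := fun k => by positivity
  have hU0 : ∀ k, (0 : ℝ) < 2 ^ I k := fun k => by positivity
  have hY1 : ∀ k, (1 : ℝ) ≤ z (J (k + 1)) 0 := fun k => h.one_le _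
  -- comparison of the scales `2 ^ J k`, `2 ^ I k` and the first coordinates
  have ha : ∀ k, (2 ^ J (k + 1) : ℝ) ^ l ≤ C₁ * z (J (k + 1)) 0 := by
    intro k
    have h1 := (hn₁ (J (k + 1)) ((le_max_left _ _).trans (hJmono _))).2
    rw [Real.rpow_neg (hM0 _).le, ← div_eq_mul_inv, ← mul_div_assoc,
      one_le_div (Real.rpow_pos_of_pos (hM0 _) _)] at h1
    exact h1
  have ha' : ∀ k, (z (J (k + 1)) 0 : ℝ) ≤ 2 * 2 ^ I k := by
    intro k
    have h1 := h.le (I k + 1)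
    rw [(hIJ k).2.2.2.1.eq, pow_succ] at h1
    linarith
  have hb : ∀ k, (2 ^ I k : ℝ) ≤ C₂ * (2 ^ J (k + 1) : ℝ) ^ l := by
    intro k
    have b1 := (h.turn_bounds hc.le hl0.le (hIJ k).2.2.2.1).1
    have hM := hM0 (k + 1)
    have hU := hU0 k
    set M : ℝ := 2 ^ J (k + 1)
    set U : ℝ := 2 ^ I k
    have e2 : U ^ (-l) * U ^ l = 1 := by rw [← Real.rpow_add hU, neg_add_cancel, Real.rpow_zero]
    have e3 : M * M ^ (-l) = (M ^ l) ^ l := by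
      rw [← Real.rpow_mul hM.le]
      nth_rewrite 1 [← Real.rpow_one M]
      rw [← Real.rpow_add hM]
      congr 1; linarith
    have h2 : U ^ l ≤ 10 * c ^ 2 * (M ^ l) ^ l := by
      have h1 := mul_le_mul_of_nonneg_right b1 (by positivity : 0 ≤ U ^ l)
      calc U ^ l = 1 * U ^ l := (one_mul _).symm
        _ ≤ _ := h1
        _ = 10 * c ^ 2 * (M * M ^ (-l)) * (U ^ (-l) * U ^ l) := by ring
        _ = _ := by rw [e2, e3, mul_one]
    calc U = (U ^ l) ^ γ := (hroot U hU.le).symm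
      _ ≤ (10 * c ^ 2 * (M ^ l) ^ l) ^ γ := by gcongr
      _ = C₂ * M ^ l := by
        rw [Real.mul_rpow (by positivity) (by positivity), hroot _ (by positivity)]
  have hUY : ∀ k, (2 ^ I k : ℝ) ≤ C₂ * C₁ * z (J (k + 1)) 0 := by
    intro k
    refine (hb k).trans ?_
    rw [mul_assoc]
    exact mul_le_mul_of_nonneg_left (ha k) hC₂0.le
  have hYM : ∀ k, (z (J (k + 1)) 0 : ℝ) ≤ 2 * C₂ * (2 ^ J (k + 1) : ℝ) ^ l := by
    intro k
    have h1 := ha' k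
    have h2 := hb k
    linarith
  have hplane : ∀ k, z (J k) ⨯₃ z (J k + 1) ≠ 0 := fun k => h.cross_ne_zero (hIJ k).2.2.1
  -- The next turning point spans the intersection of two successive planes, so its first coordinate
  -- is `≪ (M * M') ^ (1 - l)`. Here `M' ^ (1 - l) = (M' ^ l) ^ l ≪ U ^ l`, whence `U ^ (1 - l) ≪ M
  -- ^ (1 - l)`.
  have hcl : ∀ k, (2 ^ I (k + 1) : ℝ) ≤ C₃ * 2 ^ J (k + 1) := by
    intro k
    have h1 := abs_first_le_of_planes (h.prim (J (k + 1 + 1))) (hIJ (k + 1)).2.2.2.2.1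
      (dot_self_cross _ (z (J (k + 1 + 1) + 1))) (hplane _) (dot_cross_self _ _)
      (hIJ (k + 1)).2.2.2.2.2
      (h.abs_cross_succ_le hc.le hl0.le _ (by decide : (1 : Fin 3) ≠ 0))
      (h.abs_cross_succ_le hc.le hl0.le _ (by decide : (2 : Fin 3) ≠ 0))
      (h.abs_cross_succ_le hc.le hl0.le _ (by decide : (1 : Fin 3) ≠ 0))
      (h.abs_cross_succ_le hc.le hl0.le _ (by decide : (2 : Fin 3) ≠ 0))
    rw [abs_of_pos (by linarith [hY1 (k + 1)])] at h1
    have h2 := hUY (k + 1)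
    have h3 := ha (k + 1)
    have h4 := ha' (k + 1)
    have hM := hM0 (k + 1)
    have hM' := hM0 (k + 1 + 1)
    have hU := hU0 (k + 1)
    set M : ℝ := 2 ^ J (k + 1)
    set M' : ℝ := 2 ^ J (k + 1 + 1)
    set U : ℝ := 2 ^ I (k + 1)
    set Y : ℝ := ((z (J (k + 1 + 1)) 0 : ℤ) : ℝ)
    have h5 : M' ^ (1 - l) ≤ (2 * C₁) ^ l * U ^ l := by
      have e : 1 - l = l * l := by linarith [sq l]
      calc M' ^ (1 - l) = (M' ^ l) ^ l := by rw [← Real.rpow_mul hM'.le, e]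
        _ ≤ (C₁ * (2 * U)) ^ l := by
          gcongr
          exact h3.trans (by gcongr)
        _ = _ := by rw [← Real.mul_rpow (by positivity) hU.le]; congr 1; ring
    have h6 : U ≤ D * M ^ (1 - l) * U ^ l := by
      calc U ≤ C₂ * C₁ * Y := h2
        _ ≤ C₂ * C₁ * (2 * (3 * c * M ^ (1 - l)) * (3 * c * M' ^ (1 - l))) := by gcongr
        _ ≤ C₂ * C₁ * (2 * (3 * c * M ^ (1 - l)) * (3 * c * ((2 * C₁) ^ l * U ^ l))) := by gcongr
        _ = _ := by rw [hD]; ring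
    have h7 : U ^ (1 - l) ≤ D * M ^ (1 - l) := by
      rw [Real.rpow_sub hU, Real.rpow_one, div_le_iff₀ (by positivity)]
      exact h6
    have hl1 : 0 < 1 - l := by linarith
    have hrt : ∀ x : ℝ, 0 ≤ x → (x ^ (1 - l)) ^ (1 / (1 - l)) = x := fun x hx => by
      rw [← Real.rpow_mul hx, mul_one_div_cancel hl1.ne', Real.rpow_one]
    calc U = (U ^ (1 - l)) ^ (1 / (1 - l)) := (hrt U hU.le).symm
      _ ≤ (D * M ^ (1 - l)) ^ (1 / (1 - l)) := by gcongr
      _ = _ := by rw [Real.mul_rpow hD0.le (by positivity), hrt M hM.le]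
  set y : ℕ → Fin 3 → ℤ := fun k => z (J (k + 1)) with hy
  have hg1 : ∀ k, (y (k + 1) 0 : ℝ) ≤ C * (y k 0 : ℝ) ^ γ := by
    intro k
    have h0 : (0 : ℝ) < z (J (k + 1)) 0 := by linarith [hY1 k]
    calc (y (k + 1) 0 : ℝ) ≤ 2 * 2 ^ I (k + 1) := ha' _
      _ ≤ 2 * (C₃ * 2 ^ J (k + 1)) := by linarith [hcl k]
      _ = 2 * C₃ * ((2 ^ J (k + 1) : ℝ) ^ l) ^ γ := by rw [hroot _ (hM0 _).le]; ring
      _ ≤ 2 * C₃ * (C₁ * z (J (k + 1)) 0) ^ γ := by gcongr; exact ha k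
      _ = 2 * C₃ * C₁ ^ γ * (y k 0 : ℝ) ^ γ := by
        rw [Real.mul_rpow hC₁.le h0.le]; simp only [hy]; ring
      _ ≤ _ := by
        gcongr
        rw [hCdef, add_assoc]
        exact le_add_of_nonneg_right (by positivity)
  have hg2 : ∀ k, (y k 0 : ℝ) ^ γ ≤ C * y (k + 1) 0 := by
    intro k
    have h0 : (0 : ℝ) < z (J (k + 1)) 0 := by linarith [hY1 k]
    have h0' : (0 : ℝ) < z (J (k + 1 + 1)) 0 := by linarith [hY1 (k + 1)]
    calc (y k 0 : ℝ) ^ γ ≤ (2 * C₂ * (2 ^ J (k + 1) : ℝ) ^ l) ^ γ := by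
          gcongr
          exact hYM k
      _ = (2 * C₂) ^ γ * 2 ^ J (k + 1) := by
        rw [Real.mul_rpow (by positivity) (by positivity), hroot _ (hM0 _).le]
      _ ≤ (2 * C₂) ^ γ * 2 ^ I (k + 1) := by
        gcongr
        · norm_num
        · exact (hIJ (k + 1)).1
      _ ≤ (2 * C₂) ^ γ * (C₂ * C₁ * z (J (k + 1 + 1)) 0) := by
        gcongr
        exact hUY (k + 1)
      _ = (2 * C₂) ^ γ * (C₂ * C₁) * y (k + 1) 0 := by simp only [hy]; ring
      _ ≤ _ := by
        have h1 : (2 * C₂) ^ γ * (C₂ * C₁) ≤ C := by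
          have : 0 < 2 * C₃ * C₁ ^ γ := by positivity
          have : 0 < c * (2 * C₂) := by positivity
          rw [hCdef]; linarith
        exact mul_le_mul_of_nonneg_right h1 h0'.le
  have hdouble : ∀ k, 2 * (y k 0 : ℝ) ≤ y (k + 1) 0 := by
    intro k
    have hpos : (0 : ℝ) < y k 0 := by have := hY1 k; simp only [hy]; linarith
    have hbig := hB (y k 0) (hn₂ (J (k + 1)) ((le_max_right _ _).trans (hJmono _))).le
    have h1 := hg2 k
    have e : (y k 0 : ℝ) ^ γ = y k 0 * (y k 0 : ℝ) ^ l := by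
      rw [hγl, Real.rpow_add hpos, Real.rpow_one]
    rw [Real.rpow_neg hpos.le, ← div_eq_mul_inv, div_lt_one (by positivity)] at hbig
    rw [e] at h1
    have h2 : (y k 0 : ℝ) * (2 * C) ≤ C * y (k + 1) 0 :=
      (mul_le_mul_of_nonneg_left hbig.le hpos.le).trans h1
    refine le_of_mul_le_mul_left ?_ hC0
    linarith
  have hne : ∀ k, y k ≠ y (k + 1) := by
    intro k h0
    have h1 := hdouble k
    rw [← h0] at h1
    have := hY1 k
    simp only [hy] at h1
    linarith
  refine ⟨C, y, hC0, fun k => h.pos _, hdouble, hg1, hg2, fun k => ?_, fun k => ?_,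
    fun k => h.prim _, fun k h0 => ?_⟩
  · refine (h.approx _).mono ?_
    have h0 : (0 : ℝ) < z (J (k + 1)) 0 := by linarith [hY1 k]
    have h1 := hYM k
    have h2 : 0 < (2 ^ J (k + 1) : ℝ) ^ l := Real.rpow_pos_of_pos (hM0 _) _
    simp only [hy]
    rw [Real.rpow_neg (hM0 _).le, ← div_eq_mul_inv, div_le_div_iff₀ h2 h0]
    calc c * (z (J (k + 1)) 0 : ℝ) ≤ c * (2 * C₂ * (2 ^ J (k + 1) : ℝ) ^ l) := by gcongr
      _ = c * (2 * C₂) * (2 ^ J (k + 1) : ℝ) ^ l := by ring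
      _ ≤ _ := by
        gcongr
        rw [hCdef]
        exact le_add_of_nonneg_left (by positivity)
  · exact (hn₁ _ ((le_max_left _ _).trans (hJmono _))).1
  -- If three consecutive points were coplanar, `y (k + 1)` and `y (k + 2)` would span both of two
  -- successive planes of the chain, although these differ.
  · have c1 : y k ⨯₃ y (k + 1) ≠ 0 := h.cross_ne_zero (hne k)
    have c2 : y (k + 1) ⨯₃ y (k + 2) ≠ 0 := h.cross_ne_zero (hne (k + 1))
    have d1 := (hIJ (k + 1)).2.2.2.2.1
    have d2 := (hIJ (k + 2)).2.2.2.2.1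
    have d3 : y (k + 2) ⬝ᵥ (z (J (k + 1)) ⨯₃ z (J (k + 1) + 1)) = 0 :=
      dot_eq_zero_of_dot_cross_eq_zero c1 (dot_self_cross _ _) d1 h0
    have d4 := dot_cross_eq_zero (hplane (k + 2)) (dot_self_cross (z (J (k + 2))) _) d2
      (dot_cross_self _ (z (J (k + 2) + 1)))
    exact (hIJ (k + 1)).2.2.2.2.2 (dot_eq_zero_of_dot_cross_eq_zero c2 d1 d3 d4)

end IsDyadicSequence

/-! ### Rational approximation to extremal numbers -/

lemma exists_le_lt_succ {f : ℕ → ℝ} (hf : ∀ B, ∃ n, B < f n) {x : ℝ} (hx : f 0 ≤ x) :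
    ∃ k, f k ≤ x ∧ x < f (k + 1) := by
  classical
  have hs := Nat.find_spec (hf x)
  have hmin := fun m => Nat.find_min (hf x) (m := m)
  rcases h0 : Nat.find (hf x) with _ | n
  · rw [h0] at hs; linarith
  · rw [h0] at hs
    exact ⟨n, not_lt.1 (hmin n (by omega)), hs⟩

/-- There are infinitely many rationals `p / q` with `|q * ξ - p| ≤ D * |q| ^ (-(1 + δ))`. -/
def HasRationalApproximations (ξ δ : ℝ) : Prop :=
  ∃ D : ℝ, 0 < D ∧ ∀ B : ℝ, ∃ q p : ℤ, q ≠ 0 ∧ B ≤ |(q : ℝ)| ∧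
    |(q : ℝ) * ξ - p| ≤ D * |(q : ℝ)| ^ (-(1 + δ))

namespace IsExtremalSequence

variable {ξ C : ℝ} {y : ℕ → Fin 3 → ℤ}

lemma one_le (h : IsExtremalSequence ξ C y) (k : ℕ) : (1 : ℝ) ≤ y k 0 := by
  exact_mod_cast h.pos k

lemma first_pos (h : IsExtremalSequence ξ C y) (k : ℕ) : (0 : ℝ) < y k 0 :=
  one_pos.trans_le (h.one_le k)

lemma le_succ (h : IsExtremalSequence ξ C y) (k : ℕ) : (y k 0 : ℝ) ≤ y (k + 1) 0 := by
  linarith [h.double k, h.one_le k]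

lemma exists_lt_first (h : IsExtremalSequence ξ C y) (B : ℝ) : ∃ n, ∀ k, n ≤ k → B < y k 0 := by
  have hpow : ∀ k, (2 : ℝ) ^ k ≤ y k 0 := by
    intro k
    induction k with
    | zero => simpa using h.one_le 0
    | succ k ih => rw [pow_succ]; linarith [h.double k]
  obtain ⟨n, hn⟩ := pow_unbounded_of_one_lt B (one_lt_two : (1 : ℝ) < 2)
  exact ⟨n, fun k hk => hn.trans_le ((pow_le_pow_right₀ (by norm_num) hk).trans (hpow k))⟩

lemma one_le_const (h : IsExtremalSequence ξ C y) (hC : 0 < C) : 1 ≤ C := by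
  have h1 := h.growth_le 0
  have h2 := h.le_growth 0
  have h3 : 0 < (y 0 0 : ℝ) ^ Real.goldenRatio := Real.rpow_pos_of_pos (h.first_pos 0) _
  have h4 : (y 0 0 : ℝ) ^ Real.goldenRatio ≤ C * (C * (y 0 0 : ℝ) ^ Real.goldenRatio) :=
    h2.trans (by gcongr)
  by_contra! hlt
  have h5 : C * (C * (y 0 0 : ℝ) ^ Real.goldenRatio) < 1 * (1 * (y 0 0 : ℝ) ^ Real.goldenRatio) := by
    gcongr
  linarith

lemma le_rpow_succ (h : IsExtremalSequence ξ C y) (hC : 0 < C) (k : ℕ) :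
    (y k 0 : ℝ) ≤ C ^ (1 / Real.goldenRatio) * (y (k + 1) 0 : ℝ) ^ (1 / Real.goldenRatio) := by
  have h0 := h.first_pos k
  have h1 := h.first_pos (k + 1)
  rw [← Real.mul_rpow hC.le h1.le]
  calc (y k 0 : ℝ) = ((y k 0 : ℝ) ^ Real.goldenRatio) ^ (1 / Real.goldenRatio) := by
        rw [← Real.rpow_mul h0.le, mul_one_div_cancel Real.goldenRatio_ne_zero, Real.rpow_one]
    _ ≤ _ := by
        have := Real.goldenRatio_pos
        gcongr
        exact h.le_growth k

lemma rpow_succ_le (h : IsExtremalSequence ξ C y) (hC : 0 < C) (k : ℕ) :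
    (y (k + 1) 0 : ℝ) ^ (1 / Real.goldenRatio) ≤ C ^ (1 / Real.goldenRatio) * y k 0 := by
  have h0 := h.first_pos k
  have h1 := h.first_pos (k + 1)
  calc (y (k + 1) 0 : ℝ) ^ (1 / Real.goldenRatio)
      ≤ (C * (y k 0 : ℝ) ^ Real.goldenRatio) ^ (1 / Real.goldenRatio) := by
        have := Real.goldenRatio_pos
        gcongr
        exact h.growth_le k
    _ = _ := by
        rw [Real.mul_rpow hC.le (by positivity), ← Real.rpow_mul h0.le,
          mul_one_div_cancel Real.goldenRatio_ne_zero, Real.rpow_one]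

/-- `Y (k + 2)` is comparable with the product `Y k * Y (k + 1)`. -/
lemma exists_mul_comparable (h : IsExtremalSequence ξ C y) (hC : 0 < C) :
    ∃ E : ℝ, 1 ≤ E ∧ ∀ k, (y k 0 : ℝ) * y (k + 1) 0 ≤ E * y (k + 2) 0 ∧
      (y (k + 2) 0 : ℝ) ≤ E * (y k 0 * y (k + 1) 0) := by
  have hC1 := h.one_le_const hC
  have hγ := Real.goldenRatio_pos
  refine ⟨C ^ (1 / Real.goldenRatio) * C, ?_, fun k => ?_⟩
  · have : 1 ≤ C ^ (1 / Real.goldenRatio) := Real.one_le_rpow hC1 (by positivity)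
    nlinarith
  have h1 := h.first_pos (k + 1)
  have e : (y (k + 1) 0 : ℝ) ^ Real.goldenRatio =
      y (k + 1) 0 * (y (k + 1) 0 : ℝ) ^ (1 / Real.goldenRatio) := by
    nth_rewrite 1 [goldenRatio_eq]
    rw [Real.rpow_add h1, Real.rpow_one]
  have a1 := h.le_rpow_succ hC k
  have a2 := h.rpow_succ_le hC k
  have a3 := h.growth_le (k + 1)
  have a4 := h.le_growth (k + 1)
  rw [e] at a3 a4
  set s := (y (k + 1) 0 : ℝ) ^ (1 / Real.goldenRatio)
  set t := C ^ (1 / Real.goldenRatio)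
  have ht : 0 < t := Real.rpow_pos_of_pos hC _
  constructor
  · calc (y k 0 : ℝ) * y (k + 1) 0 ≤ t * s * y (k + 1) 0 := by gcongr
      _ = t * (y (k + 1) 0 * s) := by ring
      _ ≤ t * (C * y (k + 2) 0) := by gcongr
      _ = _ := by ring
  · calc (y (k + 2) 0 : ℝ) ≤ C * (y (k + 1) 0 * s) := a3
      _ ≤ C * (y (k + 1) 0 * (t * y k 0)) := by gcongr
      _ = _ := by ring

lemma err_le (h : IsExtremalSequence ξ C y) (hC : 0 < C) (k : ℕ) : C / (y k 0 : ℝ) ≤ C :=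
  div_le_self hC.le (h.one_le k)

lemma abs_second_le (h : IsExtremalSequence ξ C y) (hC : 0 < C) (k : ℕ) :
    |(y k 1 : ℝ)| ≤ (|ξ| + C) * y k 0 := by
  have h0 := h.first_pos k
  have e : (y k 1 : ℝ) = y k 0 * ξ - (y k 0 * ξ - y k 1) := by ring
  rw [e]
  refine (abs_sub_le_of_abs_le le_rfl (h.approx k).1).trans ?_
  rw [abs_mul, abs_of_pos h0]
  have := h.err_le hC k
  nlinarith [h.one_le k]

lemma abs_third_le (h : IsExtremalSequence ξ C y) (hC : 0 < C) (k : ℕ) :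
    |(y k 2 : ℝ)| ≤ (ξ ^ 2 + C) * y k 0 := by
  have h0 := h.first_pos k
  have e : (y k 2 : ℝ) = y k 0 * ξ ^ 2 - (y k 0 * ξ ^ 2 - y k 2) := by ring
  rw [e]
  refine (abs_sub_le_of_abs_le le_rfl (h.approx k).2).trans ?_
  rw [abs_mul, abs_of_pos h0, abs_of_nonneg (sq_nonneg ξ)]
  have := h.err_le hC k
  nlinarith [h.one_le k]

/-- The vector `adj (y k) * (q, p)` does not vanish. -/
lemma minors_ne_zero (h : IsExtremalSequence ξ C y) (k : ℕ) {q p : ℤ} (hq : q ≠ 0) :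
    q * y k 2 - p * y k 1 ≠ 0 ∨ p * y k 0 - q * y k 1 ≠ 0 := by
  by_contra! h0
  obtain ⟨h1, h2⟩ := h0
  refine h.hankel k ((mul_eq_zero.1 ?_).resolve_left (mul_ne_zero hq hq))
  linear_combination q * y k 0 * h1 + q * y k 1 * h2

lemma abs_minors_le (h : IsExtremalSequence ξ C y) (hC : 0 < C) (k : ℕ) (q p : ℤ) :
    |((q * y k 2 - p * y k 1 : ℤ) : ℝ)| ≤ (C * (1 + |ξ|) + |ξ| + C + 1) *
        (|(q : ℝ)| / y k 0 + |(q : ℝ) * ξ - p| * y k 0) ∧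
      |((p * y k 0 - q * y k 1 : ℤ) : ℝ)| ≤ (C * (1 + |ξ|) + |ξ| + C + 1) *
        (|(q : ℝ)| / y k 0 + |(q : ℝ) * ξ - p| * y k 0) := by
  have h0 := h.first_pos k
  have ha := h.approx k
  set r := |(q : ℝ) * ξ - p| with hr
  have hr0 : 0 ≤ r := abs_nonneg _
  have hq0 : 0 ≤ |(q : ℝ)| / y k 0 := by positivity
  have hξ0 := abs_nonneg ξ
  have e0 : |(q : ℝ)| * (C / y k 0) = C * (|(q : ℝ)| / y k 0) := by ring
  have hrY : 0 ≤ r * y k 0 := by positivity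
  constructor
  · have e : ((q * y k 2 - p * y k 1 : ℤ) : ℝ) = q * (ξ * (y k 0 * ξ - y k 1)) -
        q * (y k 0 * ξ ^ 2 - y k 2) + (q * ξ - p) * y k 1 := by push_cast; ring
    rw [e]
    refine (abs_add_le_of_abs_le (abs_sub_le_of_abs_le (abs_mul_le_of_abs_le le_rfl
      (abs_mul_le_of_abs_le le_rfl ha.1)) (abs_mul_le_of_abs_le le_rfl ha.2))
      (abs_mul_le_of_abs_le hr.ge (h.abs_second_le hC k))).trans ?_
    have e1 : |(q : ℝ)| * (|ξ| * (C / y k 0)) + |(q : ℝ)| * (C / y k 0) +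
        r * ((|ξ| + C) * y k 0) =
        C * (1 + |ξ|) * (|(q : ℝ)| / y k 0) + (|ξ| + C) * (r * y k 0) := by ring
    rw [e1]
    have f1 : 0 ≤ (|ξ| + C + 1) * (|(q : ℝ)| / y k 0) := by positivity
    have f2 : 0 ≤ (C * (1 + |ξ|) + 1) * (r * y k 0) := by positivity
    linarith
  · have e : ((p * y k 0 - q * y k 1 : ℤ) : ℝ) = q * (y k 0 * ξ - y k 1) -
        (q * ξ - p) * y k 0 := by push_cast; ring
    rw [e]
    refine (abs_sub_le_of_abs_le (abs_mul_le_of_abs_le le_rfl ha.1)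
      (abs_mul_le_of_abs_le hr.ge (abs_of_pos h0).le)).trans ?_
    rw [e0]
    have f1 : 0 ≤ (C * |ξ| + |ξ| + C + 1) * (|(q : ℝ)| / y k 0) := by positivity
    have f2 : 0 ≤ (C * (1 + |ξ|) + |ξ| + C) * (r * y k 0) := by positivity
    linarith

lemma exists_one_le (h : IsExtremalSequence ξ C y) (hC : 0 < C) : ∃ R : ℝ, 1 ≤ R ∧
    ∀ (k : ℕ) (q p : ℤ), q ≠ 0 →
      1 ≤ R * (|(q : ℝ)| / y k 0 + |(q : ℝ) * ξ - p| * y k 0) := by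
  refine ⟨C * (1 + |ξ|) + |ξ| + C + 1, ?_, fun k q p hq => ?_⟩
  · have : 0 ≤ C * (1 + |ξ|) + |ξ| + C := by positivity
    linarith
  · obtain ⟨h1, h2⟩ := h.abs_minors_le hC k q p
    rcases h.minors_ne_zero k (p := p) hq with h0 | h0
    · exact le_trans (by exact_mod_cast Int.one_le_abs h0) h1
    · exact le_trans (by exact_mod_cast Int.one_le_abs h0) h2

/-- The map `y k * adj (y (k + 2))` sends a good approximation `p / q` of `ξ` to another one with a
smaller denominator. -/
lemma exists_descent (h : IsExtremalSequence ξ C y) (hC : 0 < C) : ∃ G : ℝ, 0 < G ∧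
    ∀ (k : ℕ) (q p : ℤ), q ≠ 0 → |(q : ℝ) * ξ - p| ≤ |(q : ℝ)| → ∃ v w : ℤ, (v ≠ 0 ∨ w ≠ 0) ∧
      |(v : ℝ)| ≤ G * (|(q : ℝ)| / y (k + 1) 0 + |(q : ℝ) * ξ - p| * y (k + 1) 0) ∧
      |(v : ℝ) * ξ - w| ≤ G * (|(q : ℝ)| / (y (k + 2) 0 * y k 0) +
        |(q : ℝ) * ξ - p| * y (k + 1) 0) := by
  obtain ⟨E, hE1, hE⟩ := h.exists_mul_comparable hC
  set R := C * (1 + |ξ|) + |ξ| + C + 1 with hR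
  have hR0 : 0 < R := by positivity
  set A := 2 + 2 * |ξ| with hA
  have hA1 : 1 ≤ A := by have := abs_nonneg ξ; rw [hA]; linarith
  have hE0 : 0 < E := by linarith
  refine ⟨C * A * E + C * A * R * (1 + E), by positivity, fun k q p hq hqp => ?_⟩
  obtain ⟨b0, b1⟩ := h.abs_minors_le hC (k + 2) q p
  have hu := h.minors_ne_zero (k + 2) (p := p) hq
  obtain ⟨E1, E2⟩ := hE k
  have hx := h.approx k
  have hz := h.approx (k + 2)
  have hX := h.first_pos k
  have hX1 := h.one_le k
  have hM := h.first_pos (k + 1)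
  have hT := h.first_pos (k + 2)
  have hMT := h.le_succ (k + 1)
  have hxh := h.hankel k
  set x := y k
  set z := y (k + 2)
  set u₀ := q * z 2 - p * z 1 with hu₀
  set u₁ := p * z 0 - q * z 1 with hu₁
  set r := |(q : ℝ) * ξ - p| with hr
  set X : ℝ := ((x 0 : ℤ) : ℝ) with hXd
  set M : ℝ := ((y (k + 1) 0 : ℤ) : ℝ)
  set T : ℝ := ((z 0 : ℤ) : ℝ)
  have hr0 : 0 ≤ r := abs_nonneg _
  have hξ0 := abs_nonneg ξ
  set Q := |(q : ℝ)| with hQ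
  have hQ0 : 0 ≤ Q := abs_nonneg _
  set S := Q / T + r * T with hS
  have hS0 : 0 ≤ S := by positivity
  have hp : |(p : ℝ)| ≤ Q * |ξ| + Q := by
    have e : (p : ℝ) = q * ξ - (q * ξ - p) := by ring
    rw [e]
    exact abs_sub_le_of_abs_le (abs_mul_le_of_abs_le le_rfl le_rfl) hqp
  -- The symmetric matrix of `z` is nearly `T` times the rank one matrix of `(1, ξ)`, whose adjugate
  -- is annihilated by `(1, ξ)`. Only the errors of `z` survive in this combination.
  have hcomb : |(u₀ : ℝ) + ξ * u₁| ≤ A * C * (Q / T) := by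
    have e : (u₀ : ℝ) + ξ * u₁ = q * (ξ * (z 0 * ξ - z 1)) - q * (z 0 * ξ ^ 2 - z 2) +
        p * (z 0 * ξ - z 1) := by rw [hu₀, hu₁]; push_cast; ring
    rw [e]
    refine (abs_add_le_of_abs_le (abs_sub_le_of_abs_le (abs_mul_le_of_abs_le le_rfl
      (abs_mul_le_of_abs_le le_rfl hz.1)) (abs_mul_le_of_abs_le le_rfl hz.2))
      (abs_mul_le_of_abs_le hp hz.1)).trans (le_of_eq ?_)
    rw [hA]; ring
  have hSX : S / X ≤ Q / (T * X) + E * (r * M) := by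
    have e : S / X = Q / (T * X) + r * (T / X) := by rw [hS, add_div, div_div, mul_div_assoc]
    have : T / X ≤ E * M := by
      rw [div_le_iff₀ hX]
      linarith
    rw [e]
    have := mul_le_mul_of_nonneg_left this hr0
    linarith
  have hTX : Q / (T * X) ≤ Q / M := by
    gcongr
    calc M ≤ T * 1 := by linarith
      _ ≤ T * X := by gcongr
  have hXT : X * (Q / T) ≤ E * (Q / M) := by
    rw [← mul_div_assoc, ← mul_div_assoc, div_le_div_iff₀ hT hM]
    nlinarith
  refine ⟨x 0 * u₀ + x 1 * u₁, x 1 * u₀ + x 2 * u₁, ?_, ?_, ?_⟩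
  · by_contra! h0
    obtain ⟨h1, h2⟩ := h0
    have e0 : (x 0 * x 2 - x 1 ^ 2) * u₀ = 0 := by linear_combination x 2 * h1 - x 1 * h2
    have e1 : (x 0 * x 2 - x 1 ^ 2) * u₁ = 0 := by linear_combination x 0 * h2 - x 1 * h1
    have f0 := (mul_eq_zero.1 e0).resolve_left hxh
    have f1 := (mul_eq_zero.1 e1).resolve_left hxh
    tauto
  · have e : ((x 0 * u₀ + x 1 * u₁ : ℤ) : ℝ) = X * (u₀ + ξ * u₁) - (x 0 * ξ - x 1) * u₁ := by
      push_cast; ring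
    rw [e]
    refine (abs_sub_le_of_abs_le (abs_mul_le_of_abs_le (abs_of_pos hX).le hcomb)
      (abs_mul_le_of_abs_le hx.1 b1)).trans ?_
    have e2 : X * (A * C * (Q / T)) + C / X * (R * S) = A * C * (X * (Q / T)) + C * R * (S / X) := by
      ring
    rw [e2]
    calc _ ≤ A * C * (E * (Q / M)) + C * R * (Q / M + E * (r * M)) := by
          gcongr
          exact hSX.trans (by linarith)
      _ ≤ A * C * (E * (Q / M)) + C * R * (Q / M + E * (r * M)) +
          ((A - 1) * (C * R * (Q / M + E * (r * M))) + C * A * R * E * (Q / M) +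
            C * A * R * (r * M) + C * A * E * (r * M)) := by
          apply le_add_of_nonneg_right
          have : 0 ≤ A - 1 := by linarith
          positivity
      _ = _ := by ring
  · have e : ((x 0 * u₀ + x 1 * u₁ : ℤ) : ℝ) * ξ - ((x 1 * u₀ + x 2 * u₁ : ℤ) : ℝ) =
        (x 0 * ξ - x 1) * u₀ + ((x 0 * ξ ^ 2 - x 2) - ξ * (x 0 * ξ - x 1)) * u₁ := by
      push_cast; ring
    rw [e]
    refine (abs_add_le_of_abs_le (abs_mul_le_of_abs_le hx.1 b0) (abs_mul_le_of_abs_le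
      (abs_sub_le_of_abs_le hx.2 (abs_mul_le_of_abs_le le_rfl hx.1)) b1)).trans ?_
    have e2 : C / X * (R * S) + (C / X + |ξ| * (C / X)) * (R * S) =
      C * (2 + |ξ|) * R * (S / X) := by ring
    rw [e2]
    calc _ ≤ C * A * R * (Q / (T * X) + E * (r * M)) := by
          gcongr
          rw [hA]; linarith
      _ ≤ C * A * R * (Q / (T * X) + E * (r * M)) +
          (C * A * R * E * (Q / (T * X)) + C * A * R * (r * M) +
            C * A * E * (Q / (T * X) + r * M)) := by
          apply le_add_of_nonneg_right
          positivity
      _ = _ := by ring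

/-- For `Q = |q|` choose `k` with `κ Y_k ≤ Q < κ Y_{k+1}`. A nonzero minor forces `|q ξ - p| *
Y_{k+1} ≫ 1`, but this product is `≪ Q ^ (γ - 2)`, which tends to 0. -/
lemma not_hasRationalApproximations_of_lt (h : IsExtremalSequence ξ C y) (hC : 0 < C) {δ : ℝ}
    (hδ : 1 ≤ δ) : ¬ HasRationalApproximations ξ δ := by
  rintro ⟨D, hD, hq⟩
  obtain ⟨R, hR1, hR⟩ := h.exists_one_le hC
  set κ := 1 / (2 * R) with hκ
  have hκ0 : 0 < κ := by positivity
  set γ := Real.goldenRatio with hγ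
  have hγ0 := Real.goldenRatio_pos
  have hγ2 := Real.goldenRatio_lt_two
  obtain ⟨B, hB1, hB⟩ := exists_mul_rpow_neg_lt (2 * R * D * C * κ ^ (-γ)) (s := 2 - γ)
    (by linarith) one_pos
  obtain ⟨q, p, hq0, hqB, hqp⟩ := hq (max B (κ * y 0 0))
  obtain ⟨k, hk1, hk2⟩ := exists_le_lt_succ (f := fun k => κ * y k 0) (fun B => by
    obtain ⟨n, hn⟩ := h.exists_lt_first (B / κ)
    exact ⟨n, by have := hn n le_rfl; rwa [div_lt_iff₀ hκ0, mul_comm] at this⟩)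
    ((le_max_right _ _).trans hqB)
  have h1 := hR (k + 1) q p hq0
  have hb := hB _ ((le_max_left _ _).trans hqB)
  have hY := h.first_pos k
  have hY1 := h.first_pos (k + 1)
  have hg := h.growth_le k
  have hQ1 : 1 ≤ |(q : ℝ)| := hB1.trans ((le_max_left _ _).trans hqB)
  have hQ0 : 0 < |(q : ℝ)| := by linarith
  set Q := |(q : ℝ)|
  have h2 : R * (Q / y (k + 1) 0) ≤ 1 / 2 := by
    have : Q / y (k + 1) 0 ≤ κ := by
      rw [div_le_iff₀ hY1]; exact hk2.le
    calc R * (Q / y (k + 1) 0) ≤ R * κ := by gcongr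
      _ = 1 / 2 := by rw [hκ]; field_simp
  have h3 : |(q : ℝ) * ξ - p| * y (k + 1) 0 ≤ D * C * κ ^ (-γ) * Q ^ (-(2 - γ)) := by
    have e1 : (y k 0 : ℝ) ^ γ ≤ κ ^ (-γ) * Q ^ γ := by
      rw [Real.rpow_neg hκ0.le, inv_mul_eq_div, le_div_iff₀ (by positivity),
        ← Real.mul_rpow hY.le hκ0.le, mul_comm]
      gcongr
    have e2 : Q ^ (-(1 + δ)) ≤ Q ^ (-2 : ℝ) :=
      Real.rpow_le_rpow_of_exponent_le hQ1 (by linarith)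
    have e3 : Q ^ (-(2 - γ)) = Q ^ (-2 : ℝ) * Q ^ γ := by
      rw [← Real.rpow_add hQ0]; congr 1; ring
    rw [e3]
    calc _ ≤ (D * Q ^ (-2 : ℝ)) * (C * (κ ^ (-γ) * Q ^ γ)) := by
          gcongr
          · exact hqp.trans (by gcongr)
          · exact hg.trans (by gcongr)
      _ = _ := by ring
  have h4 := mul_le_mul_of_nonneg_left h3 (by linarith : 0 ≤ R)
  linarith

set_option maxHeartbeats 1000000 in
/-- Doubling the exponent of approximation. -/
lemma hasRationalApproximations_two_mul (h : IsExtremalSequence ξ C y) (hC : 0 < C)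
    (hξ : Irrational ξ) {δ : ℝ} (hδ : 0 < δ) (hA : HasRationalApproximations ξ δ) :
    HasRationalApproximations ξ (2 * δ) := by
  obtain ⟨D, hD, hq⟩ := hA
  obtain ⟨R, hR1, hR⟩ := h.exists_one_le hC
  obtain ⟨G, hG, hdesc⟩ := h.exists_descent hC
  obtain ⟨E, hE1, hE⟩ := h.exists_mul_comparable hC
  obtain ⟨hl35, hl23⟩ := inv_goldenRatio_bounds
  set l := 1 / Real.goldenRatio with hl
  set κ := 1 / (2 * R) with hκ
  have hκ0 : 0 < κ := by positivity
  have hκ1 : κ ≤ 1 := by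
    rw [hκ, div_le_one (by positivity)]; linarith
  obtain ⟨G₁, hG₁⟩ : ∃ x, x = G * (1 + D / κ ^ 2) := ⟨_, rfl⟩
  have hG₁0 : 0 < G₁ := by rw [hG₁]; positivity
  obtain ⟨G₂, hG₂⟩ : ∃ x, x = G₁ * C ^ l := ⟨_, rfl⟩
  have hG₂0 : 0 < G₂ := by rw [hG₂]; positivity
  obtain ⟨G₃, hG₃⟩ : ∃ x, x = G * (2 * R * D + D / κ) := ⟨_, rfl⟩
  have hG₃0 : 0 < G₃ := by rw [hG₃]; positivity
  obtain ⟨G₄, hG₄⟩ : ∃ x, x = G * (1 + D / κ ^ 2) * G * (E * (2 * R * D) + D) := ⟨_, rfl⟩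
  have hG₄0 : 0 < G₄ := by rw [hG₄]; positivity
  refine ⟨G₄ * G₂ ^ (2 * δ), by positivity, fun B => ?_⟩
  obtain ⟨m, hm, hmin⟩ := hξ.exists_pos_le_abs_mul_sub B
  obtain ⟨B₁, hB₁1, hB₁⟩ := exists_mul_rpow_neg_lt G₃ hδ (lt_min hm one_pos)
  obtain ⟨B₂, hB₂1, hB₂⟩ := exists_mul_rpow_neg_lt D (s := 1 + δ) (by linarith) one_pos
  obtain ⟨q, p, hq0, hqB, hqp⟩ := hq (max (max B₁ B₂) (κ * y 1 0))
  obtain ⟨k, hk1, hk2⟩ := exists_le_lt_succ (f := fun k => κ * y (k + 1) 0) (fun B => by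
    obtain ⟨n, hn⟩ := h.exists_lt_first (B / κ)
    exact ⟨n, by have := hn (n + 1) (by omega); rwa [div_lt_iff₀ hκ0, mul_comm] at this⟩)
    ((le_max_right _ _).trans hqB)
  have hqB₁ : B₁ ≤ |(q : ℝ)| := ((le_max_left _ _).trans (le_max_left _ _)).trans hqB
  have hqB₂ : B₂ ≤ |(q : ℝ)| := ((le_max_right _ _).trans (le_max_left _ _)).trans hqB
  have hQ1 : 1 ≤ |(q : ℝ)| := hB₁1.trans hqB₁
  have hr1 : |(q : ℝ) * ξ - p| ≤ |(q : ℝ)| := (hqp.trans (hB₂ _ hqB₂).le).trans hQ1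
  obtain ⟨v, w, hvw, hv, hw⟩ := hdesc k q p hq0 hr1
  have h1 := hR (k + 2) q p hq0
  have hX1 := h.one_le k
  have hM := h.first_pos (k + 1)
  have hT := h.first_pos (k + 2)
  have hroot := h.rpow_succ_le hC (k + 1)
  obtain ⟨-, hE2⟩ := hE k
  have hsmall := hB₁ _ hqB₁
  have hQ0 : 0 < |(q : ℝ)| := by linarith
  set Q := |(q : ℝ)| with hQ
  set r := |(q : ℝ) * ξ - p| with hr
  have hr0 : 0 ≤ r := abs_nonneg _
  set X : ℝ := ((y k 0 : ℤ) : ℝ)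
  set M : ℝ := ((y (k + 1) 0 : ℤ) : ℝ)
  set T : ℝ := ((y (k + 2) 0 : ℤ) : ℝ)
  have hX : 0 < X := by linarith
  have hk1 : κ * M ≤ Q := hk1
  have hk2 : Q < κ * T := hk2
  set s := Q ^ (-δ) with hs
  have hs0 : 0 < s := Real.rpow_pos_of_pos hQ0 _
  have hs1 : s ≤ 1 := Real.rpow_le_one_of_one_le_of_nonpos hQ1 (by linarith)
  have hrQ : r * Q ≤ D * s := by
    calc r * Q ≤ D * Q ^ (-(1 + δ)) * Q := by gcongr
      _ = D * (Q ^ (-(1 + δ)) * Q ^ (1 : ℝ)) := by rw [Real.rpow_one]; ring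
      _ = D * s := by rw [← Real.rpow_add hQ0, hs]; congr 2; ring
  -- As `Q < κ T`, the nonzero minor gives `r T ≫ 1`, hence `Q / T ≪ r Q ≪ s`.
  have hQT : Q / T ≤ 2 * R * D * s := by
    have h2 : R * (Q / T) ≤ 1 / 2 := by
      have : Q / T ≤ κ := by
        rw [div_le_iff₀ hT]; exact hk2.le
      calc R * (Q / T) ≤ R * κ := by gcongr
        _ = 1 / 2 := by rw [hκ]; field_simp
    have h3 : 1 ≤ 2 * R * (r * T) := by linarith
    calc Q / T = Q / T * 1 := (mul_one _).symm
      _ ≤ Q / T * (2 * R * (r * T)) := by gcongr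
      _ = 2 * R * (r * Q) := by field_simp
      _ ≤ 2 * R * (D * s) := by gcongr
      _ = _ := by ring
  have hQT1 : Q / T ≤ 1 := by
    rw [div_le_one hT]
    nlinarith
  have hrM : r * M ≤ D / κ * s := by
    have : M ≤ Q / κ := by rw [le_div_iff₀ hκ0]; linarith
    calc r * M ≤ r * (Q / κ) := by gcongr
      _ = r * Q / κ := by ring
      _ ≤ D * s / κ := by gcongr
      _ = _ := by ring
  have hQM : κ ≤ Q / M := by rwa [le_div_iff₀ hM]
  have hv1 : |(v : ℝ)| ≤ G₁ * (Q / M) := by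
    refine hv.trans ?_
    have : r * M ≤ D / κ ^ 2 * (Q / M) := by
      calc r * M ≤ D / κ * 1 := hrM.trans (by gcongr)
        _ = D / κ ^ 2 * κ := by field_simp
        _ ≤ _ := by gcongr
    calc G * (Q / M + r * M) ≤ G * (Q / M + D / κ ^ 2 * (Q / M)) := by gcongr
      _ = _ := by rw [hG₁]; ring
  -- This is the source of the doubling: `|v| ≪ Q / M ≪ Q ^ (1 - l)` with `l > 1 / 2`, so the factor
  -- `Q ^ (-δ)` is `≪ |v| ^ (-2 δ)`.
  have hv2 : |(v : ℝ)| ≤ G₂ * Q ^ (1 / 2 : ℝ) := by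
    have h2 : Q ^ l ≤ C ^ l * M := by
      refine le_trans ?_ hroot
      gcongr
      nlinarith
    have h3 : Q / M ≤ C ^ l * Q ^ (1 / 2 : ℝ) := by
      rw [div_le_iff₀ hM]
      calc Q = Q ^ (1 - l) * Q ^ l := by
            rw [← Real.rpow_add hQ0, sub_add_cancel, Real.rpow_one]
        _ ≤ Q ^ (1 / 2 : ℝ) * (C ^ l * M) := by
            gcongr
            linarith
        _ = _ := by ring
    calc |(v : ℝ)| ≤ G₁ * (Q / M) := hv1
      _ ≤ G₁ * (C ^ l * Q ^ (1 / 2 : ℝ)) := by gcongr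
      _ = _ := by rw [hG₂]; ring
  have hTX : Q / (T * X) ≤ Q / T := by
    rw [← div_div]
    exact div_le_self (by positivity) hX1
  have herr : |(v : ℝ) * ξ - w| ≤ G₃ * s := by
    refine hw.trans ?_
    calc G * (Q / (T * X) + r * M) ≤ G * (2 * R * D * s + D / κ * s) := by
          gcongr
          exact hTX.trans hQT
      _ = _ := by rw [hG₃]; ring
  have herr1 : |(v : ℝ) * ξ - w| < 1 := (herr.trans_lt hsmall).trans_le (min_le_right _ _)
  have herrm : |(v : ℝ) * ξ - w| < m := (herr.trans_lt hsmall).trans_le (min_le_left _ _)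
  have hv0 : v ≠ 0 := by
    rintro rfl
    rw [Int.cast_zero, zero_mul, zero_sub, abs_neg] at herr1
    have hw0 : w = 0 := Int.abs_lt_one_iff.1 (by exact_mod_cast herr1)
    tauto
  have hvpos : 0 < |(v : ℝ)| := abs_pos.2 (by exact_mod_cast hv0)
  refine ⟨v, w, hv0, ?_, ?_⟩
  -- The new denominators are unbounded, because the error of `w / v` falls below the minimum `m`
  -- for denominators up to `B`.
  · by_contra! hlt
    linarith [hmin v w hv0 hlt.le]
  · have hprod : |(v : ℝ) * ξ - w| * |(v : ℝ)| ≤ G₄ * s := by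
      have e1 : Q / (T * X) * (Q / M) ≤ E * (2 * R * D * s) := by
        have e : 1 / (X * M) ≤ E / T := by
          rw [div_le_div_iff₀ (by positivity) hT]
          linarith
        calc Q / (T * X) * (Q / M) = Q ^ 2 / T * (1 / (X * M)) := by field_simp
          _ ≤ Q ^ 2 / T * (E / T) := by gcongr
          _ = E * (Q / T * (Q / T)) := by ring
          _ ≤ E * (2 * R * D * s * 1) := by gcongr
          _ = _ := by ring
      have e2 : r * M * (Q / M) ≤ D * s := by
        calc r * M * (Q / M) = r * Q := by field_simp
          _ ≤ _ := hrQ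
      calc |(v : ℝ) * ξ - w| * |(v : ℝ)| ≤ G * (Q / (T * X) + r * M) * (G₁ * (Q / M)) := by gcongr
        _ = G * G₁ * (Q / (T * X) * (Q / M) + r * M * (Q / M)) := by ring
        _ ≤ G * G₁ * (E * (2 * R * D * s) + D * s) := by gcongr
        _ = _ := by rw [hG₄, hG₁]; ring
    have hsv : s ≤ G₂ ^ (2 * δ) * |(v : ℝ)| ^ (-(2 * δ)) := by
      have h2 : (G₂ * Q ^ (1 / 2 : ℝ)) ^ (-(2 * δ)) ≤ |(v : ℝ)| ^ (-(2 * δ)) :=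
        Real.rpow_le_rpow_of_nonpos hvpos hv2 (by linarith)
      rw [Real.mul_rpow hG₂0.le (by positivity), ← Real.rpow_mul hQ0.le,
        Real.rpow_neg hG₂0.le, inv_mul_le_iff₀ (by positivity)] at h2
      have e : 1 / 2 * -(2 * δ) = -δ := by ring
      rwa [e] at h2
    have e : |(v : ℝ)| ^ (-(1 + 2 * δ)) * |(v : ℝ)| = |(v : ℝ)| ^ (-(2 * δ)) := by
      nth_rewrite 2 [← Real.rpow_one |(v : ℝ)|]
      rw [← Real.rpow_add hvpos]
      congr 1; ring
    refine le_of_mul_le_mul_right ?_ hvpos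
    calc _ ≤ G₄ * s := hprod
      _ ≤ G₄ * (G₂ ^ (2 * δ) * |(v : ℝ)| ^ (-(2 * δ))) := by gcongr
      _ = _ := by rw [← e]; ring

/-- Repeated doubling would bring the excess above 1. -/
lemma not_hasRationalApproximations (h : IsExtremalSequence ξ C y) (hC : 0 < C)
    (hξ : Irrational ξ) {δ : ℝ} (hδ : 0 < δ) : ¬ HasRationalApproximations ξ δ := by
  intro hA
  have hpow : ∀ n : ℕ, HasRationalApproximations ξ (2 ^ n * δ) := by
    intro n
    induction n with
    | zero => simpa using hA
    | succ n ih =>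
      have := h.hasRationalApproximations_two_mul hC hξ (by positivity) ih
      rwa [← mul_assoc, ← pow_succ'] at this
  obtain ⟨n, hn⟩ := pow_unbounded_of_one_lt (1 / δ) (one_lt_two : (1 : ℝ) < 2)
  rw [div_lt_iff₀ hδ] at hn
  exact h.not_hasRationalApproximations_of_lt hC hn.le (hpow n)

/-- Rational approximations to `ξ` are not better than those to a generic number. -/
lemma exists_pos_mul_rpow_le (h : IsExtremalSequence ξ C y) (hC : 0 < C) (hξ : Irrational ξ)
    {δ : ℝ} (hδ : 0 < δ) : ∃ c : ℝ, 0 < c ∧ ∀ q p : ℤ, q ≠ 0 →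
      c * |(q : ℝ)| ^ (-(1 + δ)) ≤ |(q : ℝ) * ξ - p| := by
  have hA := h.not_hasRationalApproximations hC hξ hδ
  simp only [HasRationalApproximations] at hA
  push Not at hA
  obtain ⟨B, hB⟩ := hA 1 one_pos
  obtain ⟨m, hm, hmin⟩ := hξ.exists_pos_le_abs_mul_sub B
  refine ⟨min m 1, lt_min hm one_pos, fun q p hq => ?_⟩
  have hq1 : 1 ≤ |(q : ℝ)| := by exact_mod_cast Int.one_le_abs hq
  have hs : |(q : ℝ)| ^ (-(1 + δ)) ≤ 1 :=
    Real.rpow_le_one_of_one_le_of_nonpos hq1 (by linarith)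
  have hs0 : 0 ≤ |(q : ℝ)| ^ (-(1 + δ)) := by positivity
  rcases le_or_gt B |(q : ℝ)| with h1 | h1
  · refine le_trans ?_ (hB q p hq h1).le
    gcongr
    exact min_le_right _ _
  · refine le_trans ?_ (hmin q p hq h1.le)
    calc min m 1 * |(q : ℝ)| ^ (-(1 + δ)) ≤ m * 1 := by
          gcongr
          exact min_le_left _ _
      _ = m := mul_one m

end IsExtremalSequence

/-! ### The upper bound for `λ_3` of an extremal number -/

namespace IsExtremalSequence

open scoped Matrix

variable {ξ C : ℝ} {y : ℕ → Fin 3 → ℤ}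

lemma abs_dot_cross_le (h : IsExtremalSequence ξ C y) {F X L : ℝ} (hC : 0 < C) (hF : 0 < F)
    (hX : 0 ≤ X) (k : ℕ) {w : Fin 3 → ℤ} (hw0 : |(w 0 : ℝ)| ≤ F * X)
    (hw : ApproxWithin ξ w (F * L)) :
    |((w ⬝ᵥ (y k ⨯₃ y (k + 1)) : ℤ) : ℝ)| ≤
      (2 * F * C ^ 2 + 4 * F * C) *
        (X / (y k 0 * y (k + 1) 0) + L * (y (k + 1) 0 / y k 0)) := by
  have h1 := hw.abs_det_le (h.approx k) (h.approx (k + 1))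
  have hY := h.first_pos k
  have hZ := h.first_pos (k + 1)
  have hYZ := h.le_succ k
  have hL : 0 ≤ L := nonneg_of_mul_nonneg_right hw.nonneg hF
  rw [abs_of_pos hY, abs_of_pos hZ] at h1
  set Y : ℝ := ((y k 0 : ℤ) : ℝ)
  set Z : ℝ := ((y (k + 1) 0 : ℤ) : ℝ)
  have h2 : Y / Z ≤ Z / Y := by gcongr
  have h3 : 0 ≤ X / (Y * Z) := by positivity
  have h4 : 0 ≤ L * (Z / Y) := by positivity
  refine h1.trans ?_
  calc _ ≤ F * X * (2 * (C / Y) * (C / Z)) + 2 * (F * L) * (C * (Y / Z) + C * (Z / Y)) := by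
        have e : Y * (C / Z) + Z * (C / Y) = C * (Y / Z) + C * (Z / Y) := by ring
        rw [e]
        gcongr
    _ ≤ F * X * (2 * (C / Y) * (C / Z)) + 2 * (F * L) * (C * (Z / Y) + C * (Z / Y)) := by gcongr
    _ = 2 * F * C ^ 2 * (X / (Y * Z)) + 4 * F * C * (L * (Z / Y)) := by
        field_simp; ring
    _ ≤ 2 * F * C ^ 2 * (X / (Y * Z)) + 4 * F * C * (L * (Z / Y)) +
        (4 * F * C * (X / (Y * Z)) + 2 * F * C ^ 2 * (L * (Z / Y))) :=
        le_add_of_nonneg_right (by positivity)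
    _ = _ := by ring

lemma cross_ne_zero (h : IsExtremalSequence ξ C y) (k : ℕ) : y k ⨯₃ y (k + 1) ≠ 0 := fun h0 =>
  h.det k (by rw [h0, dotProduct_zero])

/-- Consecutive planes meet in a line. -/
lemma cross_eq_zero_of_dot_eq_zero (h : IsExtremalSequence ξ C y) (k : ℕ) {w : Fin 3 → ℤ}
    (h1 : w ⬝ᵥ (y k ⨯₃ y (k + 1)) = 0) (h2 : w ⬝ᵥ (y (k + 1) ⨯₃ y (k + 2)) = 0) :
    w ⨯₃ y (k + 1) = 0 := by
  by_contra hne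
  have h3 := dot_cross_eq_zero (h.cross_ne_zero (k + 1)) h2 (dot_self_cross (y (k + 1)) _)
    (dot_cross_self _ (y (k + 2)))
  exact h.det k (dot_eq_zero_of_dot_cross_eq_zero hne h1 (dot_cross_self _ _) h3)

/-- The two halves of a point of `ℤ ^ 4` are not both proportional to a point of the sequence. -/
lemma not_both_parallel (h : IsExtremalSequence ξ C y) (k : ℕ) {x : Fin 4 → ℤ} (hx : x 0 ≠ 0)
    (h1 : ![x 0, x 1, x 2] ⨯₃ y k = 0) (h2 : ![x 1, x 2, x 3] ⨯₃ y k = 0) : False := by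
  obtain ⟨n, hn⟩ := h.prim k _ h1
  obtain ⟨m, hm⟩ := h.prim k _ h2
  have n0 : x 0 = n * y k 0 := by simpa using congrFun hn 0
  have n1 : x 1 = n * y k 1 := by simpa using congrFun hn 1
  have n2 : x 2 = n * y k 2 := by simpa using congrFun hn 2
  have m0 : x 1 = m * y k 0 := by simpa using congrFun hm 0
  have m1 : x 2 = m * y k 1 := by simpa using congrFun hm 1
  have hn0 : n ≠ 0 := by
    rintro rfl
    exact hx (by rw [n0, zero_mul])
  refine h.hankel k ((mul_eq_zero.1 ?_).resolve_left (mul_ne_zero hn0 hn0))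
  linear_combination n * y k 0 * (m1 - n2) - n * y k 1 * (m0 - n1)

/-- An approximation point to `(ξ, ξ ^ 2, ξ ^ 3)` in the plane of `y k` and `y (k + 1)` yields a
rational approximation to `ξ`. -/
lemma exists_of_approx_cube (h : IsExtremalSequence ξ C y) (hC : 0 < C) : ∃ Γ : ℝ, 1 ≤ Γ ∧
    ∀ (k : ℕ) (X L : ℝ) (x : Fin 4 → ℤ), x 0 ≠ 0 → |(x 0 : ℝ)| ≤ X → L ≤ X →
      (∀ j : Fin 4, |x 0 * ξ ^ (j : ℕ) - x j| ≤ L) →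
      Γ * (X / (y k 0 * y (k + 1) 0) + L * (y (k + 1) 0 / y k 0)) < 1 →
      1 ≤ Γ * (X / (y (k + 1) 0 * y (k + 2) 0) + L * (y (k + 2) 0 / y (k + 1) 0)) ∧
      ∃ t s : ℤ, (t ≠ 0 ∨ s ≠ 0) ∧
        |(t : ℝ)| ≤ Γ * ((X / y k 0 + y k 0 * L) * (y k 0 / y (k + 1) 0)) ∧
        |(t : ℝ) * ξ - s| ≤ Γ * (L * y k 0 * (y k 0 / y (k + 1) 0)) := by
  obtain ⟨E, hE1, hE⟩ := h.exists_mul_comparable hC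
  have hE0 : 0 < E := by linarith
  obtain ⟨F, hFd⟩ : ∃ F, F = 1 + |ξ| + ξ ^ 2 := ⟨_, rfl⟩
  have hξ0 := abs_nonneg ξ
  have hF1 : 1 ≤ F := by rw [hFd]; nlinarith [sq_nonneg ξ]
  have hF0 : 0 < F := by linarith
  obtain ⟨Γ₁, hΓ₁⟩ : ∃ g, g = 2 * F * C ^ 2 + 4 * F * C := ⟨_, rfl⟩
  obtain ⟨Γ₂, hΓ₂⟩ : ∃ g, g = 4 * C * E * (F * (C + 1)) := ⟨_, rfl⟩
  obtain ⟨Γ₃, hΓ₃⟩ : ∃ g, g = 4 * C * E * (2 * F + C) := ⟨_, rfl⟩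
  have hΓ₁0 : 0 < Γ₁ := by rw [hΓ₁]; positivity
  have hΓ₂0 : 0 < Γ₂ := by rw [hΓ₂]; positivity
  have hΓ₃0 : 0 < Γ₃ := by rw [hΓ₃]; positivity
  refine ⟨1 + Γ₁ + Γ₂ + Γ₃, by linarith, fun k X L x hx0 hxX hLX hx hsmall => ?_⟩
  have hX : 0 ≤ X := (abs_nonneg _).trans hxX
  have hL : 0 ≤ L := (abs_nonneg _).trans (hx 0)
  have hx1 : |x 0 * ξ - x 1| ≤ L := by simpa using hx 1
  have hx2 : |x 0 * ξ ^ 2 - x 2| ≤ L := by simpa using hx 2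
  have hx3 : |x 0 * ξ ^ 3 - x 3| ≤ L := by simpa using hx 3
  have d1 : |(x 1 : ℝ) * ξ - x 2| ≤ (1 + |ξ|) * L := by
    have e : (x 1 : ℝ) * ξ - x 2 = (x 0 * ξ ^ 2 - x 2) - ξ * (x 0 * ξ - x 1) := by ring
    rw [e]
    refine (abs_sub_le_of_abs_le hx2 (abs_mul_le_of_abs_le le_rfl hx1)).trans (le_of_eq (by ring))
  have d2 : |(x 2 : ℝ) * ξ - x 3| ≤ (1 + |ξ|) * L := by
    have e : (x 2 : ℝ) * ξ - x 3 = (x 0 * ξ ^ 3 - x 3) - ξ * (x 0 * ξ ^ 2 - x 2) := by ring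
    rw [e]
    refine (abs_sub_le_of_abs_le hx3 (abs_mul_le_of_abs_le le_rfl hx2)).trans (le_of_eq (by ring))
  have d3 : |(x 1 : ℝ) * ξ ^ 2 - x 3| ≤ (1 + ξ ^ 2) * L := by
    have e : (x 1 : ℝ) * ξ ^ 2 - x 3 = (x 0 * ξ ^ 3 - x 3) - ξ ^ 2 * (x 0 * ξ - x 1) := by ring
    rw [e]
    refine (abs_sub_le_of_abs_le hx3 (abs_mul_le_of_abs_le (abs_of_nonneg (sq_nonneg ξ)).le
      hx1)).trans (le_of_eq (by ring))
  have hξF : 1 + |ξ| ≤ F := by rw [hFd]; linarith [sq_nonneg ξ]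
  have hξF2 : 1 + ξ ^ 2 ≤ F := by rw [hFd]; linarith
  have hm : ApproxWithin ξ ![x 0, x 1, x 2] (F * L) := by
    have : L ≤ F * L := le_mul_of_one_le_left hL hF1
    exact ⟨by simpa using hx1.trans this, by simpa using hx2.trans this⟩
  have hp : ApproxWithin ξ ![x 1, x 2, x 3] (F * L) :=
    ⟨by simpa using d1.trans (by gcongr), by simpa using d3.trans (by gcongr)⟩
  have hm0 : |((![x 0, x 1, x 2] 0 : ℤ) : ℝ)| ≤ F * X := by
    simpa using hxX.trans (le_mul_of_one_le_left hX hF1)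
  have hp0 : |((![x 1, x 2, x 3] 0 : ℤ) : ℝ)| ≤ F * X := by
    have e : (x 1 : ℝ) = x 0 * ξ - (x 0 * ξ - x 1) := by ring
    have : |(x 1 : ℝ)| ≤ X * |ξ| + L := by
      rw [e]
      exact abs_sub_le_of_abs_le (abs_mul_le_of_abs_le hxX le_rfl) hx1
    have h2 : (1 + |ξ|) * X ≤ F * X := by gcongr
    simp only [Matrix.cons_val_zero]
    linarith
  have hY := h.first_pos k
  have hZ := h.first_pos (k + 1)
  have hT := h.first_pos (k + 2)
  have hYZ : (0 : ℝ) < y k 0 * y (k + 1) 0 := by positivity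
  -- Both halves of `x` are approximations to `(1, ξ, ξ²)`, so their determinants with `y k` and `y
  -- (k + 1)` are integers below 1 in absolute value.
  have hplane : ∀ w : Fin 3 → ℤ, |(w 0 : ℝ)| ≤ F * X → ApproxWithin ξ w (F * L) →
      w ⬝ᵥ (y k ⨯₃ y (k + 1)) = 0 := by
    intro w hw0 hw
    have h1 := h.abs_dot_cross_le hC hF0 hX k hw0 hw
    rw [← Int.abs_lt_one_iff]
    have h2 : |((w ⬝ᵥ (y k ⨯₃ y (k + 1)) : ℤ) : ℝ)| < 1 := by
      refine (h1.trans ?_).trans_lt hsmall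
      rw [← hΓ₁]
      gcongr
      linarith
    exact_mod_cast h2
  have hmk := hplane _ hm0 hm
  have hpk := hplane _ hp0 hp
  constructor
  -- Otherwise both halves would also lie in the next plane, hence both on the line of `y (k + 1)`,
  -- making that point degenerate.
  · by_contra! hlt
    have hplane' : ∀ w : Fin 3 → ℤ, |(w 0 : ℝ)| ≤ F * X → ApproxWithin ξ w (F * L) →
        w ⬝ᵥ (y (k + 1) ⨯₃ y (k + 2)) = 0 := by
      intro w hw0 hw
      have h1 := h.abs_dot_cross_le hC hF0 hX (k + 1) hw0 hw
      rw [← Int.abs_lt_one_iff]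
      have h2 : |((w ⬝ᵥ (y (k + 1) ⨯₃ y (k + 2)) : ℤ) : ℝ)| < 1 := by
        refine (h1.trans ?_).trans_lt hlt
        rw [← hΓ₁]
        gcongr
        linarith
      exact_mod_cast h2
    exact h.not_both_parallel (k + 1) hx0
      (h.cross_eq_zero_of_dot_eq_zero k hmk (hplane' _ hm0 hm))
      (h.cross_eq_zero_of_dot_eq_zero k hpk (hplane' _ hp0 hp))
  · obtain ⟨Q, g, hg, hQg, hQ⟩ := exists_isPrimitivePoint (h.cross_ne_zero k)
    have hdot : ∀ w : Fin 3 → ℤ, w ⬝ᵥ (y k ⨯₃ y (k + 1)) = 0 ↔ w ⬝ᵥ Q = 0 := by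
      intro w
      rw [hQg, dotProduct_smul, smul_eq_zero]
      tauto
    have hQy : y k ⬝ᵥ Q = 0 := (hdot _).1 (dot_self_cross _ _)
    -- The cross product of two vectors of the plane is parallel to its primitive normal `Q`, hence
    -- an integer multiple of it; this defines `t` and `s`.
    have hpar : ∀ w : Fin 3 → ℤ, w ⬝ᵥ (y k ⨯₃ y (k + 1)) = 0 → (w ⨯₃ y k) ⨯₃ Q = 0 := by
      intro w hw
      rw [← neg_cross, cross_cross_eq_zero_of_dot_eq_zero ((hdot w).1 hw) hQy, neg_zero]
    obtain ⟨t, ht⟩ := hQ _ (hpar _ hmk)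
    obtain ⟨s, hs⟩ := hQ _ (hpar _ hpk)
    have hts : t ≠ 0 ∨ s ≠ 0 := by
      by_contra! h0
      rw [h0.1, zero_smul] at ht
      rw [h0.2, zero_smul] at hs
      exact h.not_both_parallel k hx0 ht hs
    -- lower bound for the height of `Q`
    obtain ⟨i, hi0, hiQ⟩ : ∃ i : Fin 3, i ≠ 0 ∧
        (y (k + 1) 0 : ℝ) ≤ 4 * C * E * y k 0 * |(Q i : ℝ)| := by
      have hz := h.approx (k + 1)
      have hw := h.approx (k + 2)
      have hH : |(y (k + 1) 0 : ℝ)| * (C / y (k + 2) 0) + |(y (k + 2) 0 : ℝ)| * (C / y (k + 1) 0) ≤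
          2 * C * E * y k 0 := by
        rw [abs_of_pos hZ, abs_of_pos hT]
        have h1 := (hE k).2
        have h2 := h.le_succ (k + 1)
        have h3 : (y (k + 2) 0 : ℝ) / y (k + 1) 0 ≤ E * y k 0 := by
          rw [div_le_iff₀ hZ]; linarith
        have h4 : (y (k + 1) 0 : ℝ) / y (k + 2) 0 ≤ y (k + 2) 0 / y (k + 1) 0 := by gcongr
        calc _ = C * (y (k + 1) 0 / y (k + 2) 0 : ℝ) + C * (y (k + 2) 0 / y (k + 1) 0 : ℝ) := by
              ring
          _ ≤ C * (E * y k 0) + C * (E * y k 0) := by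
              gcongr
              exact h4.trans h3
          _ = _ := by ring
      have h1 := abs_first_le_of_planes (h.prim (k + 1)) ((hdot _).1 (dot_cross_self _ _))
        (dot_self_cross _ (y (k + 2))) (h.cross_ne_zero (k + 1)) (dot_cross_self _ _)
        (fun h0 => h.det k ((hdot _).2 h0)) (le_max_left |(Q 1 : ℝ)| |(Q 2 : ℝ)|)
        (le_max_right |(Q 1 : ℝ)| |(Q 2 : ℝ)|) ((hz.abs_cross_one_le hw).trans hH)
        ((hz.abs_cross_two_le hw).trans hH)
      rw [abs_of_pos hZ] at h1
      rcases max_choice |(Q 1 : ℝ)| |(Q 2 : ℝ)| with h2 | h2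
      · rw [h2] at h1
        exact ⟨1, by decide, h1.trans (le_of_eq (by ring))⟩
      · rw [h2] at h1
        exact ⟨2, by decide, h1.trans (le_of_eq (by ring))⟩
    have hy := h.approx k
    have b1 := h.abs_second_le hC k
    have b2 := h.abs_third_le hC k
    have hQi0 : 0 < |(Q i : ℝ)| := by
      by_contra! h0
      have h1 : |(Q i : ℝ)| = 0 := le_antisymm h0 (abs_nonneg _)
      rw [h1, mul_zero] at hiQ
      linarith
    have htQ : |(t : ℝ)| * |(Q i : ℝ)| ≤ F * (C + 1) * (X / y k 0 + y k 0 * L) := by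
      have e : (t : ℝ) * Q i = (((![x 0, x 1, x 2] ⨯₃ y k) i : ℤ) : ℝ) := by
        rw [ht]; simp
      rw [← abs_mul, e]
      have hb : |((![x 0, x 1, x 2] 0 : ℤ) : ℝ)| * (C / y k 0) + |(y k 0 : ℝ)| * (F * L) ≤
          F * (C + 1) * (X / y k 0 + y k 0 * L) := by
        rw [abs_of_pos hY]
        have h3 : 0 ≤ X / y k 0 := by positivity
        have h4 : 0 ≤ y k 0 * L := by positivity
        calc _ ≤ F * X * (C / y k 0) + (y k 0 : ℝ) * (F * L) := by gcongr
          _ = F * C * (X / y k 0) + F * (y k 0 * L) := by ring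
          _ ≤ F * C * (X / y k 0) + F * (y k 0 * L) +
              (F * (X / y k 0) + F * C * (y k 0 * L)) := le_add_of_nonneg_right (by positivity)
          _ = _ := by ring
      fin_cases i
      · exact absurd rfl hi0
      · exact (hm.abs_cross_one_le hy).trans hb
      · exact (hm.abs_cross_two_le hy).trans hb
    -- In `ξ` times the first cross product minus the second, the coordinates of `x` enter only
    -- through the errors `x j * ξ - x (j + 1)`, so no factor `X` appears.
    have hsQ : |(t : ℝ) * ξ - s| * |(Q i : ℝ)| ≤ (2 * F + C) * (L * y k 0) := by
      have e : ((t : ℝ) * ξ - s) * Q i = ξ * (((![x 0, x 1, x 2] ⨯₃ y k) i : ℤ) : ℝ) -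
          (((![x 1, x 2, x 3] ⨯₃ y k) i : ℤ) : ℝ) := by
        rw [ht, hs]; simp; ring
      rw [← abs_mul, e]
      have hF1' : |ξ| ≤ F := by linarith
      have hF2' : ξ ^ 2 ≤ F := by linarith
      fin_cases i
      · exact absurd rfl hi0
      · have e1 : ξ * (((![x 0, x 1, x 2] ⨯₃ y k) 1 : ℤ) : ℝ) -
            (((![x 1, x 2, x 3] ⨯₃ y k) 1 : ℤ) : ℝ) =
            (x 2 * ξ - x 3) * y k 0 - (x 0 * ξ - x 1) * y k 2 := by
          simp [cross_apply]; ring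
        refine (le_of_eq (congrArg abs e1)).trans ((abs_sub_le_of_abs_le
          (abs_mul_le_of_abs_le d2 (abs_of_pos hY).le) (abs_mul_le_of_abs_le hx1 b2)).trans ?_)
        calc _ = ((1 + |ξ|) + (ξ ^ 2 + C)) * (L * y k 0) := by ring
          _ ≤ (F + (F + C)) * (L * y k 0) := by gcongr
          _ = _ := by ring
      · have e1 : ξ * (((![x 0, x 1, x 2] ⨯₃ y k) 2 : ℤ) : ℝ) -
            (((![x 1, x 2, x 3] ⨯₃ y k) 2 : ℤ) : ℝ) =
            (x 0 * ξ - x 1) * y k 1 - (x 1 * ξ - x 2) * y k 0 := by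
          simp [cross_apply]; ring
        refine (le_of_eq (congrArg abs e1)).trans ((abs_sub_le_of_abs_le
          (abs_mul_le_of_abs_le hx1 b1) (abs_mul_le_of_abs_le d1 (abs_of_pos hY).le)).trans ?_)
        calc _ = ((|ξ| + C) + (1 + |ξ|)) * (L * y k 0) := by ring
          _ ≤ ((F + C) + F) * (L * y k 0) := by gcongr
          _ = _ := by ring
    have hdiv : ∀ u v : ℝ, 0 ≤ u → u * |(Q i : ℝ)| ≤ v →
        u ≤ 4 * C * E * (v * (y k 0 / y (k + 1) 0)) := by
      intro u v hu huv
      rw [← mul_div_assoc, ← mul_div_assoc, le_div_iff₀ hZ]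
      calc u * y (k + 1) 0 ≤ u * (4 * C * E * y k 0 * |(Q i : ℝ)|) := by gcongr
        _ = 4 * C * E * y k 0 * (u * |(Q i : ℝ)|) := by ring
        _ ≤ 4 * C * E * y k 0 * v := by gcongr
        _ = _ := by ring
    refine ⟨t, s, hts, ?_, ?_⟩
    · refine (hdiv _ _ (abs_nonneg _) htQ).trans ?_
      calc _ = Γ₂ * ((X / y k 0 + y k 0 * L) * (y k 0 / y (k + 1) 0)) := by rw [hΓ₂]; ring
        _ ≤ _ := by
          gcongr
          linarith
    · refine (hdiv _ _ (abs_nonneg _) hsQ).trans ?_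
      calc _ = Γ₃ * (L * y k 0 * (y k 0 / y (k + 1) 0)) := by rw [hΓ₃]; ring
        _ ≤ _ := by
          gcongr
          linarith

set_option maxHeartbeats 1000000 in
/-- The upper bound for the exponent `λ_3`. -/
lemma not_frequently_simApproxSolvable (h : IsExtremalSequence ξ C y) (hC : 0 < C)
    (hξ : Irrational ξ) {μ : ℝ} (hμ1 : 2 / 5 ≤ μ) (hμ2 : μ ≤ 1)
    (hμ : 1 / Real.goldenRatio / μ + 1 / Real.goldenRatio < 2) :
    ¬ ∃ᶠ X : ℝ in atTop, SimApproxSolvable (veronesePoint 3 ξ) μ X := by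
  intro hfreq
  obtain ⟨hl35, hl23⟩ := inv_goldenRatio_bounds
  have hYZl := h.le_rpow_succ hC
  have hZYl := h.rpow_succ_le hC
  obtain ⟨l, hl⟩ : ∃ l, l = 1 / Real.goldenRatio := ⟨_, rfl⟩
  rw [← hl] at hl35 hl23 hμ hYZl hZYl
  obtain ⟨E, hE1, hE⟩ := h.exists_mul_comparable hC
  obtain ⟨Γ, hΓ1, hcore⟩ := h.exists_of_approx_cube hC
  -- For `κ Z ≤ X < κ T` this bounds the contributions of `X / (Y Z)` and `X / (Z T)`, after
  -- multiplication by `Γ`, by `1 / 4`.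
  obtain ⟨κ, hκ⟩ : ∃ κ, κ = 1 / (4 * Γ * E) := ⟨_, rfl⟩
  have hκ0 : 0 < κ := by rw [hκ]; positivity
  have hκΓE : Γ * (E * κ) = 1 / 4 := by rw [hκ]; field_simp
  have hκE : E * κ ≤ 1 := by nlinarith [mul_pos (by linarith : 0 < E) hκ0]
  have hκΓ : Γ * κ ≤ 1 / 4 := by nlinarith [mul_pos (by linarith : 0 < Γ) hκ0]
  obtain ⟨c₀, hc₀⟩ : ∃ c₀, c₀ = C ^ l := ⟨_, rfl⟩
  have hc₀0 : 0 < c₀ := by rw [hc₀]; positivity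
  rw [← hc₀] at hYZl hZYl
  obtain ⟨b, hb⟩ : ∃ b, b = κ ^ (-μ) := ⟨_, rfl⟩
  have hb0 : 0 < b := by rw [hb]; positivity
  have hμ0 : 0 < μ := by linarith
  obtain ⟨A, hA⟩ : ∃ A, A = (2 * Γ * E * c₀) ^ (1 / μ) := ⟨_, rfl⟩
  have hA0 : 0 < A := by rw [hA]; positivity
  -- These are the savings in `Z` for the two parts `X L (Y / Z)²` and `(Y L)² (Y / Z)²` of `|t| *
  -- |t ξ - s|`. The first is positive by `hμ`, the second by `μ ≥ 2 / 5` and `l < 2 / 3`.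
  obtain ⟨η, hη⟩ : ∃ η, η = min (2 - l - l / μ) (2 + 2 * μ - 4 * l) := ⟨_, rfl⟩
  have hη0 : 0 < η := by rw [hη]; exact lt_min (by linarith) (by linarith)
  -- Since `|t| ≪ Z²`, the choice `δ = η / 4` costs at most `Z ^ (η / 2)`, half of the saving.
  obtain ⟨c, hc, hlow⟩ := h.exists_pos_mul_rpow_le hC hξ (δ := η / 4) (by linarith)
  obtain ⟨K, hK⟩ : ∃ K, K = Γ ^ 2 * (A ^ (1 - μ) * c₀ ^ 2 + b ^ 2 * c₀ ^ 4) := ⟨_, rfl⟩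
  have hK0 : 0 < K := by rw [hK]; positivity
  obtain ⟨B₁, hB₁1, hB₁⟩ := exists_mul_rpow_neg_lt (Γ * (b * c₀)) (s := μ - (1 - l)) (by linarith)
    (by norm_num : (0 : ℝ) < 1 / 2)
  obtain ⟨B₂, hB₂1, hB₂⟩ := exists_mul_rpow_neg_lt (Γ * (b * c₀ ^ 2)) (s := μ + 1 - 2 * l)
    (by linarith) one_pos
  obtain ⟨B₃, hB₃1, hB₃⟩ := exists_mul_rpow_neg_lt (K * (2 * Γ) ^ (η / 4)) (s := η / 2)
    (by linarith) hc
  -- The threshold is squared because `Z` is only known to satisfy `X ≤ Z²`.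
  obtain ⟨X, hX0, ⟨x, w, hx1, hxX, hx⟩⟩ :=
    frequently_atTop.1 hfreq (max (max B₁ (max B₂ B₃) ^ 2) (κ * y 1 0))
  obtain ⟨k, hk1, hk2⟩ := exists_le_lt_succ (f := fun k => κ * y (k + 1) 0) (fun B => by
    obtain ⟨n, hn⟩ := h.exists_lt_first (B / κ)
    exact ⟨n, by have := hn (n + 1) (by omega); rwa [div_lt_iff₀ hκ0, mul_comm] at this⟩)
    ((le_max_right _ _).trans hX0)
  have hX1 : 1 ≤ X := hx1.trans hxX
  have hXpos : 0 < X := by linarith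
  have hxne : x ≠ 0 := by rintro rfl; norm_num at hx1
  have hL1 : X ^ (-μ) ≤ 1 := Real.rpow_le_one_of_one_le_of_nonpos hX1 (by linarith)
  have hcore := hcore k X (X ^ (-μ)) ![x, w 0, w 1, w 2] hxne hxX (hL1.trans hX1) (by
    intro j
    have h0 := hx 0
    have h1 := hx 1
    have h2 := hx 2
    simp only [veronesePoint, Fin.val_zero, Fin.val_one, Fin.val_two, Nat.reduceAdd, zero_add,
      mul_comm _ (x : ℝ)] at h0 h1 h2
    fin_cases j
    · simp; positivity
    · simpa using h0
    · simpa using h1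
    · simpa using h2)
  have hY1 := h.one_le k
  have hZ := h.first_pos (k + 1)
  have hT := h.first_pos (k + 2)
  obtain ⟨hE2, hE3⟩ := hE k
  have hle := h.le_succ k
  have hYZl := hYZl k
  have hZYl := hZYl k
  generalize ((y k 0 : ℤ) : ℝ) = Y at *
  generalize ((y (k + 1) 0 : ℤ) : ℝ) = Z at *
  generalize ((y (k + 2) 0 : ℤ) : ℝ) = T at *
  have hY : 0 < Y := by linarith
  have hZ1 : 1 ≤ Z := hY1.trans hle
  have hXT : X < κ * T := hk2
  have hXZ : κ * Z ≤ X := hk1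
  have hXZ2 : X ≤ Z ^ 2 := by
    calc X ≤ κ * T := hXT.le
      _ ≤ κ * (E * (Y * Z)) := by gcongr
      _ = (E * κ) * (Y * Z) := by ring
      _ ≤ 1 * (Z * Z) := by gcongr
      _ = Z ^ 2 := by ring
  have hBZ : max B₁ (max B₂ B₃) ≤ Z :=
    le_of_sq_le_sq (((le_max_left _ _).trans hX0).trans hXZ2) hZ.le
  have hB₁ := hB₁ Z ((le_max_left _ _).trans hBZ)
  have hB₂ := hB₂ Z (((le_max_left _ _).trans (le_max_right _ _)).trans hBZ)
  have hB₃ := hB₃ Z (((le_max_right _ _).trans (le_max_right _ _)).trans hBZ)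
  obtain ⟨L, hL⟩ : ∃ L, L = X ^ (-μ) := ⟨_, rfl⟩
  rw [← hL] at hcore hL1
  have hL0 : 0 < L := by rw [hL]; positivity
  have hLZ : L ≤ b * Z ^ (-μ) := by
    rw [hL, hb, ← Real.mul_rpow hκ0.le hZ.le]
    exact Real.rpow_le_rpow_of_nonpos (by positivity) hXZ (by linarith)
  have hZY : Z / Y ≤ c₀ * Z ^ (1 - l) := by
    rw [div_le_iff₀ hY]
    calc Z = Z ^ (1 - l) * Z ^ l := by rw [← Real.rpow_add hZ, sub_add_cancel, Real.rpow_one]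
      _ ≤ Z ^ (1 - l) * (c₀ * Y) := by gcongr
      _ = _ := by ring
  have hYZ' : Y / Z ≤ c₀ * Z ^ (-(1 - l)) := by
    rw [div_le_iff₀ hZ]
    calc Y ≤ c₀ * Z ^ l := hYZl
      _ = c₀ * (Z ^ (-(1 - l)) * Z ^ (1 : ℝ)) := by
        rw [← Real.rpow_add hZ]; congr 2; ring
      _ = _ := by rw [Real.rpow_one]; ring
  obtain ⟨ha, t, s, hts, ht, hs⟩ := hcore (by
    have h1 : X / (Y * Z) ≤ E * κ := by
      rw [div_le_iff₀ (by positivity)]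
      calc X ≤ κ * T := hXT.le
        _ ≤ κ * (E * (Y * Z)) := by gcongr
        _ = _ := by ring
    have h2 : L * (Z / Y) ≤ b * c₀ * Z ^ (-(μ - (1 - l))) := by
      calc L * (Z / Y) ≤ b * Z ^ (-μ) * (c₀ * Z ^ (1 - l)) := by gcongr
        _ = b * c₀ * (Z ^ (-μ) * Z ^ (1 - l)) := by ring
        _ = _ := by rw [← Real.rpow_add hZ]; congr 2; ring
    calc Γ * (X / (Y * Z) + L * (Z / Y)) ≤ Γ * (E * κ + b * c₀ * Z ^ (-(μ - (1 - l)))) := by gcongr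
      _ = Γ * (E * κ) + Γ * (b * c₀) * Z ^ (-(μ - (1 - l))) := by ring
      _ < 1 := by rw [hκΓE]; linarith)
  -- Not lying in the next plane forces `L * (T / Z) ≫ 1`; as `T / Z ≪ Y ≪ Z ^ l`, this reads `X ^ μ
  -- ≪ Z ^ l`.
  have hXbound : X ≤ A * Z ^ (l / μ) := by
    have h1 : Γ * (X / (Z * T)) ≤ 1 / 4 := by
      have : X / (Z * T) ≤ κ := by
        rw [div_le_iff₀ (by positivity)]
        calc X ≤ κ * (1 * T) := by linarith
          _ ≤ κ * (Z * T) := by gcongr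
      calc Γ * (X / (Z * T)) ≤ Γ * κ := by gcongr
        _ ≤ _ := hκΓ
    have h2 : T / Z ≤ E * Y := by rw [div_le_iff₀ hZ]; linarith
    have h3 : 1 ≤ 2 * Γ * E * c₀ * Z ^ l * L := by
      have h4 : 1 ≤ 2 * (Γ * (L * (T / Z))) := by linarith
      calc 1 ≤ 2 * (Γ * (L * (T / Z))) := h4
        _ ≤ 2 * (Γ * (L * (E * (c₀ * Z ^ l)))) := by
          gcongr
          exact h2.trans (by gcongr)
        _ = _ := by ring
    have h4 : X ^ μ ≤ 2 * Γ * E * c₀ * Z ^ l := by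
      rwa [hL, Real.rpow_neg hXpos.le, ← div_eq_mul_inv, one_le_div (by positivity)] at h3
    calc X = (X ^ μ) ^ (1 / μ) := by
          rw [← Real.rpow_mul hXpos.le, mul_one_div_cancel hμ0.ne', Real.rpow_one]
      _ ≤ (2 * Γ * E * c₀ * Z ^ l) ^ (1 / μ) := by gcongr
      _ = _ := by
        rw [Real.mul_rpow (by positivity) (by positivity), ← Real.rpow_mul hZ.le, hA]
        congr 2; ring
  have hXL : X * L ≤ A ^ (1 - μ) * Z ^ (l / μ - l) := by
    calc X * L = X ^ (1 - μ) := by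
          rw [hL, sub_eq_add_neg, Real.rpow_add hXpos, Real.rpow_one]
      _ ≤ (A * Z ^ (l / μ)) ^ (1 - μ) := by
          gcongr
      _ = _ := by
        rw [Real.mul_rpow hA0.le (by positivity), ← Real.rpow_mul hZ.le]
        congr 2
        field_simp
  have hYZ2 : (Y / Z) ^ 2 ≤ c₀ ^ 2 * Z ^ (2 * l - 2) := by
    calc (Y / Z) ^ 2 ≤ (c₀ * Z ^ (-(1 - l))) ^ 2 := by gcongr
      _ = _ := by
        rw [mul_pow, ← Real.rpow_natCast (Z ^ _), ← Real.rpow_mul hZ.le]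
        congr 2; push_cast; ring
  have hYL : (Y * L) ^ 2 ≤ b ^ 2 * c₀ ^ 2 * Z ^ (2 * l - 2 * μ) := by
    calc (Y * L) ^ 2 ≤ ((c₀ * Z ^ l) * (b * Z ^ (-μ))) ^ 2 := by gcongr
      _ = b ^ 2 * c₀ ^ 2 * (Z ^ l * Z ^ (-μ)) ^ 2 := by ring
      _ = _ := by
        rw [← Real.rpow_add hZ, ← Real.rpow_natCast (Z ^ _), ← Real.rpow_mul hZ.le]
        congr 2; push_cast; ring
  have hprod : |(t : ℝ)| * |(t : ℝ) * ξ - s| ≤ K * Z ^ (-η) := by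
    calc |(t : ℝ)| * |(t : ℝ) * ξ - s|
        ≤ Γ * ((X / Y + Y * L) * (Y / Z)) * (Γ * (L * Y * (Y / Z))) := by gcongr
      _ = Γ ^ 2 * ((X * L + (Y * L) ^ 2) * (Y / Z) ^ 2) := by field_simp
      _ ≤ Γ ^ 2 * ((A ^ (1 - μ) * Z ^ (l / μ - l) + b ^ 2 * c₀ ^ 2 * Z ^ (2 * l - 2 * μ)) *
          (c₀ ^ 2 * Z ^ (2 * l - 2))) := by gcongr
      _ = Γ ^ 2 * (A ^ (1 - μ) * c₀ ^ 2 * (Z ^ (l / μ - l) * Z ^ (2 * l - 2)) +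
          b ^ 2 * c₀ ^ 4 * (Z ^ (2 * l - 2 * μ) * Z ^ (2 * l - 2))) := by ring
      _ ≤ Γ ^ 2 * (A ^ (1 - μ) * c₀ ^ 2 * Z ^ (-η) + b ^ 2 * c₀ ^ 4 * Z ^ (-η)) := by
        rw [← Real.rpow_add hZ, ← Real.rpow_add hZ]
        have h1 : η ≤ 2 - l - l / μ := hη ▸ min_le_left _ _
        have h2 : η ≤ 2 + 2 * μ - 4 * l := hη ▸ min_le_right _ _
        have e1 : Z ^ (l / μ - l + (2 * l - 2)) ≤ Z ^ (-η) :=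
          Real.rpow_le_rpow_of_exponent_le hZ1 (by linarith)
        have e2 : Z ^ (2 * l - 2 * μ + (2 * l - 2)) ≤ Z ^ (-η) :=
          Real.rpow_le_rpow_of_exponent_le hZ1 (by linarith)
        gcongr
      _ = _ := by rw [hK]; ring
  have hs1 : |(t : ℝ) * ξ - s| < 1 := by
    refine (hs.trans ?_).trans_lt hB₂
    calc Γ * (L * Y * (Y / Z)) ≤ Γ * (b * Z ^ (-μ) * (c₀ * Z ^ l) * (c₀ * Z ^ (-(1 - l)))) := by
          gcongr
      _ = Γ * (b * c₀ ^ 2) * (Z ^ (-μ) * Z ^ l * Z ^ (-(1 - l))) := by ring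
      _ = _ := by
        rw [← Real.rpow_add hZ, ← Real.rpow_add hZ]
        congr 2; ring
  have ht0 : t ≠ 0 := by
    rintro rfl
    rw [Int.cast_zero, zero_mul, zero_sub, abs_neg] at hs1
    have hs0 : s = 0 := Int.abs_lt_one_iff.1 (by exact_mod_cast hs1)
    tauto
  have htpos : 0 < |(t : ℝ)| := abs_pos.2 (by exact_mod_cast ht0)
  have htZ : |(t : ℝ)| ≤ 2 * Γ * Z ^ 2 := by
    refine ht.trans ?_
    have h1 : Y / Z ≤ 1 := by rwa [div_le_one hZ]
    have h2 : X / Y ≤ Z ^ 2 := (div_le_self hXpos.le hY1).trans hXZ2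
    have h3 : Y * L ≤ Z ^ 2 := by
      calc Y * L ≤ Z * 1 := by gcongr
        _ ≤ Z * Z := by gcongr
        _ = _ := by ring
    calc Γ * ((X / Y + Y * L) * (Y / Z)) ≤ Γ * ((Z ^ 2 + Z ^ 2) * 1) := by gcongr
      _ = _ := by ring
  have hfin : c ≤ K * (2 * Γ) ^ (η / 4) * Z ^ (-(η / 2)) := by
    have h1 := hlow t s ht0
    rw [Real.rpow_neg htpos.le, ← div_eq_mul_inv, div_le_iff₀ (by positivity),
      Real.rpow_add htpos, Real.rpow_one] at h1
    calc c ≤ |(t : ℝ) * ξ - s| * (|(t : ℝ)| * |(t : ℝ)| ^ (η / 4)) := h1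
      _ = |(t : ℝ)| * |(t : ℝ) * ξ - s| * |(t : ℝ)| ^ (η / 4) := by ring
      _ ≤ K * Z ^ (-η) * (2 * Γ * Z ^ 2) ^ (η / 4) := by gcongr
      _ = K * (2 * Γ) ^ (η / 4) * (Z ^ (-η) * Z ^ (2 * (η / 4))) := by
        rw [Real.mul_rpow (by positivity) (by positivity), ← Real.rpow_natCast Z 2,
          ← Real.rpow_mul hZ.le]
        push_cast; ring
      _ = _ := by
        rw [← Real.rpow_add hZ]
        congr 2; ring
  linarith

end IsExtremalSequence

/-! ### Exponents of extremal numbers and conclusion -/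

lemma IsExtremalNumber.notQuadratic {ξ : ℝ} (h : IsExtremalNumber ξ) : NotQuadratic ξ :=
  notQuadratic_of_polynomial h.1

lemma IsExtremalNumber.uniformExponent_eq {ξ : ℝ} (h : IsExtremalNumber ξ) :
    uniformExponent 2 ξ = ((1 / Real.goldenRatio : ℝ) : EReal) := by
  obtain ⟨hl35, hl23⟩ := inv_goldenRatio_bounds
  have hsq := inv_goldenRatio_sq_add
  have hξ := h.notQuadratic
  obtain ⟨-, c, hc, hX⟩ := h
  set l := 1 / Real.goldenRatio with hl
  refine le_antisymm ?_ ?_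
  · by_contra! hlt
    -- The cap `2 / 3` keeps `m` below 1, as the Davenport–Schmidt inequality requires; `m > l` then
    -- violates it because `l² + l = 1`.
    obtain ⟨m, hm1, hm2⟩ := EReal.lt_iff_exists_real_btwn.1
      (lt_min hlt (by exact_mod_cast hl23 : ((l : ℝ) : EReal) < ((2 / 3 : ℝ) : EReal)))
    have h1 : l < m := by exact_mod_cast hm1
    have h2 : m < 2 / 3 := by exact_mod_cast hm2.trans_le (min_le_right _ _)
    have h3 := uniformExponent_sq_add_le_one hξ (by linarith) (by linarith)
      (hm2.trans_le (min_le_left _ _))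
    nlinarith
  · refine EReal.ge_of_forall_gt_iff_ge.1 fun m hm => le_uniformExponentVec ?_
    have hm : m < l := by exact_mod_cast hm
    obtain ⟨B, hB1, hB⟩ := exists_mul_rpow_neg_lt c (sub_pos.2 hm) one_pos
    filter_upwards [eventually_ge_atTop B] with X hXB
    have hX1 : 1 ≤ X := hB1.trans hXB
    have hX0 : 0 < X := by linarith
    obtain ⟨x₀, x₁, x₂, h1, h2, h3, h4⟩ := hX X hX1
    have hle : c * X ^ (-l) ≤ X ^ (-m) := by
      have h5 := (hB X hXB).le
      have e : X ^ (-(l - m)) = X ^ (-l) * X ^ m := by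
        rw [← Real.rpow_add hX0]; congr 1; ring
      rw [e, ← mul_assoc] at h5
      rw [Real.rpow_neg hX0.le m, ← one_div, le_div_iff₀ (by positivity)]
      exact h5
    refine ⟨x₀, ![x₁, x₂], h1, h2, fun j => ?_⟩
    fin_cases j
    · simpa [veronesePoint, mul_comm] using h3.trans hle
    · simpa [veronesePoint, mul_comm] using h4.trans hle

/-- The condition `l / μ + l < 2` under which the exponent `μ` was excluded is exactly `μ > l / (2 -
l)`. -/
lemma IsExtremalNumber.ordinaryExponent_three_le {ξ : ℝ} (h : IsExtremalNumber ξ) :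
    ordinaryExponent 3 ξ ≤ (((1 / Real.goldenRatio) / (2 - 1 / Real.goldenRatio) : ℝ) : EReal) := by
  obtain ⟨hl35, hl23⟩ := inv_goldenRatio_bounds
  have hξ := h.notQuadratic
  obtain ⟨-, c, hc, hX⟩ := h
  obtain ⟨z, hz⟩ := UniformlyApproximable.exists_isDyadicSequence hX
  obtain ⟨C, y, hC, hy⟩ := hz.exists_isExtremalSequence hc hξ
  set l := 1 / Real.goldenRatio with hl
  by_contra! hlt
  have h1 : l / (2 - l) < 1 / 2 := by rw [div_lt_div_iff₀ (by linarith) (by norm_num)]; linarith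
  obtain ⟨m, hm1, hm2⟩ := EReal.lt_iff_exists_real_btwn.1
    (lt_min hlt (by exact_mod_cast h1 : ((l / (2 - l) : ℝ) : EReal) < ((1 / 2 : ℝ) : EReal)))
  have h2 : l / (2 - l) < m := by exact_mod_cast hm1
  have h3 : m < 1 / 2 := by exact_mod_cast hm2.trans_le (min_le_right _ _)
  rw [div_lt_iff₀ (by linarith)] at h2
  have hm : 2 / 5 ≤ m := by nlinarith
  refine hy.not_frequently_simApproxSolvable hC hξ.irrational hm (by linarith) ?_
    (frequently_of_lt_ordinaryExponentVec (hm2.trans_le (min_le_left _ _)))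
  rw [← hl]
  have : l / m < 2 - l := by
    rw [div_lt_iff₀ (by linarith)]
    linarith
  linarith

theorem mainTheorem2 (ξ : ℝ) :
    (Irrational ξ →
      ∃ l : ℝ, uniformExponent 2 ξ = (l : EReal) ∧
        (((-l ^ 2 + 3 * l - 1) / (3 * l ^ 2 - 5 * l + 3) : ℝ) : EReal) ≤ ordinaryExponent 3 ξ ∧
        (((-2 * l ^ 2 + 5 * l - 2) / (4 * l ^ 2 - 7 * l + 4) : ℝ) : EReal)
          ≤ ordinaryExponent 4 ξ ∧
        (IsExtremalNumber ξ →
          ordinaryExponent 3 ξ =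
            (((-l ^ 2 + 3 * l - 1) / (3 * l ^ 2 - 5 * l + 3) : ℝ) : EReal))) ∧
    (¬ Irrational ξ →
      uniformExponent 2 ξ = ⊤ ∧ ordinaryExponent 3 ξ = ⊤ ∧ ordinaryExponent 4 ξ = ⊤) := by
  refine ⟨fun hirr => ?_, fun hrat => ⟨(exponents_eq_top_of_rational hrat 2).1,
    (exponents_eq_top_of_rational hrat 3).2, (exponents_eq_top_of_rational hrat 4).2⟩⟩
  have hle1 := uniformExponent_two_le_one hirr
  have hge0 : 0 ≤ uniformExponent 2 ξ := uniformExponentVec_nonneg _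
  by_cases hquad : ∀ p : Polynomial ℤ, p ≠ 0 → p.natDegree ≤ 2 → Polynomial.aeval ξ p ≠ 0
  · have hξ := notQuadratic_of_polynomial hquad
    obtain ⟨l, hl⟩ : ∃ l : ℝ, uniformExponent 2 ξ = l :=
      ⟨(uniformExponent 2 ξ).toReal, (EReal.coe_toReal
        (hle1.trans_lt (EReal.coe_lt_top 1)).ne ((EReal.bot_lt_coe 0).trans_le hge0).ne').symm⟩
    have hl1 : l ≤ 1 := by
      rw [hl] at hle1
      exact_mod_cast hle1
    have hd3 : ∀ x : ℝ, 0 < 3 * x ^ 2 - 5 * x + 3 := fun x => by nlinarith [sq_nonneg (6 * x - 5)]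
    have hd4 : ∀ x : ℝ, 0 < 4 * x ^ 2 - 7 * x + 4 := fun x => by nlinarith [sq_nonneg (8 * x - 7)]
    have hb3 : (((-l ^ 2 + 3 * l - 1) / (3 * l ^ 2 - 5 * l + 3) : ℝ) : EReal) ≤
        ordinaryExponent 3 ξ := by
      refine le_ordinaryExponent_of_uniformExponent_eq hξ hl1 hl (n := 2) (by norm_num)
        (f := fun x => (-x ^ 2 + 3 * x - 1) / (3 * x ^ 2 - 5 * x + 3)) ?_ fun x hx => ?_
      · exact ContinuousAt.div (by fun_prop) (by fun_prop) (hd3 l).ne'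
      · have h1 : (1 - x) ≠ 0 := by linarith
        have h2 := hd3 x
        have e1 : x / (1 - x) ^ 2 + 1 - ((2 : ℕ) : ℝ) = (-x ^ 2 + 3 * x - 1) / (1 - x) ^ 2 := by
          field_simp; push_cast; ring
        have e2 : x / (1 - x) ^ 2 + ((2 : ℕ) : ℝ) + 1 = (3 * x ^ 2 - 5 * x + 3) / (1 - x) ^ 2 := by
          field_simp; push_cast; ring
        simp only [e1, e2]
        rw [div_div_div_cancel_right₀ (pow_ne_zero 2 h1)]
    refine ⟨l, hl, hb3, ?_, fun hext => le_antisymm ?_ hb3⟩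
    · refine le_ordinaryExponent_of_uniformExponent_eq hξ hl1 hl (n := 3) (by norm_num)
        (f := fun x => (-2 * x ^ 2 + 5 * x - 2) / (4 * x ^ 2 - 7 * x + 4)) ?_ fun x hx => ?_
      · exact ContinuousAt.div (by fun_prop) (by fun_prop) (hd4 l).ne'
      · have h1 : (1 - x) ≠ 0 := by linarith
        have h2 := hd4 x
        have e1 : x / (1 - x) ^ 2 + 1 - ((3 : ℕ) : ℝ) = (-2 * x ^ 2 + 5 * x - 2) / (1 - x) ^ 2 := by
          field_simp; push_cast; ring
        have e2 : x / (1 - x) ^ 2 + ((3 : ℕ) : ℝ) + 1 = (4 * x ^ 2 - 7 * x + 4) / (1 - x) ^ 2 := by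
          field_simp; push_cast; ring
        simp only [e1, e2]
        rw [div_div_div_cancel_right₀ (pow_ne_zero 2 h1)]
    · have hlg : l = 1 / Real.goldenRatio := by
        have := hl.symm.trans hext.uniformExponent_eq
        exact_mod_cast this
      refine hext.ordinaryExponent_three_le.trans (le_of_eq ?_)
      rw [← hlg]
      have hsq := inv_goldenRatio_sq_add
      rw [← hlg] at hsq
      congr 1
      rw [div_eq_div_iff (by linarith) (hd3 l).ne']
      -- After cross-multiplication the two sides differ by `2 (l - 1) (l² + l - 1)`.
      linear_combination 2 * (l - 1) * hsq
  · push Not at hquad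
    obtain ⟨p, hp0, hpd, hp⟩ := hquad
    obtain ⟨a, b, c, ha, habc⟩ := exists_int_quadratic hirr hp0 hpd hp
    have hN : ∀ N, 1 ≤ uniformExponent N ξ := one_le_uniformExponent_of_quadratic ha habc
    have hN' : ∀ N, 1 ≤ ordinaryExponent N ξ := fun N =>
      (hN N).trans (uniformExponentVec_le_ordinaryExponentVec _)
    -- For quadratic `ξ` the uniform exponent is 1, where both fractions take the value 1.
    refine ⟨1, le_antisymm (by exact_mod_cast hle1) (by exact_mod_cast hN 2), ?_, ?_,
      fun hext => absurd hp (hext.1 p hp0 hpd)⟩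
    · norm_num
      exact hN' 3
    · norm_num
      exact hN' 4
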